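/- Let $Q$ be a finite quiver, let $\mathbb{C}Q$ be its path algebra, graded by the length of paths, and let $A=\mathbb{C}Q/\mathcal{I}$ be the quotient by a graded two-sided ideal. Let $S=A_0$ be the subring of $A$ generated by the (images of the) vertices. All bimodules are over $\mathbb{C}$, i.e. $\mathbb{C}$ acts centrally. Let $\mathcal{P}$ be the class of $A$-bimodules isomorphic to $F_T=A\otimes_S T\otimes_S A$ for a finite dimensional $S$-bimodule $T$. For an $A$-bimodule $M$ let $M^\vee=\mathrm{Hom}_{A-A}(M,A\otimes A)$, where the homomorphisms are taken for the outer structure $a_1(b_1\otimes b_2)a_2=a_1b_1\otimes b_2a_2$, and $M^\vee$ is an $A$-bimodule through the inner structure $a_1(b_1\otimes b_2)a_2=b_1a_2\otimes a_1b_2$; for $f:M\to N$ let $f^\vee:N^\vee\to M^\vee$, $\nu\mapsto\nu\circ f$. Suppose that the $A$-bimodule $A$ has a projective resolution $P_n\xrightarrow{d_n}P_{n-1}\to\cdots\xrightarrow{d_1}P_0$ with all $P_i\in\mathcal{P}$ which is selfdual with shift $n$: there are bimodule isomorphisms $\alpha_i:P_i\to P_{n-i}^\vee$ $(0\le i\le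 n)$ with $\alpha_{i-1}\circ d_i=-d_{n-i+1}^\vee\circ\alpha_i$ for $1\le i\le n$. A $\mathbb{C}$-linear category with shift functors is called Calabi–Yau of dimension $n$ if its $n$-th shift is a Serre functor, i.e. its Hom-spaces are finite dimensional and there are linear isomorphisms $\mathrm{Hom}(X,Y)\cong\mathrm{Hom}(Y,X[n])^*$ natural in $X$ and $Y$. Let $\mathcal{D}^b_{fd}(\mathrm{Mod}\,A)$ be the full subcategory of the derived category of left $A$-modules on the bounded objects all of whose cohomology modules are finite dimensional over $\mathbb{C}$, and let $\mathcal{D}^b(\mathrm{Rep}\,A)$ be the bounded derived category of the abelian category $\mathrm{Rep}\,A$ of finite dimensional left $A$-modules. Then: 1. $\mathcal{D}^b_{fd}(\mathrm{Mod}\,A)$ is Calabi–Yau of dimension $n$. 2. If the functor $\mathcal{D}^b(\mathrm{Rep}\,A)\to\mathcal{D}(\mathrm{Mod}\,A)$ induced by the inclusion is fully faithful (that is, morphisms in $\mathcal{D}^b(\mathrm{Rep}\,A)$ may be computed in the derived category of all $A$-modules), then $\mathcal{D}^b(\mathrm{Rep}\,A)$ is Calabi–Yau of dimension $n$. -/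

import Mathlib

open CategoryTheory Limits TensorProduct MulOpposite

/-! ### Path algebras -/

/-- The paths of a quiver: `⟨i, j, p⟩` is a path with tail `i` and head `j`. -/
abbrev QuiverPath (V : Type*) [Quiver V] := Σ i j : V, Quiver.Path i j

/-- The path algebra `ℂQ` as a vector space: its basis is the set of paths of `Q`. -/
def PathAlgebra (V : Type*) [Quiver V] := QuiverPath V →₀ ℂ

namespace PathAlgebra

variable {V : Type*} [Quiver V]

noncomputable instance : AddCommGroup (PathAlgebra V) :=
  inferInstanceAs (AddCommGroup (QuiverPath V →₀ ℂ))

noncomputable instance : Module ℂ (PathAlgebra V) :=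
  inferInstanceAs (Module ℂ (QuiverPath V →₀ ℂ))

/-- The basis element given by a path. -/
noncomputable def ofPath (p : QuiverPath V) : PathAlgebra V := Finsupp.single p 1

/-- The trivial path at a vertex. -/
noncomputable def vertex (i : V) : PathAlgebra V := ofPath ⟨i, i, Quiver.Path.nil⟩

open Classical in
/-- The product `p q` of two paths: the concatenation (first `q`, then `p`) if the tail of `p` is
the head of `q`, and `0` otherwise. -/
noncomputable def pathMul (p q : QuiverPath V) : PathAlgebra V :=
  if h : q.2.1 = p.1 then ofPath ⟨q.1, p.2.1, (q.2.2.cast rfl h).comp p.2.2⟩ else 0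

/-- The bilinear extension of the product of paths. -/
noncomputable def mulLinear : PathAlgebra V →ₗ[ℂ] PathAlgebra V →ₗ[ℂ] PathAlgebra V :=
  Finsupp.linearCombination ℂ fun p =>
    (Finsupp.linearCombination ℂ fun q => pathMul p q : (QuiverPath V →₀ ℂ) →ₗ[ℂ] PathAlgebra V)

noncomputable instance : Mul (PathAlgebra V) := ⟨fun x y => mulLinear x y⟩

theorem mul_def (x y : PathAlgebra V) : x * y = mulLinear x y := rfl

theorem ofPath_mul_ofPath (p q : QuiverPath V) : ofPath p * ofPath q = pathMul p q := by
  have h := Finsupp.linearCombination_single ℂ (1 : ℂ) p (v := fun p => (Finsupp.linearCombination ℂ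
    fun q => pathMul p q : (QuiverPath V →₀ ℂ) →ₗ[ℂ] PathAlgebra V))
  have h' := Finsupp.linearCombination_single ℂ (1 : ℂ) q (v := fun q => pathMul p q)
  rw [one_smul] at h h'
  exact (LinearMap.congr_fun h (Finsupp.single q 1)).trans h'

theorem ofPath_mul_ofPath_of_eq {i j k : V} (p : Quiver.Path j k) (q : Quiver.Path i j) :
    ofPath ⟨j, k, p⟩ * ofPath ⟨i, j, q⟩ = ofPath ⟨i, k, q.comp p⟩ := by
  rw [ofPath_mul_ofPath, pathMul, dif_pos rfl]
  rfl

theorem ofPath_mul_ofPath_of_ne {i j k l : V} (p : Quiver.Path k l) (q : Quiver.Path i j)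
    (h : j ≠ k) : ofPath ⟨k, l, p⟩ * ofPath ⟨i, j, q⟩ = 0 := by
  rw [ofPath_mul_ofPath, pathMul, dif_neg h]

theorem induction_on {P : PathAlgebra V → Prop} (x : PathAlgebra V) (zero : P 0)
    (add : ∀ x y, P x → P y → P (x + y)) (smul : ∀ (c : ℂ) p, P (c • ofPath p)) : P x := by
  refine Finsupp.induction_linear (motive := P) x zero add fun p c => ?_
  have h : (Finsupp.single p c : QuiverPath V →₀ ℂ) = c • Finsupp.single p 1 := by simp
  rw [h]
  exact smul c p

protected theorem add_mul' (x y z : PathAlgebra V) : (x + y) * z = x * z + y * z := by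
  simp [mul_def]

protected theorem mul_add' (x y z : PathAlgebra V) : x * (y + z) = x * y + x * z := by
  simp [mul_def]

protected theorem smul_mul' (c : ℂ) (x y : PathAlgebra V) : (c • x) * y = c • (x * y) := by
  simp [mul_def]

protected theorem mul_smul' (c : ℂ) (x y : PathAlgebra V) : x * (c • y) = c • (x * y) := by
  simp [mul_def]

protected theorem zero_mul' (x : PathAlgebra V) : 0 * x = 0 := by simp [mul_def]

protected theorem mul_zero' (x : PathAlgebra V) : x * 0 = 0 := by simp [mul_def]

theorem ofPath_mul_assoc (p q r : QuiverPath V) :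
    ofPath p * ofPath q * ofPath r = ofPath p * (ofPath q * ofPath r) := by
  obtain ⟨i, j, p⟩ := p
  obtain ⟨k, l, q⟩ := q
  obtain ⟨m, n, r⟩ := r
  by_cases h₁ : l = i
  · subst h₁
    by_cases h₂ : n = k
    · subst h₂
      simp only [ofPath_mul_ofPath_of_eq, Quiver.Path.comp_assoc]
    · simp only [ofPath_mul_ofPath_of_eq, ofPath_mul_ofPath_of_ne _ _ h₂, PathAlgebra.mul_zero']
  · by_cases h₂ : n = k
    · subst h₂
      simp only [ofPath_mul_ofPath_of_eq, ofPath_mul_ofPath_of_ne _ _ h₁, PathAlgebra.zero_mul']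
    · simp only [ofPath_mul_ofPath_of_ne _ _ h₁, ofPath_mul_ofPath_of_ne _ _ h₂,
        PathAlgebra.zero_mul', PathAlgebra.mul_zero']

protected theorem mul_assoc' (x y z : PathAlgebra V) : x * y * z = x * (y * z) := by
  induction x using induction_on with
  | zero => simp only [PathAlgebra.zero_mul']
  | add x x' hx hx' => simp only [PathAlgebra.add_mul', hx, hx']
  | smul c p =>
    induction y using induction_on with
    | zero => simp only [PathAlgebra.zero_mul', PathAlgebra.mul_zero']
    | add y y' hy hy' => simp only [PathAlgebra.add_mul', PathAlgebra.mul_add', hy, hy']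
    | smul d q =>
      induction z using induction_on with
      | zero => simp only [PathAlgebra.mul_zero']
      | add z z' hz hz' => simp only [PathAlgebra.mul_add', hz, hz']
      | smul e r =>
        simp only [PathAlgebra.smul_mul', PathAlgebra.mul_smul', ofPath_mul_assoc]

variable [Fintype V]

noncomputable instance : One (PathAlgebra V) := ⟨∑ i, vertex i⟩

theorem one_def : (1 : PathAlgebra V) = ∑ i, vertex i := rfl

theorem one_mul_ofPath (p : QuiverPath V) : 1 * ofPath p = ofPath p := by
  obtain ⟨i, j, p⟩ := p
  rw [one_def, mul_def, map_sum, LinearMap.sum_apply, Finset.sum_eq_single j]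
  · exact ofPath_mul_ofPath_of_eq _ _
  · intro k _ hk
    exact ofPath_mul_ofPath_of_ne _ _ hk.symm
  · simp

theorem ofPath_mul_one (p : QuiverPath V) : ofPath p * 1 = ofPath p := by
  obtain ⟨i, j, p⟩ := p
  rw [one_def, mul_def, map_sum, Finset.sum_eq_single i]
  · exact (ofPath_mul_ofPath_of_eq _ _).trans (by rw [Quiver.Path.nil_comp])
  · intro k _ hk
    exact ofPath_mul_ofPath_of_ne _ _ hk
  · simp

noncomputable instance : Ring (PathAlgebra V) :=
  { (inferInstance : AddCommGroup (PathAlgebra V)) with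
    mul := (· * ·)
    one := 1
    left_distrib := PathAlgebra.mul_add'
    right_distrib := PathAlgebra.add_mul'
    zero_mul := PathAlgebra.zero_mul'
    mul_zero := PathAlgebra.mul_zero'
    mul_assoc := PathAlgebra.mul_assoc'
    one_mul := fun x => by
      induction x using induction_on with
      | zero => exact PathAlgebra.mul_zero' _
      | add x y hx hy => rw [PathAlgebra.mul_add', hx, hy]
      | smul c p => rw [PathAlgebra.mul_smul', one_mul_ofPath]
    mul_one := fun x => by
      induction x using induction_on with
      | zero => exact PathAlgebra.zero_mul' _
      | add x y hx hy => rw [PathAlgebra.add_mul', hx, hy]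
      | smul c p => rw [PathAlgebra.smul_mul', ofPath_mul_one] }

noncomputable instance : Algebra ℂ (PathAlgebra V) :=
  Algebra.ofModule PathAlgebra.smul_mul' PathAlgebra.mul_smul'

open Classical in
/-- The component of degree `k` for the grading of `ℂQ` by the length of paths. -/
noncomputable def component (k : ℕ) (x : PathAlgebra V) : PathAlgebra V :=
  Finsupp.filter (fun p : QuiverPath V => p.2.2.length = k) x

/-- A homomorphism out of `ℂQ` is *graded* if its kernel is a graded ideal. -/
def HasGradedKernel {A : Type*} [Ring A] [Algebra ℂ A] (π : PathAlgebra V →ₐ[ℂ] A) : Prop :=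
  ∀ x, π x = 0 → ∀ k, π (component k x) = 0

/-- The subring `S = A₀` of a quotient `π : ℂQ → A`, generated by (the images of) the vertices. -/
noncomputable def degreeZero {A : Type*} [Ring A] [Algebra ℂ A] (π : PathAlgebra V →ₐ[ℂ] A) :
    Subalgebra ℂ A :=
  Algebra.adjoin ℂ (Set.range fun i : V => π (vertex i))

end PathAlgebra

/-! ### Bimodules and selfdual resolutions -/

universe u v v' w w'

section Bimodules

variable (A : Type u) [Ring A] [Algebra ℂ A]

/-- The enveloping algebra `A ⊗ Aᵒᵖ`. Left modules over it are the `A`-bimodules on which `ℂ` acts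
centrally, with `(a ⊗ op b) • m = a m b`. -/
def Env := A ⊗[ℂ] Aᵐᵒᵖ

noncomputable instance : Ring (Env A) := inferInstanceAs (Ring (A ⊗[ℂ] Aᵐᵒᵖ))

noncomputable instance : Algebra ℂ (Env A) := inferInstanceAs (Algebra ℂ (A ⊗[ℂ] Aᵐᵒᵖ))

variable {A} in
/-- The element `a ⊗ op b` of the enveloping algebra. -/
def Env.tmul (a b : A) : Env A := (a ⊗ₜ[ℂ] op b : A ⊗[ℂ] Aᵐᵒᵖ)

theorem Env.tmul_mul_tmul (a b c d : A) :
    Env.tmul a b * Env.tmul c d = Env.tmul (a * c) (d * b) :=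
  Algebra.TensorProduct.tmul_mul_tmul a c (op b) (op d)

/-- The bimodule structure of `A` over itself. -/
noncomputable abbrev diagonalModule : Module (Env A) A :=
  (TensorProduct.Algebra.module : Module (A ⊗[ℂ] Aᵐᵒᵖ) A)

theorem diagonalModule_tmul_smul (a b m : A) :
    letI := diagonalModule A
    Env.tmul a b • m = a * m * b :=
  (TensorProduct.Algebra.smul_def a (op b) m).trans (mul_assoc a m b).symm

/-- `A` as an `A`-bimodule. -/
noncomputable def diagonalBimodule : ModuleCat.{u} (Env A) :=
  letI := diagonalModule A
  ModuleCat.of (Env A) A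

/-- The anti-automorphism `a ⊗ op b ↦ b ⊗ op a` of the enveloping algebra. -/
noncomputable def envFlip : Env A ≃ₐ[ℂ] (Env A)ᵐᵒᵖ :=
  (((Algebra.TensorProduct.comm ℂ A Aᵐᵒᵖ).trans
    (Algebra.TensorProduct.congr AlgEquiv.refl (AlgEquiv.opOp ℂ A))).trans
    (Algebra.TensorProduct.opAlgEquiv ℂ ℂ A Aᵐᵒᵖ) : A ⊗[ℂ] Aᵐᵒᵖ ≃ₐ[ℂ] (A ⊗[ℂ] Aᵐᵒᵖ)ᵐᵒᵖ)

theorem envFlip_tmul (a b : A) : envFlip A (Env.tmul a b) = op (Env.tmul b a) := by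
  change (((Algebra.TensorProduct.comm ℂ A Aᵐᵒᵖ).trans
    (Algebra.TensorProduct.congr AlgEquiv.refl (AlgEquiv.opOp ℂ A))).trans
    (Algebra.TensorProduct.opAlgEquiv ℂ ℂ A Aᵐᵒᵖ)) (a ⊗ₜ[ℂ] op b) = op (b ⊗ₜ[ℂ] op a)
  simp

variable {A}

/-- The bimodule structure on `M^∨ = Hom_{A-A}(M, A ⊗ A)`. Here `A ⊗ A` with its outer structure
`a₁ (b₁ ⊗ b₂) a₂ = a₁ b₁ ⊗ b₂ a₂` is the free bimodule `Env A` of rank one, and the bimodule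
structure of `M^∨` comes from the inner structure `a₁ (b₁ ⊗ b₂) a₂ = b₁ a₂ ⊗ a₁ b₂`, which is right
multiplication by `a₂ ⊗ op a₁` in `Env A`. -/
noncomputable abbrev dualModule (M : ModuleCat.{u} (Env A)) : Module (Env A) (M →ₗ[Env A] Env A) :=
  Module.compHom (M →ₗ[Env A] Env A) (envFlip A).toAlgHom.toRingHom

theorem dualModule_tmul_smul (M : ModuleCat.{u} (Env A)) (a b : A) (ν : M →ₗ[Env A] Env A)
    (m : M) :
    letI := dualModule M
    (Env.tmul a b • ν) m = ν m * Env.tmul b a := by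
  change (envFlip A (Env.tmul a b) • ν) m = _
  rw [envFlip_tmul]
  rfl

/-- The dual `M^∨` of a bimodule. -/
noncomputable def bimoduleDual (M : ModuleCat.{u} (Env A)) : ModuleCat.{u} (Env A) :=
  letI := dualModule M
  ModuleCat.of (Env A) (M →ₗ[Env A] Env A)

/-- The dual `f^∨ : N^∨ → M^∨`, `ν ↦ ν ∘ f`, of a bimodule homomorphism `f : M → N`. -/
noncomputable def bimoduleDualMap {M N : ModuleCat.{u} (Env A)} (f : M ⟶ N) :
    bimoduleDual N ⟶ bimoduleDual M :=
  letI := dualModule M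
  letI := dualModule N
  ModuleCat.ofHom
    { toFun := fun ν : N →ₗ[Env A] Env A => ν.comp f.hom
      map_add' := fun _ _ => rfl
      map_smul' := fun _ _ => rfl }

variable (S : Subalgebra ℂ A)

/-- The relations `a s ⊗ t ⊗ b = a ⊗ s t ⊗ b` and `a ⊗ t s ⊗ b = a ⊗ t ⊗ s b` that define
`A ⊗_S T ⊗_S A` as a quotient of `A ⊗ T ⊗ A`; here `a ⊗ t ⊗ b` is written `(a ⊗ op b) ⊗ t`. -/
noncomputable def balancedRelations (T : Type u) [AddCommGroup T] [Module ℂ T] [Module S T]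
    [Module Sᵐᵒᵖ T] : Submodule (Env A) (Env A ⊗[ℂ] T) :=
  Submodule.span (Env A)
    ({x | ∃ (a b : A) (s : S) (t : T),
        x = Env.tmul (a * s) b ⊗ₜ[ℂ] t - Env.tmul a b ⊗ₜ[ℂ] (s • t)} ∪
      {x | ∃ (a b : A) (s : S) (t : T),
        x = Env.tmul a b ⊗ₜ[ℂ] (op s • t) - Env.tmul a (s * b) ⊗ₜ[ℂ] t})

/-- The bimodule `F_T = A ⊗_S T ⊗_S A` of an `S`-bimodule `T`. -/
noncomputable def standardBimodule (T : Type u) [AddCommGroup T] [Module ℂ T] [Module S T]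
    [Module Sᵐᵒᵖ T] : ModuleCat.{u} (Env A) :=
  ModuleCat.of (Env A) ((Env A ⊗[ℂ] T) ⧸ balancedRelations S T)

/-- The class `𝒫` of the bimodules isomorphic to some `F_T`, where `T` is a finite dimensional
`S`-bimodule (on which `ℂ` acts centrally). -/
def IsStandardBimodule (M : ModuleCat.{u} (Env A)) : Prop :=
  ∃ (T : Type u) (_ : AddCommGroup T) (_ : Module ℂ T) (_ : Module S T) (_ : Module Sᵐᵒᵖ T)
    (_ : IsScalarTower ℂ S T) (_ : IsScalarTower ℂ Sᵐᵒᵖ T) (_ : SMulCommClass S Sᵐᵒᵖ T),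
    FiniteDimensional ℂ T ∧ Nonempty (M ≅ standardBimodule S T)

/-- A projective resolution `P` of a bimodule is *selfdual of length `n`* if it has the form
`P_n → ⋯ → P_0` and there are isomorphisms of bimodules `α_i : P_i ≅ (P_{n-i})^∨`, `0 ≤ i ≤ n`, with
`α_{i-1} ∘ d_i = - d_{n-i+1}^∨ ∘ α_i`. -/
def IsSelfdual {M : ModuleCat.{u} (Env A)} (P : ProjectiveResolution M) (n : ℕ) : Prop :=
  (∀ i, n < i → IsZero (P.complex.X i)) ∧
  ∃ α : ∀ i j : ℕ, i + j = n → (P.complex.X i ≅ bimoduleDual (P.complex.X j)),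
    ∀ (i j : ℕ) (h : (i + 1) + j = n),
      P.complex.d (i + 1) i ≫ (α i (j + 1) (by omega)).hom =
        (α (i + 1) j h).hom ≫ (-bimoduleDualMap (P.complex.d (j + 1) j))

end Bimodules

/-! ### Serre functors and Calabi-Yau categories -/

section Serre

variable (k : Type*) [Field k] (C : Type*) [Category* C] [Preadditive C] [Linear k C]

/-- `F` is a Serre functor of the `k`-linear category `C`: an autoequivalence with linear
isomorphisms `Hom(X, Y) ≅ Hom(Y, F X)^*` natural in `X` and `Y`, where `C` is Hom-finite. -/
structure IsSerreFunctor (F : C ⥤ C) : Prop where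
  isEquivalence : F.IsEquivalence
  finiteDimensional : ∀ X Y : C, FiniteDimensional k (X ⟶ Y)
  duality : ∃ ν : ∀ X Y : C, (X ⟶ Y) ≃ₗ[k] Module.Dual k (Y ⟶ F.obj X),
    (∀ {X X' Y : C} (f : X' ⟶ X) (g : X ⟶ Y) (h : Y ⟶ F.obj X'),
      ν X' Y (f ≫ g) h = ν X Y g (h ≫ F.map f)) ∧
    (∀ {X Y Y' : C} (g : X ⟶ Y) (u : Y ⟶ Y') (h : Y' ⟶ F.obj X),
      ν X Y' (g ≫ u) h = ν X Y g (u ≫ h))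

/-- `C` is Calabi-Yau of dimension `n`: the `n`-th shift is a Serre functor. -/
def IsCalabiYau [HasShift C ℤ] (n : ℤ) : Prop :=
  IsSerreFunctor k C (shiftFunctor C n)

end Serre

/-! ### Derived categories of finite dimensional modules -/

section Derived

variable (A : Type u) [Ring A] [Algebra ℂ A]

open scoped ModuleCat in
/-- The left `A`-modules that are finite dimensional over `ℂ`. -/
def finDimModules : ObjectProperty (ModuleCat.{u} A) := fun M => FiniteDimensional ℂ M

open scoped ModuleCat in
theorem finDimModules_of_injective {M N : ModuleCat.{u} A} (f : M ⟶ N)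
    (hf : Function.Injective f) (hN : finDimModules A N) : finDimModules A M := by
  have : FiniteDimensional ℂ N := hN
  exact FiniteDimensional.of_injective (f.hom.restrictScalars ℂ) hf

open scoped ModuleCat in
theorem finDimModules_of_surjective {M N : ModuleCat.{u} A} (f : M ⟶ N)
    (hf : Function.Surjective f) (hM : finDimModules A M) : finDimModules A N := by
  have : FiniteDimensional ℂ M := hM
  exact Module.Finite.of_surjective (f.hom.restrictScalars ℂ) hf

instance : (finDimModules A).ContainsZero where
  exists_zero := ⟨ModuleCat.of A PUnit, ModuleCat.isZero_of_subsingleton _, by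
    change FiniteDimensional ℂ PUnit
    infer_instance⟩

instance : (finDimModules A).IsClosedUnderSubobjects where
  prop_of_mono f _ h := finDimModules_of_injective A f ((ModuleCat.mono_iff_injective f).1 ‹_›) h

instance : (finDimModules A).IsClosedUnderQuotients where
  prop_of_epi f _ h := finDimModules_of_surjective A f ((ModuleCat.epi_iff_surjective f).1 ‹_›) h

open scoped ModuleCat in
instance : (finDimModules A).IsClosedUnderFiniteProducts where
  isClosedUnderLimitsOfShape J _ :=
    { limitsOfShape_le := by
        rintro X ⟨p⟩
        let Y : ModuleCat.{u} A := ModuleCat.of A (∀ j : J, p.diag.obj ⟨j⟩)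
        let f : X ⟶ Y := ModuleCat.ofHom (LinearMap.pi fun j => (p.π.app ⟨j⟩).hom)
        have hf : Mono f := ⟨fun {Z} g h e => p.isLimit.hom_ext fun ⟨j⟩ => by
          ext z
          exact congrFun (ConcreteCategory.congr_hom e z) j⟩
        refine finDimModules_of_injective A f ((ModuleCat.mono_iff_injective f).1 hf) ?_
        have (j : J) : FiniteDimensional ℂ (p.diag.obj ⟨j⟩) := p.prop_diag_obj ⟨j⟩
        change FiniteDimensional ℂ (∀ j : J, p.diag.obj ⟨j⟩)
        have : Module.Finite ℂ (∀ j : J, p.diag.obj ⟨j⟩) := inferInstance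
        convert this }

/-- The abelian category `Rep A` of finite dimensional left `A`-modules. -/
abbrev FinRep := (finDimModules A).FullSubcategory

instance : PreservesFiniteLimits (finDimModules A).ι := by
  have := (finDimModules A).preservesKernels_ι
  exact Functor.preservesFiniteLimits_of_preservesKernels _

instance : PreservesFiniteColimits (finDimModules A).ι := by
  have := (finDimModules A).preservesCokernels_ι
  exact Functor.preservesFiniteColimits_of_preservesCokernels _

open DerivedCategory

variable [HasDerivedCategory.{w} (ModuleCat.{u} A)]

/-- The objects of the derived category of all left `A`-modules whose cohomology modules are finite
dimensional. -/
def finDimCohomology : ObjectProperty (DerivedCategory (ModuleCat.{u} A)) :=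
  fun X => ∀ i : ℤ, finDimModules A ((homologyFunctor (ModuleCat.{u} A) i).obj X)

instance : (finDimCohomology A).IsStableUnderShift ℤ where
  isStableUnderShiftBy a :=
    ⟨fun X hX i => (finDimModules A).prop_of_iso
      (((homologyFunctor (ModuleCat.{u} A) 0).shiftIso a i (a + i) rfl).symm.app X) (hX _)⟩

/-- The category `D^b_fd(Mod A)`: the full subcategory of the derived category of all left
`A`-modules on the bounded objects with finite dimensional cohomology. -/
abbrev BoundedFinDim := (TStructure.t.bounded ⊓ finDimCohomology A).FullSubcategory

/-- The functor `D^b(Rep A) → D(Mod A)` induced by the inclusion of `Rep A` in the category of all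
left `A`-modules. -/
noncomputable def fromBoundedFinRep [HasDerivedCategory.{w'} (FinRep A)] :
    Bounded (FinRep A) ⥤ DerivedCategory (ModuleCat.{u} A) :=
  Bounded.ι ⋙ (finDimModules A).ι.mapDerivedCategory

end Derived

/-! ### Mapping cones of natural transformations -/

section Cones

open CochainComplex Preadditive

variable {C : Type*} [Category* C] [Abelian C]

section

variable {K₁ L₁ K₂ L₂ : CochainComplex C ℤ} (φ₁ : K₁ ⟶ L₁) (φ₂ : K₂ ⟶ L₂)
  (a : K₁ ⟶ K₂) (b : L₁ ⟶ L₂) (comm : φ₁ ≫ b = a ≫ φ₂)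

/-! Serre duality is proved first for the Nakayama functor `ν = Hom_A(-, A)^*`, and `ν` is then
identified with the shift by `n`.

For a bounded complex `K` of finitely generated projectives, a finite dual basis gives a trace on
`Hom_A(K_i, νK_i)`. The alternating sum of these traces pairs the cochain complexes `Hom(K, L)` and
`Hom(L, νK)` perfectly and kills boundaries. Since dualizing vector spaces is exact, it induces
`Hom(L, νK) ≅ Hom(K, L)^*` in the derived category when `L` is perfect as well
(`eq_zero_of_derivedTrace`, `exists_derivedTrace_comp_eq`). No finite dimensionality enters at this
stage.

To compare `νK` with `K[n]` when the cohomology of `K` is finite dimensional, cut the bimodule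
resolution into syzygies `0 → Ω_{i+1} → P_i → Ω_i → 0` with `Ω_0 = A`. The covariant functors `B ↦
Hom_A(B ⊗_A K, A)^*` and the contravariant functors `B ↦ Hom_A(B, K^**)` turn these into short exact
sequences of complexes that begin with `νK` and with `K^**` respectively. On the terms `P_i`,
selfduality and the natural map `Hom_A(P_i ⊗_A M, A)^* → Hom_A(P_i^∨, M^**)` compare the first
family with the second one read backwards. That map is invertible for finite dimensional `M`
(`nakToRhom_app_isIso`), and both functors are exact, so finite dimensional cohomology of `K` makes
it a quasi-isomorphism although the terms of `K` may be infinite dimensional. Climbing the ladder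
costs one shift per step and yields `νK ≅ K^**[n] ≅ K[n]`, naturally in `K` (`iso_shift_of_ladder`,
`nakFunctor_iso_shift`).

Every bounded object with finite dimensional cohomology is represented by such a `K`: for a finite
dimensional module `M`, tensoring the resolution with `M` resolves `M` by finitely generated
projectives, and truncation triangles do the rest (`exists_perfectFinDim`). The outcome is a cyclic
trace `Hom(X, X[n]) → ℂ` with perfect pairings (`hasCyclicTrace`). It forces finite dimensional
Hom-spaces, because infinite dimensions grow strictly under duality. It also restricts along every
fully faithful functor compatible with shifts, which gives both assertions. -/

theorem mappingCone_inl_v_map_f (p q : ℤ) (h : p + (-1) = q) :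
    (mappingCone.inl φ₁).v p q h ≫ (mappingCone.map φ₁ φ₂ a b comm).f q =
      a.f p ≫ (mappingCone.inl φ₂).v p q h := by
  simp [mappingCone.map]

theorem mappingCone_inr_f_map_f (p : ℤ) :
    (mappingCone.inr φ₁).f p ≫ (mappingCone.map φ₁ φ₂ a b comm).f p =
      b.f p ≫ (mappingCone.inr φ₂).f p := by
  simp [mappingCone.map]

theorem mappingCone_map_f_fst_v (p q : ℤ) (h : p + 1 = q) :
    (mappingCone.map φ₁ φ₂ a b comm).f p ≫ (mappingCone.fst φ₂).1.v p q h =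
      (mappingCone.fst φ₁).1.v p q h ≫ a.f q := by
  rw [mappingCone.ext_from_iff φ₁ q p h]
  simp [mappingCone.map]

theorem mappingCone_map_f_snd_v (p : ℤ) :
    (mappingCone.map φ₁ φ₂ a b comm).f p ≫ (mappingCone.snd φ₂).v p p (add_zero p) =
      (mappingCone.snd φ₁).v p p (add_zero p) ≫ b.f p := by
  rw [mappingCone.ext_from_iff φ₁ (p + 1) p rfl]
  simp [mappingCone.map]

end

theorem mappingCone_map_comp_map {K₁ L₁ K₂ L₂ K₃ L₃ K₄ L₄ : CochainComplex C ℤ} {φ₁ : K₁ ⟶ L₁}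
    {φ₂ : K₂ ⟶ L₂} {φ₃ : K₃ ⟶ L₃} {φ₄ : K₄ ⟶ L₄} {a : K₁ ⟶ K₂} {b : L₁ ⟶ L₂} {a' : K₂ ⟶ K₄}
    {b' : L₂ ⟶ L₄} {c : K₁ ⟶ K₃} {d : L₁ ⟶ L₃} {c' : K₃ ⟶ K₄} {d' : L₃ ⟶ L₄}
    (hab : φ₁ ≫ b = a ≫ φ₂) (hab' : φ₂ ≫ b' = a' ≫ φ₄) (hcd : φ₁ ≫ d = c ≫ φ₃)
    (hcd' : φ₃ ≫ d' = c' ≫ φ₄) (h : a ≫ a' = c ≫ c') (h' : b ≫ b' = d ≫ d') :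
    mappingCone.map φ₁ φ₂ a b hab ≫ mappingCone.map φ₂ φ₄ a' b' hab' =
      mappingCone.map φ₁ φ₃ c d hcd ≫ mappingCone.map φ₃ φ₄ c' d' hcd' := by
  rw [← mappingCone.map_comp, ← mappingCone.map_comp]
  congr 1

/-- The short complex formed by the mapping cones of a morphism of short complexes. -/
noncomputable def mappingConeShortComplex {S₁ S₂ : ShortComplex (CochainComplex C ℤ)}
    (η : S₁ ⟶ S₂) : ShortComplex (CochainComplex C ℤ) :=
  ShortComplex.mk (mappingCone.map η.τ₁ η.τ₂ S₁.f S₂.f η.comm₁₂)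
    (mappingCone.map η.τ₂ η.τ₃ S₁.g S₂.g η.comm₂₃) (by
      rw [← mappingCone.map_comp]
      ext p
      rw [mappingCone.ext_from_iff _ (p + 1) p rfl, mappingCone_inl_v_map_f,
        mappingCone_inr_f_map_f]
      simp)

/-- In degree `p` the cone is the direct sum of `K` in degree `p + 1` and `L` in degree `p`, and the
map of cones is diagonal there. -/
theorem mono_mappingCone_map_f {K₁ L₁ K₂ L₂ : CochainComplex C ℤ} (φ₁ : K₁ ⟶ L₁) (φ₂ : K₂ ⟶ L₂)
    (a : K₁ ⟶ K₂) (b : L₁ ⟶ L₂) (comm : φ₁ ≫ b = a ≫ φ₂) (p : ℤ) [Mono (a.f (p + 1))]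
    [Mono (b.f p)] : Mono ((mappingCone.map φ₁ φ₂ a b comm).f p) := by
  refine mono_of_cancel_zero _ fun k hk => ?_
  rw [mappingCone.ext_to_iff _ p (p + 1) rfl, zero_comp, zero_comp]
  constructor
  · rw [← cancel_mono (a.f (p + 1)), Category.assoc, ← mappingCone_map_f_fst_v _ _ _ _ comm,
      reassoc_of% hk, zero_comp, zero_comp]
  · rw [← cancel_mono (b.f p), Category.assoc, ← mappingCone_map_f_snd_v _ _ _ _ comm,
      reassoc_of% hk, zero_comp, zero_comp]

theorem epi_mappingCone_map_f {K₁ L₁ K₂ L₂ : CochainComplex C ℤ} (φ₁ : K₁ ⟶ L₁) (φ₂ : K₂ ⟶ L₂)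
    (a : K₁ ⟶ K₂) (b : L₁ ⟶ L₂) (comm : φ₁ ≫ b = a ≫ φ₂) (p : ℤ) [Epi (a.f (p + 1))]
    [Epi (b.f p)] : Epi ((mappingCone.map φ₁ φ₂ a b comm).f p) := by
  refine epi_of_cancel_zero _ fun k hk => ?_
  rw [mappingCone.ext_from_iff _ (p + 1) p rfl, comp_zero, comp_zero]
  constructor
  · rw [← cancel_epi (a.f (p + 1)), ← reassoc_of% (mappingCone_inl_v_map_f _ _ _ _ comm),
      hk, comp_zero, comp_zero]
  · rw [← cancel_epi (b.f p), ← reassoc_of% (mappingCone_inr_f_map_f _ _ _ _ comm),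
      hk, comp_zero, comp_zero]

/-- In degree `p` this is the direct sum of `S₁` in degree `p + 1` and `S₂` in degree `p`. Only the
differentials, which play no role in exactness, mix the two summands. -/
theorem mappingConeShortComplex_shortExact {S₁ S₂ : ShortComplex (CochainComplex C ℤ)}
    (η : S₁ ⟶ S₂) (h₁ : S₁.ShortExact) (h₂ : S₂.ShortExact) :
    (mappingConeShortComplex η).ShortExact := by
  refine HomologicalComplex.shortExact_of_degreewise_shortExact _ fun p => ?_
  have e₁ : (S₁.map (HomologicalComplex.eval C (ComplexShape.up ℤ) (p + 1))).ShortExact :=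
    h₁.map_of_exact _
  have e₂ : (S₂.map (HomologicalComplex.eval C (ComplexShape.up ℤ) p)).ShortExact :=
    h₂.map_of_exact _
  have m₁ : Mono (S₁.f.f (p + 1)) := e₁.mono_f
  have m₂ : Mono (S₂.f.f p) := e₂.mono_f
  have p₁ : Epi (S₁.g.f (p + 1)) := e₁.epi_g
  have p₂ : Epi (S₂.g.f p) := e₂.epi_g
  have m₁' := e₁.mono_f
  have m₂' := e₂.mono_f
  have m : Mono ((mappingConeShortComplex η).map
      (HomologicalComplex.eval C (ComplexShape.up ℤ) p)).f :=
    mono_mappingCone_map_f η.τ₁ η.τ₂ S₁.f S₂.f η.comm₁₂ p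
  have e : Epi ((mappingConeShortComplex η).map
      (HomologicalComplex.eval C (ComplexShape.up ℤ) p)).g :=
    epi_mappingCone_map_f η.τ₂ η.τ₃ S₁.g S₂.g η.comm₂₃ p
  refine ShortComplex.ShortExact.mk (ShortComplex.exact_of_f_is_kernel _ ?_)
  -- The first map is mono, so a lift of each `k` killed by the second map suffices; it is built
  -- from separate lifts of the two components of `k`.
  suffices H : ∀ {T : C} (k : T ⟶ (mappingCone η.τ₂).X p)
      (_ : k ≫ (mappingCone.map η.τ₂ η.τ₃ S₁.g S₂.g η.comm₂₃).f p = 0),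
      ∃ l : T ⟶ (mappingCone η.τ₁).X p,
        l ≫ (mappingCone.map η.τ₁ η.τ₂ S₁.f S₂.f η.comm₁₂).f p = k from
    KernelFork.IsLimit.ofι' _ _ fun {T} k hk => ⟨(H k hk).choose, (H k hk).choose_spec⟩
  intro T k hk
  have hk₁ : (k ≫ (mappingCone.fst η.τ₂).1.v p (p + 1) rfl) ≫ S₁.g.f (p + 1) = 0 := by
    rw [Category.assoc, ← mappingCone_map_f_fst_v _ _ _ _ η.comm₂₃, reassoc_of% hk, zero_comp]
  have hk₂ : (k ≫ (mappingCone.snd η.τ₂).v p p (add_zero p)) ≫ S₂.g.f p = 0 := by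
    rw [Category.assoc, ← mappingCone_map_f_snd_v _ _ _ _ η.comm₂₃, reassoc_of% hk, zero_comp]
  obtain ⟨l₁, hl₁⟩ : ∃ l : T ⟶ S₁.X₁.X (p + 1), l ≫ S₁.f.f (p + 1) =
      k ≫ (mappingCone.fst η.τ₂).1.v p (p + 1) rfl := ⟨_, e₁.exact.lift_f _ hk₁⟩
  obtain ⟨l₂, hl₂⟩ : ∃ l : T ⟶ S₂.X₁.X p, l ≫ S₂.f.f p =
      k ≫ (mappingCone.snd η.τ₂).v p p (add_zero p) := ⟨_, e₂.exact.lift_f _ hk₂⟩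
  refine ⟨l₁ ≫ (mappingCone.inl η.τ₁).v (p + 1) p (by lia) + l₂ ≫ (mappingCone.inr η.τ₁).f p, ?_⟩
  rw [add_comp, Category.assoc, Category.assoc, mappingCone_inl_v_map_f, mappingCone_inr_f_map_f,
    reassoc_of% hl₁, reassoc_of% hl₂, ← comp_add]
  exact (congrArg (k ≫ ·) (mappingCone.id_X η.τ₂ p (p + 1) rfl)).trans (Category.comp_id k)

variable {𝒲 : Type*} [Category* 𝒲]

/-- The mapping cones of a natural transformation. -/
noncomputable def coneFunctor {U V : 𝒲 ⥤ CochainComplex C ℤ} (η : U ⟶ V) :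
    𝒲 ⥤ CochainComplex C ℤ where
  obj W := mappingCone (η.app W)
  map f := mappingCone.map _ _ (U.map f) (V.map f) (η.naturality f).symm
  map_id W := by
    convert mappingCone.map_id (η.app W) using 2 <;> simp
  map_comp f g := by
    rw [← mappingCone.map_comp]
    congr 1 <;> simp

variable [HasDerivedCategory.{w} C]

open DerivedCategory

theorem isZero_Q_mappingCone {K L : CochainComplex C ℤ} (f : K ⟶ L) [QuasiIso f] :
    IsZero (Q.obj (mappingCone f)) := by
  refine (Pretriangulated.Triangle.isZero₃_iff_isIso₁ _ (mappingCone_triangle_distinguished f)).2 ?_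
  exact inferInstanceAs (IsIso (Q.map f))

/-- The mapping cones of the outer terms of a morphism of short exact sequences of complexes
whose middle term is a quasi-isomorphism differ by a shift, naturally. -/
theorem coneFunctor_iso_shift (S₁ S₂ : ShortComplex (𝒲 ⥤ CochainComplex C ℤ)) (η : S₁ ⟶ S₂)
    (h₁ : ∀ W, (S₁.map ((evaluation 𝒲 (CochainComplex C ℤ)).obj W)).ShortExact)
    (h₂ : ∀ W, (S₂.map ((evaluation 𝒲 (CochainComplex C ℤ)).obj W)).ShortExact)
    (hη : ∀ W, QuasiIso (η.τ₂.app W)) :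
    Nonempty (coneFunctor η.τ₃ ⋙ Q ≅
      (coneFunctor η.τ₁ ⋙ Q) ⋙ shiftFunctor (DerivedCategory C) (1 : ℤ)) := by
  let η' (W : 𝒲) := ((evaluation 𝒲 (CochainComplex C ℤ)).obj W).mapShortComplex.map η
  have hT (W : 𝒲) : (mappingConeShortComplex (η' W)).ShortExact :=
    mappingConeShortComplex_shortExact _ (h₁ W) (h₂ W)
  -- The middle cone vanishes in the derived category, so the connecting morphism from the third
  -- cone to the shift of the first is invertible.
  have hδ (W : 𝒲) : IsIso (triangleOfSESδ (hT W)) := by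
    refine (Pretriangulated.Triangle.isZero₂_iff_isIso₃ _ (triangleOfSES_distinguished (hT W))).1 ?_
    have : QuasiIso (η' W).τ₂ := hη W
    exact isZero_Q_mappingCone (η' W).τ₂
  refine ⟨NatIso.ofComponents (fun W => @asIso _ _ _ _ _ (hδ W)) fun {W W'} f => ?_⟩
  -- Cones of complexes, unlike cones in a triangulated category, are functorial. Hence `f` induces
  -- a morphism of short exact sequences, and the connecting morphism is natural.
  let t : mappingConeShortComplex (η' W) ⟶ mappingConeShortComplex (η' W') :=
    { τ₁ := (coneFunctor η.τ₁).map f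
      τ₂ := (coneFunctor η.τ₂).map f
      τ₃ := (coneFunctor η.τ₃).map f
      comm₁₂ := mappingCone_map_comp_map (η.τ₁.naturality f).symm (η' W').comm₁₂
        (η' W).comm₁₂ (η.τ₂.naturality f).symm (S₁.f.naturality f) (S₂.f.naturality f)
      comm₂₃ := mappingCone_map_comp_map (η.τ₂.naturality f).symm (η' W').comm₂₃
        (η' W).comm₂₃ (η.τ₃.naturality f).symm (S₁.g.naturality f) (S₂.g.naturality f) }
  exact (triangleOfSESδ_naturality (hT W) (hT W') t).symm

end Cones

/-! ### Climbing a ladder of short exact sequences. -/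

section Ladder

open CochainComplex Preadditive

variable {C : Type*} [Category* C] [Abelian C] {𝒲 : Type*} [Category* 𝒲]

/-- A natural transformation that is killed by the second map of a pointwise short exact sequence
of functors factors through the first one. -/
theorem exists_lift_of_shortExact (S : ShortComplex (𝒲 ⥤ CochainComplex C ℤ))
    (h : ∀ W, (S.map ((evaluation 𝒲 (CochainComplex C ℤ)).obj W)).ShortExact)
    {T : 𝒲 ⥤ CochainComplex C ℤ} (k : T ⟶ S.X₂) (hk : k ≫ S.g = 0) :
    ∃ l : T ⟶ S.X₁, l ≫ S.f = k := by
  have hm (W : 𝒲) : Mono (S.f.app W) := (h W).mono_f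
  have H (W : 𝒲) : ∃ l : T.obj W ⟶ S.X₁.obj W, l ≫ S.f.app W = k.app W := by
    have := (h W).mono_f
    exact ⟨_, (h W).exact.lift_f (k.app W) (congrArg (fun t => t.app W) hk)⟩
  choose l hl using H
  refine ⟨{ app := l, naturality := fun W W' f => ?_ }, by ext1; ext1 W; exact hl W⟩
  rw [← cancel_mono (S.f.app W'), Category.assoc, Category.assoc, hl, S.f.naturality,
    reassoc_of% hl, k.naturality]

variable [HasDerivedCategory.{w} C]

open DerivedCategory

/-- Upper end of the ladder: the inclusion of the target in the cone becomes invertible. -/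
theorem coneFunctor_iso_of_isZero_left {U V : 𝒲 ⥤ CochainComplex C ℤ} (η : U ⟶ V)
    (hU : ∀ W, IsZero (U.obj W)) : Nonempty (V ⋙ Q ≅ coneFunctor η ⋙ Q) := by
  have h (W : 𝒲) : IsIso (Q.map (mappingCone.inr (η.app W))) :=
    (Pretriangulated.Triangle.isZero₁_iff_isIso₂ _
      (mappingCone_triangle_distinguished (η.app W))).1 (Q.map_isZero (hU W))
  refine ⟨NatIso.ofComponents (fun W => @asIso _ _ _ _ _ (h W)) fun {W W'} f => ?_⟩
  have hc := (mappingCone.triangleMap (η.app W) (η.app W') (U.map f) (V.map f)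
    (η.naturality f).symm).comm₂
  exact (Q.map_comp _ _).symm.trans ((congrArg Q.map hc.symm).trans (Q.map_comp _ _))

theorem Q_map_mor₃_naturality {T T' : Pretriangulated.Triangle (CochainComplex C ℤ)} (t : T ⟶ T') :
    Q.map t.hom₃ ≫ Q.map T'.mor₃ ≫ (Q.commShiftIso (1 : ℤ)).hom.app T'.obj₁ =
      (Q.map T.mor₃ ≫ (Q.commShiftIso (1 : ℤ)).hom.app T.obj₁) ≫ (Q.map t.hom₁)⟦(1 : ℤ)⟧' := by
  rw [Category.assoc, ← Functor.commShiftIso_hom_naturality, ← Q.map_comp_assoc,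
    ← Q.map_comp_assoc, t.comm₃]

/-- Lower end of the ladder: the projection of the cone to the shifted source becomes invertible. -/
theorem coneFunctor_iso_of_isZero_right {U V : 𝒲 ⥤ CochainComplex C ℤ} (η : U ⟶ V)
    (hV : ∀ W, IsZero (V.obj W)) :
    Nonempty (coneFunctor η ⋙ Q ≅ (U ⋙ Q) ⋙
      CategoryTheory.shiftFunctor (DerivedCategory C) (1 : ℤ)) := by
  have h (W : 𝒲) : IsIso (Q.map (mappingCone.triangle (η.app W)).mor₃ ≫
      (Q.commShiftIso (1 : ℤ)).hom.app (U.obj W)) :=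
    (Pretriangulated.Triangle.isZero₂_iff_isIso₃ _
      (mappingCone_triangle_distinguished (η.app W))).1 (Q.map_isZero (hV W))
  refine ⟨NatIso.ofComponents (fun W => @asIso _ _ _ _ _ (h W)) fun {W W'} f => ?_⟩
  exact Q_map_mor₃_naturality (mappingCone.triangleMap (η.app W) (η.app W') (U.map f) (V.map f)
    (η.naturality f).symm)

/-- Two exact sequences `0 → G n → ⋯ → G 0 → Z 0 → 0` and `0 → V 0 → J 0 → ⋯ → J n → 0` of functors
with values in complexes, together with compatible quasi-isomorphisms `G i → J (n - i)`, identify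
`Z 0` with the `n`-th shift of `V 0` in the derived category. -/
theorem iso_shift_of_ladder (n : ℕ) (Z V G J : ℕ → 𝒲 ⥤ CochainComplex C ℤ)
    (k : ∀ i, Z (i + 1) ⟶ G i) (q : ∀ i, G i ⟶ Z i) (hkq : ∀ i, k i ≫ q i = 0)
    (l : ∀ j, V j ⟶ J j) (r : ∀ j, J j ⟶ V (j + 1)) (hlr : ∀ j, l j ≫ r j = 0)
    (hZ : ∀ i W, ((ShortComplex.mk _ _ (hkq i)).map
      ((evaluation 𝒲 (CochainComplex C ℤ)).obj W)).ShortExact)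
    (hV : ∀ j W, ((ShortComplex.mk _ _ (hlr j)).map
      ((evaluation 𝒲 (CochainComplex C ℤ)).obj W)).ShortExact)
    (φ : ∀ i j, i + j = n → (G i ⟶ J j))
    (hφ : ∀ i j h W, QuasiIso ((φ i j h).app W))
    (comm : ∀ i j (h : (i + 1) + j = n),
      (q (i + 1) ≫ k i) ≫ φ i (j + 1) (by omega) = φ (i + 1) j h ≫ r j ≫ l (j + 1))
    (hZ₀ : ∀ W, IsZero ((Z (n + 1)).obj W)) (hV₀ : ∀ W, IsZero ((V (n + 1)).obj W)) :
    Nonempty (Z 0 ⋙ Q ≅ (V 0 ⋙ Q) ⋙ CategoryTheory.shiftFunctor (DerivedCategory C) (n : ℤ)) := by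
  have h₁ : (1 : ℤ) + n = n + 1 := by ring
  have h₂ : (n + 1 : ℤ) + (-1) = n := by ring
  have h₃ (i : ℕ) : (1 : ℤ) + i = ((i + 1 : ℕ) : ℤ) := by push_cast; ring
  let η₀ : Z 0 ⟶ V (n + 1) := 0
  -- One rung: a map `η` on the quotients compatible with the quasi-isomorphism `φ i j` determines a
  -- map `η'` on the kernels, and the cones of `η` and `η'` differ by one shift.
  have step (i j : ℕ) (h : i + j = n) (η : Z i ⟶ V (j + 1)) (hη : φ i j h ≫ r j = q i ≫ η) :
      ∃ η' : Z (i + 1) ⟶ V j, η' ≫ l j = k i ≫ φ i j h ∧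
        Nonempty (coneFunctor η ⋙ Q ≅
          (coneFunctor η' ⋙ Q) ⋙ CategoryTheory.shiftFunctor (DerivedCategory C) (1 : ℤ)) := by
    obtain ⟨η', hη'⟩ := exists_lift_of_shortExact (ShortComplex.mk _ _ (hlr j)) (hV j)
      (k i ≫ φ i j h) (by
        change (k i ≫ φ i j h) ≫ r j = 0
        rw [Category.assoc, hη, ← Category.assoc, hkq, zero_comp])
    let t : ShortComplex.mk _ _ (hkq i) ⟶ ShortComplex.mk _ _ (hlr j) :=
      { τ₁ := η', τ₂ := φ i j h, τ₃ := η, comm₁₂ := hη', comm₂₃ := hη }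
    exact ⟨η', hη', coneFunctor_iso_shift _ _ t (hZ i) (hV j) (hφ i j h)⟩
  -- After `i` rungs the cone of the zero map `η₀ : Z 0 ⟶ V (n + 1)` is the `i`-fold shift of the
  -- cone of a map `Z i ⟶ V (j + 1)` that is ready for the next rung.
  have main (i : ℕ) : ∀ j (h : i + j = n), ∃ η : Z i ⟶ V (j + 1), φ i j h ≫ r j = q i ≫ η ∧
      Nonempty (coneFunctor η₀ ⋙ Q ≅
        (coneFunctor η ⋙ Q) ⋙ CategoryTheory.shiftFunctor (DerivedCategory C) (i : ℤ)) := by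
    induction i with
    | zero =>
      intro j h
      obtain rfl : j = n := by omega
      refine ⟨η₀, ?_, ⟨(Functor.rightUnitor _).symm ≪≫
        Functor.isoWhiskerLeft _ (CategoryTheory.shiftFunctorZero' _ _ rfl).symm⟩⟩
      ext1
      ext1 W
      exact (hV₀ W).eq_of_tgt _ _
    | succ i ih =>
      intro j h
      obtain ⟨η, hη, ⟨e⟩⟩ := ih (j + 1) (by omega)
      obtain ⟨η', hη', ⟨e'⟩⟩ := step i (j + 1) (by omega) η hη
      refine ⟨η', ?_, ⟨e ≪≫ Functor.isoWhiskerRight e' _ ≪≫ Functor.associator _ _ _ ≪≫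
        Functor.isoWhiskerLeft _
          (CategoryTheory.shiftFunctorAdd' (DerivedCategory C) (1 : ℤ) i _ (h₃ i)).symm⟩⟩
      -- The compatibility of `η'` with the next square may be tested after the monomorphism `l (j +
      -- 1)`, where it becomes `comm`.
      have (W : 𝒲) : Mono ((l (j + 1)).app W) := (hV (j + 1) W).mono_f
      have : Mono (l (j + 1)) := NatTrans.mono_of_mono_app _
      rw [← cancel_mono (l (j + 1)), Category.assoc, ← comm, Category.assoc, Category.assoc, hη']
  obtain ⟨η, hη, ⟨e⟩⟩ := main n 0 rfl
  obtain ⟨η', -, ⟨e'⟩⟩ := step n 0 rfl η hη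
  obtain ⟨e₁⟩ := coneFunctor_iso_of_isZero_right η₀ hV₀
  obtain ⟨e₂⟩ := coneFunctor_iso_of_isZero_left η' hZ₀
  -- There are `n + 1` rungs, but the cone of `η₀` is already `Z 0` shifted by one. So the ladder
  -- gives `Z 0[1] ≅ V 0[1][n]`, and a shift by `-1` remains to be applied.
  let F : (Z 0 ⋙ Q) ⋙ CategoryTheory.shiftFunctor (DerivedCategory C) (1 : ℤ) ≅
      (V 0 ⋙ Q) ⋙ CategoryTheory.shiftFunctor (DerivedCategory C) (1 : ℤ) ⋙
        CategoryTheory.shiftFunctor (DerivedCategory C) (n : ℤ) :=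
    e₁.symm ≪≫ e ≪≫ Functor.isoWhiskerRight (e' ≪≫ Functor.isoWhiskerRight e₂.symm _) _ ≪≫
      Functor.associator _ _ _
  exact ⟨(Functor.rightUnitor _).symm ≪≫
    Functor.isoWhiskerLeft _ (shiftFunctorCompIsoId (DerivedCategory C) (1 : ℤ) (-1) rfl).symm ≪≫
    (Functor.associator _ _ _).symm ≪≫ Functor.isoWhiskerRight F _ ≪≫
    Functor.associator _ _ _ ≪≫ Functor.isoWhiskerLeft _ (
      Functor.isoWhiskerRight (CategoryTheory.shiftFunctorAdd' (DerivedCategory C) (1 : ℤ) n (n + 1)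
        h₁).symm _ ≪≫
      (CategoryTheory.shiftFunctorAdd' (DerivedCategory C) (n + 1 : ℤ) (-1) n h₂).symm)⟩

end Ladder

/-! ### One-sided structures of bimodules -/

section OneSided

open scoped ModuleCat

variable {A : Type u} [Ring A] [Algebra ℂ A]

theorem Env.induction_on {p : Env A → Prop} (x : Env A) (zero : p 0)
    (tmul : ∀ a b, p (Env.tmul a b)) (add : ∀ x y, p x → p y → p (x + y)) : p x :=
  TensorProduct.induction_on (motive := p) x zero (fun a b => tmul a b.unop) add

/-- The left structure of a bimodule. -/
noncomputable def Env.left : A →+* Env A :=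
  (Algebra.TensorProduct.includeLeftRingHom : A →+* A ⊗[ℂ] Aᵐᵒᵖ)

/-- The right structure of a bimodule. -/
noncomputable def Env.right : Aᵐᵒᵖ →+* Env A :=
  ((Algebra.TensorProduct.includeRight : Aᵐᵒᵖ →ₐ[ℂ] A ⊗[ℂ] Aᵐᵒᵖ) : Aᵐᵒᵖ →+* A ⊗[ℂ] Aᵐᵒᵖ)

noncomputable instance (B : ModuleCat.{u} (Env A)) : Module A B := Module.compHom B Env.left

noncomputable instance (B : ModuleCat.{u} (Env A)) : Module Aᵐᵒᵖ B := Module.compHom B Env.right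

variable {B B' : ModuleCat.{u} (Env A)}

theorem left_smul_def (a : A) (b : B) : a • b = Env.tmul a 1 • b := rfl

theorem right_smul_def (a : A) (b : B) : op a • b = Env.tmul 1 a • b := rfl

theorem tmul_smul (a a' : A) (b : B) : Env.tmul a a' • b = a • op a' • b := by
  rw [left_smul_def, right_smul_def, smul_smul, Env.tmul_mul_tmul, mul_one, mul_one]

instance : SMulCommClass A Aᵐᵒᵖ B where
  smul_comm a a' b := by
    obtain ⟨a', rfl⟩ := op_surjective a'
    rw [left_smul_def, right_smul_def, left_smul_def, right_smul_def, smul_smul, smul_smul,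
      Env.tmul_mul_tmul, Env.tmul_mul_tmul, mul_one, mul_one, one_mul, one_mul]

/-- Right multiplication by an element of `A`. -/
noncomputable def rightMul (B : ModuleCat.{u} (Env A)) (a : A) : B →ₗ[A] B where
  toFun b := op a • b
  map_add' := smul_add _
  map_smul' c b := (smul_comm c (op a) b).symm

/-- A bimodule homomorphism as a homomorphism of left modules. -/
noncomputable def leftLinear (g : B ⟶ B') : B →ₗ[A] B' where
  toFun := g.hom
  map_add' := map_add g.hom
  map_smul' a b := g.hom.map_smul (Env.tmul a 1) b

theorem hom_smul (g : B ⟶ B') (a : A) (b : B) : g.hom (a • b) = a • g.hom b :=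
  g.hom.map_smul (Env.tmul a 1) b

theorem hom_op_smul (g : B ⟶ B') (a : A) (b : B) : g.hom (op a • b) = op a • g.hom b :=
  g.hom.map_smul (Env.tmul 1 a) b

end OneSided

/-! ### The functors `Hom_A(B, -)` -/

section RHom

open scoped ModuleCat

variable {A : Type u} [Ring A] [Algebra ℂ A]

/-- The left module `Hom_A(B, Y)` of a bimodule `B` and a left module `Y`. -/
def RHom (B : ModuleCat.{u} (Env A)) (Y : Type u) [AddCommGroup Y] [Module A Y] : Type u :=
  B →ₗ[A] Y

namespace RHom

variable (B : ModuleCat.{u} (Env A)) (Y : Type u) [AddCommGroup Y] [Module A Y]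

noncomputable instance : AddCommGroup (RHom B Y) := inferInstanceAs (AddCommGroup (B →ₗ[A] Y))

instance : FunLike (RHom B Y) B Y := inferInstanceAs (FunLike (B →ₗ[A] Y) B Y)

instance : LinearMapClass (RHom B Y) A B Y := inferInstanceAs (LinearMapClass (B →ₗ[A] Y) A B Y)

variable {B Y}

@[ext] theorem ext {f g : RHom B Y} (h : ∀ b, f b = g b) : f = g := LinearMap.ext h

noncomputable instance : Module A (RHom B Y) where
  smul a f := (f : B →ₗ[A] Y).comp (rightMul B a)
  one_smul f := ext fun b => congrArg f (one_smul Aᵐᵒᵖ b)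
  mul_smul a a' f := ext fun b => congrArg f (mul_smul (op a') (op a) b)
  smul_zero _ := rfl
  smul_add _ _ _ := rfl
  add_smul a a' f := ext fun b =>
    (congrArg f (add_smul (op a) (op a') b)).trans (map_add f _ _)
  zero_smul f := ext fun b => (congrArg f (zero_smul Aᵐᵒᵖ b)).trans (map_zero f)

@[simp] theorem smul_apply (a : A) (f : RHom B Y) (b : B) : (a • f) b = f (op a • b) := rfl

noncomputable instance : Module Aᵐᵒᵖ (RHom B A) := inferInstanceAs (Module Aᵐᵒᵖ (B →ₗ[A] A))

noncomputable instance : Module ℂ (RHom B A) := inferInstanceAs (Module ℂ (B →ₗ[A] A))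

instance : SMulCommClass A Aᵐᵒᵖ (RHom B A) := ⟨fun _ _ _ => rfl⟩

instance : SMulCommClass A ℂ (RHom B A) := ⟨fun _ _ _ => rfl⟩

instance : SMulCommClass Aᵐᵒᵖ ℂ (RHom B A) :=
  inferInstanceAs (SMulCommClass Aᵐᵒᵖ ℂ (B →ₗ[A] A))

end RHom

/-- The functor `Hom_A(B, -)`. -/
noncomputable def rhomFunctor (B : ModuleCat.{u} (Env A)) : ModuleCat.{u} A ⥤ ModuleCat.{u} A where
  obj Y := ModuleCat.of A (RHom B Y)
  map f := ModuleCat.ofHom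
    { toFun := fun g : RHom B _ => (f.hom.comp (g : B →ₗ[A] _) : RHom B _)
      map_add' := fun g g' => RHom.ext fun b => map_add f.hom (g b) (g' b)
      map_smul' := fun _ _ => rfl }

instance (B : ModuleCat.{u} (Env A)) : (rhomFunctor B).Additive where
  map_add := by intros; ext; rfl

/-- `Hom_A(-, Y)` on bimodule homomorphisms. -/
noncomputable def RHom.precomp {B B' : ModuleCat.{u} (Env A)} (g : B ⟶ B') (Y : Type u)
    [AddCommGroup Y] [Module A Y] : RHom B' Y →ₗ[A] RHom B Y where
  toFun f := ((f : B' →ₗ[A] Y).comp (leftLinear g) : B →ₗ[A] Y)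
  map_add' _ _ := rfl
  map_smul' a f := RHom.ext fun b => congrArg f (hom_op_smul g a b).symm

/-- The contravariant functoriality of `Hom_A(B, -)` in the bimodule `B`. -/
noncomputable def rhomMap {B B' : ModuleCat.{u} (Env A)} (g : B ⟶ B') :
    rhomFunctor B' ⟶ rhomFunctor B where
  app Y := ModuleCat.ofHom (RHom.precomp g Y)
  naturality _ _ _ := rfl

end RHom

/-! ### Double duals and Nakayama functors -/

section Nakayama

open scoped ModuleCat

variable {A : Type u} [Ring A] [Algebra ℂ A]

/-- The double dual of a left module. -/
def DoubleDual (M : ModuleCat.{u} A) : Type u := Module.Dual ℂ (Module.Dual ℂ M)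

namespace DoubleDual

variable {M : ModuleCat.{u} A}

noncomputable instance : AddCommGroup (DoubleDual M) :=
  inferInstanceAs (AddCommGroup (Module.Dual ℂ (Module.Dual ℂ M)))

instance : FunLike (DoubleDual M) (Module.Dual ℂ M) ℂ :=
  inferInstanceAs (FunLike (Module.Dual ℂ (Module.Dual ℂ M)) _ _)

instance : LinearMapClass (DoubleDual M) ℂ (Module.Dual ℂ M) ℂ :=
  inferInstanceAs (LinearMapClass (Module.Dual ℂ (Module.Dual ℂ M)) _ _ _)

@[ext] theorem ext {x y : DoubleDual M} (h : ∀ ξ, x ξ = y ξ) : x = y := LinearMap.ext h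

@[simp] theorem add_apply (x y : DoubleDual M) (ξ : Module.Dual ℂ M) : (x + y) ξ = x ξ + y ξ := rfl

noncomputable instance : Module A (DoubleDual M) where
  smul a x := (x : Module.Dual ℂ (Module.Dual ℂ M)).comp (Algebra.lsmul ℂ ℂ M a).dualMap
  one_smul x := ext fun ξ => congrArg x (LinearMap.ext fun m => congrArg ξ (one_smul A m))
  mul_smul a a' x := ext fun ξ => congrArg x (LinearMap.ext fun m => congrArg ξ (mul_smul a a' m))
  smul_zero _ := rfl
  smul_add _ _ _ := rfl
  add_smul a a' x := ext fun ξ => (congrArg x (LinearMap.ext fun m =>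
    (congrArg ξ (add_smul a a' m)).trans (map_add ξ _ _))).trans (map_add x _ _)
  zero_smul x := ext fun ξ => (congrArg x (LinearMap.ext fun m =>
    (congrArg ξ (zero_smul A m)).trans (map_zero ξ))).trans (map_zero x)

theorem smul_apply (a : A) (x : DoubleDual M) (ξ : Module.Dual ℂ M) :
    (a • x) ξ = x (ξ ∘ₗ Algebra.lsmul ℂ ℂ M a) := rfl

end DoubleDual

/-- The double dual functor. -/
noncomputable def doubleDualFunctor : ModuleCat.{u} A ⥤ ModuleCat.{u} A where
  obj M := ModuleCat.of A (DoubleDual M)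
  map f := ModuleCat.ofHom
    { toFun := fun x => ((f.hom.restrictScalars ℂ).dualMap.dualMap x : Module.Dual ℂ _)
      map_add' := fun _ _ => rfl
      map_smul' := fun a x => DoubleDual.ext fun ξ => congrArg x (LinearMap.ext fun m =>
        congrArg ξ (f.hom.map_smul a m)) }

instance : (doubleDualFunctor (A := A)).Additive where
  map_add {M N f g} := by
    ext (x : DoubleDual M)
    refine DoubleDual.ext fun ξ => ?_
    refine (congrArg x (LinearMap.ext fun m => ?_)).trans (map_add x _ _)
    exact map_add ξ (f.hom m) (g.hom m)

/-- The map from a module to its double dual. -/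
noncomputable def doubleDualUnit : 𝟭 (ModuleCat.{u} A) ⟶ doubleDualFunctor where
  app M := ModuleCat.ofHom
    { toFun := fun m => (Module.Dual.eval ℂ M m : Module.Dual ℂ (Module.Dual ℂ M))
      map_add' := fun m m' => map_add (Module.Dual.eval ℂ M) m m'
      map_smul' := fun _ _ => rfl }
  naturality _ _ _ := rfl

section

variable (I : Type u) [AddCommGroup I] [Module A I] [Module Aᵐᵒᵖ I] [Module ℂ I]
  [SMulCommClass A Aᵐᵒᵖ I] [SMulCommClass A ℂ I] [SMulCommClass Aᵐᵒᵖ ℂ I]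

variable (A) in
/-- The left module `Hom_A(M, I)^*`, for a bimodule `I`. -/
def NakDual (M : Type u) [AddCommGroup M] [Module A M] : Type u := Module.Dual ℂ (M →ₗ[A] I)

namespace NakDual

variable {I} {M : Type u} [AddCommGroup M] [Module A M]

noncomputable instance : AddCommGroup (NakDual A I M) :=
  inferInstanceAs (AddCommGroup (Module.Dual ℂ (M →ₗ[A] I)))

instance : FunLike (NakDual A I M) (M →ₗ[A] I) ℂ :=
  inferInstanceAs (FunLike (Module.Dual ℂ (M →ₗ[A] I)) _ _)

instance : LinearMapClass (NakDual A I M) ℂ (M →ₗ[A] I) ℂ :=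
  inferInstanceAs (LinearMapClass (Module.Dual ℂ (M →ₗ[A] I)) _ _ _)

@[ext] theorem ext {x y : NakDual A I M} (h : ∀ ξ, x ξ = y ξ) : x = y := LinearMap.ext h

noncomputable instance : Module A (NakDual A I M) where
  smul a x := (x : Module.Dual ℂ (M →ₗ[A] I)).comp
    ({ toFun := fun f => op a • f
       map_add' := smul_add _
       map_smul' := fun c f => smul_comm (op a) c f } : (M →ₗ[A] I) →ₗ[ℂ] (M →ₗ[A] I))
  one_smul x := ext fun f => congrArg x (one_smul Aᵐᵒᵖ f)
  mul_smul a a' x := ext fun f => congrArg x (mul_smul (op a') (op a) f)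
  smul_zero _ := rfl
  smul_add _ _ _ := rfl
  add_smul a a' x := ext fun f => (congrArg x (add_smul (op a) (op a') f)).trans (map_add x _ _)
  zero_smul x := ext fun f => (congrArg x (zero_smul Aᵐᵒᵖ f)).trans (map_zero x)

end NakDual

/-- The functor `M ↦ Hom_A(M, I)^*`. -/
noncomputable def nakFunctor : ModuleCat.{u} A ⥤ ModuleCat.{u} A where
  obj M := ModuleCat.of A (NakDual A I M)
  map {M N} f := ModuleCat.ofHom
    { toFun := fun x => ((x : Module.Dual ℂ (M →ₗ[A] I)).comp (LinearMap.lcomp ℂ I f.hom) :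
        Module.Dual ℂ (N →ₗ[A] I))
      map_add' := fun _ _ => rfl
      map_smul' := fun _ _ => rfl }

instance : (nakFunctor (A := A) I).Additive where
  map_add {M N f g} := by
    ext (x : NakDual A I M)
    refine NakDual.ext fun h => ?_
    exact (congrArg x (LinearMap.comp_add f.hom g.hom h)).trans (map_add x _ _)

end

variable {B B' : ModuleCat.{u} (Env A)}

/-- The functor `M ↦ Hom_A(M, Hom_A(B, A))^*`, that is, `M ↦ Hom_A(B ⊗_A M, A)^*`. -/
noncomputable abbrev nakTensor (B : ModuleCat.{u} (Env A)) : ModuleCat.{u} A ⥤ ModuleCat.{u} A :=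
  nakFunctor (RHom B A)

/-- The functoriality of `nakTensor B` in the bimodule `B`. -/
noncomputable def nakTensorMap (g : B ⟶ B') : nakTensor B ⟶ nakTensor B' where
  app M := ModuleCat.ofHom
    { toFun := fun x => ((x : Module.Dual ℂ (M →ₗ[A] RHom B A)).comp
        ({ toFun := fun f => (RHom.precomp g A).comp f
           map_add' := fun f f' => LinearMap.comp_add _ _ _
           map_smul' := fun _ _ => rfl } : (M →ₗ[A] RHom B' A) →ₗ[ℂ] (M →ₗ[A] RHom B A)) :
        Module.Dual ℂ (M →ₗ[A] RHom B' A))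
      map_add' := fun _ _ => rfl
      map_smul' := fun _ _ => rfl }
  naturality _ _ _ := rfl

/-- The functor `M ↦ Hom_A(B, M^**)`. -/
noncomputable abbrev rhomDual (B : ModuleCat.{u} (Env A)) : ModuleCat.{u} A ⥤ ModuleCat.{u} A :=
  doubleDualFunctor ⋙ rhomFunctor B

/-- The contravariant functoriality of `rhomDual B` in the bimodule `B`. -/
noncomputable abbrev rhomDualMap (g : B ⟶ B') : rhomDual B' ⟶ rhomDual B :=
  Functor.whiskerLeft _ (rhomMap g)

end Nakayama

/-! ### Linear algebra -/

/-- The map is defined on the range of `g` and extended over a complement. Exactness of vector space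
duality, and the descent of traces to the derived category, rest on this. -/
theorem LinearMap.exists_comp_eq_of_ker_le {K V V' W : Type*} [Field K] [AddCommGroup V]
    [Module K V] [AddCommGroup V'] [Module K V'] [AddCommGroup W] [Module K W]
    (g : V →ₗ[K] V') (e : V →ₗ[K] W) (h : LinearMap.ker g ≤ LinearMap.ker e) :
    ∃ f : V' →ₗ[K] W, f ∘ₗ g = e := by
  obtain ⟨f, hf⟩ := LinearMap.exists_extend
    (((LinearMap.ker g).liftQ e h) ∘ₗ g.quotKerEquivRange.symm.toLinearMap)
  refine ⟨f, LinearMap.ext fun x => ?_⟩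
  have := LinearMap.congr_fun hf ⟨g x, x, rfl⟩
  refine this.trans ?_
  have h2 : g.quotKerEquivRange.symm ⟨g x, x, rfl⟩ = Submodule.Quotient.mk x := by
    rw [LinearEquiv.symm_apply_eq]
    rfl
  simp [h2]

/-- A finitely generated projective module has a finite dual basis. -/
theorem Module.Projective.exists_dualBasis {R P : Type*} [Ring R] [AddCommGroup P] [Module R P]
    [Module.Finite R P] [Module.Projective R P] :
    ∃ (m : ℕ) (p : Fin m → P) (β : Fin m → P →ₗ[R] R), ∀ x, x = ∑ k, β k x • p k := by
  obtain ⟨m, f, g, -, -, h⟩ := Module.Finite.exists_comp_eq_id_of_projective R P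
  refine ⟨m, fun k => f (Pi.single k 1), fun k => LinearMap.proj k ∘ₗ g, fun x => ?_⟩
  have h1 : f (g x) = x := LinearMap.congr_fun h x
  conv_lhs => rw [← h1, pi_eq_sum_univ' (g x), map_sum]
  refine Finset.sum_congr rfl fun k _ => ?_
  rw [map_smul]
  congr 2

section Contraction

open scoped ModuleCat

variable {A : Type u} [Ring A] [Algebra ℂ A] {M N : ModuleCat.{u} A}

/-- The contraction `a ⊗ op b ↦ a * h (b • m)`. -/
noncomputable def contract (h : M →ₗ[ℂ] A) (m : M) : Env A →ₗ[ℂ] A :=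
  (TensorProduct.lift (LinearMap.mk₂ ℂ (fun (a : A) (b : Aᵐᵒᵖ) => a * h (b.unop • m))
    (fun _ _ _ => add_mul _ _ _) (fun _ _ _ => smul_mul_assoc _ _ _)
    (fun a b b' => by rw [MulOpposite.unop_add, add_smul, map_add, mul_add])
    (fun c a b => by rw [MulOpposite.unop_smul, smul_assoc, map_smul, mul_smul_comm])) :
    A ⊗[ℂ] Aᵐᵒᵖ →ₗ[ℂ] A)

@[simp] theorem contract_tmul (h : M →ₗ[ℂ] A) (m : M) (a b : A) :
    contract h m (Env.tmul a b) = a * h (b • m) := rfl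

theorem contract_left_mul (h : M →ₗ[ℂ] A) (m : M) (a : A) (x : Env A) :
    contract h m (Env.tmul a 1 * x) = a * contract h m x := by
  induction x using Env.induction_on with
  | zero => simp
  | tmul u v => rw [Env.tmul_mul_tmul, contract_tmul, contract_tmul, mul_one, mul_assoc]
  | add x y hx hy => rw [mul_add, map_add, hx, hy, map_add, mul_add]

theorem contract_right_mul (h : M →ₗ[ℂ] A) (m : M) (a : A) (x : Env A) :
    contract h m (Env.tmul 1 a * x) = contract h (a • m) x := by
  induction x using Env.induction_on with
  | zero => simp
  | tmul u v => rw [Env.tmul_mul_tmul, contract_tmul, contract_tmul, one_mul, mul_smul]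
  | add x y hx hy => rw [mul_add, map_add, hx, hy, map_add]

theorem contract_add (h : M →ₗ[ℂ] A) (m m' : M) (x : Env A) :
    contract h (m + m') x = contract h m x + contract h m' x := by
  induction x using Env.induction_on with
  | zero => simp
  | tmul u v => simp only [contract_tmul, smul_add, map_add, mul_add]
  | add x y hx hy => simp only [map_add, hx, hy]; abel

/-- The inner structure of `A ⊗ A` acts on the linear map `h` alone, while the two preceding rules
show the outer structure acting on the value and on `m`. -/
theorem contract_mul_tmul (h : M →ₗ[ℂ] A) (m : M) (a b : A) (x : Env A) :
    contract h m (x * Env.tmul a b) =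
      contract (LinearMap.mulLeft ℂ a ∘ₗ h ∘ₗ Algebra.lsmul ℂ ℂ M b) m x := by
  induction x using Env.induction_on with
  | zero => simp
  | tmul u v =>
    rw [Env.tmul_mul_tmul, contract_tmul, contract_tmul, mul_assoc, mul_smul]
    rfl
  | add x y hx hy => simp only [add_mul, map_add, hx, hy]

theorem contract_comp (f : M ⟶ N) (h : N →ₗ[ℂ] A) (m : M) (x : Env A) :
    contract h (f.hom m) x = contract (h ∘ₗ f.hom.restrictScalars ℂ) m x := by
  induction x using Env.induction_on with
  | zero => simp
  | tmul u v =>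
    rw [contract_tmul, contract_tmul, ← f.hom.map_smul]
    rfl
  | add x y hx hy => simp only [map_add, hx, hy]

theorem contract_add_left (h h' : M →ₗ[ℂ] A) (m : M) (x : Env A) :
    contract (h + h') m x = contract h m x + contract h' m x := by
  induction x using Env.induction_on with
  | zero => simp
  | tmul u v => simp only [contract_tmul, LinearMap.add_apply, mul_add]
  | add x y hx hy => simp only [map_add, hx, hy]; abel

theorem contract_smul_left (c : ℂ) (h : M →ₗ[ℂ] A) (m : M) (x : Env A) :
    contract (c • h) m x = c • contract h m x := by
  induction x using Env.induction_on with
  | zero => simp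
  | tmul u v => simp only [contract_tmul, LinearMap.smul_apply, mul_smul_comm]
  | add x y hx hy => simp only [map_add, hx, hy, smul_add]

variable {B B' : ModuleCat.{u} (Env A)}

/-- The homomorphism `M → Hom_A(B, A)` given by `ν : B → A ⊗ A` and a linear map `h : M → A`. -/
noncomputable def contractHom (ν : B →ₗ[Env A] Env A) (h : M →ₗ[ℂ] A) : M →ₗ[A] RHom B A where
  toFun m := ({ toFun := fun b => contract h m (ν b)
                map_add' := fun b b' => by rw [map_add, map_add]
                map_smul' := fun a b => by
                  refine (congrArg (contract h m) (ν.map_smul (Env.tmul a 1) b)).trans ?_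
                  exact contract_left_mul h m a (ν b) } : B →ₗ[A] A)
  map_add' m m' := RHom.ext fun b => contract_add h m m' (ν b)
  map_smul' a m := RHom.ext fun b =>
    ((congrArg (contract h m) (ν.map_smul (Env.tmul 1 a) b)).trans
      (contract_right_mul h m a (ν b))).symm

theorem contractHom_comp (f : M ⟶ N) (ν : B →ₗ[Env A] Env A) (h : N →ₗ[ℂ] A) :
    (contractHom ν h) ∘ₗ f.hom = contractHom ν (h ∘ₗ f.hom.restrictScalars ℂ) :=
  LinearMap.ext fun m => RHom.ext fun b => contract_comp f h m (ν b)

theorem contractHom_add (ν ν' : B →ₗ[Env A] Env A) (h : M →ₗ[ℂ] A) :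
    contractHom (ν + ν') h = contractHom ν h + contractHom ν' h :=
  LinearMap.ext fun m => RHom.ext fun b => map_add (contract h m) (ν b) (ν' b)

theorem contractHom_add_right (ν : B →ₗ[Env A] Env A) (h h' : M →ₗ[ℂ] A) :
    contractHom ν (h + h') = contractHom ν h + contractHom ν h' :=
  LinearMap.ext fun m => RHom.ext fun b => contract_add_left h h' m (ν b)

theorem contractHom_smul_right (c : ℂ) (ν : B →ₗ[Env A] Env A) (h : M →ₗ[ℂ] A) :
    contractHom ν (c • h) = c • contractHom ν h :=
  LinearMap.ext fun m => RHom.ext fun b => contract_smul_left c h m (ν b)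

theorem algebraMap_tmul_one (c : ℂ) :
    Env.tmul (algebraMap ℂ A c) 1 = Env.tmul 1 (algebraMap ℂ A c) := by
  change (algebraMap ℂ A c ⊗ₜ[ℂ] (1 : Aᵐᵒᵖ) : A ⊗[ℂ] Aᵐᵒᵖ) = 1 ⊗ₜ[ℂ] op (algebraMap ℂ A c)
  rw [Algebra.algebraMap_eq_smul_one, op_smul, op_one, TensorProduct.smul_tmul]

instance : IsScalarTower ℂ A (RHom B A) := IsScalarTower.of_algebraMap_smul fun c f => by
  refine RHom.ext fun b => ?_
  rw [RHom.smul_apply, right_smul_def, ← algebraMap_tmul_one]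
  refine (LinearMap.map_smul (f : B →ₗ[A] A) (algebraMap ℂ A c) b).trans ?_
  exact (Algebra.smul_def c (f b)).symm

/-- Evaluation at an element of the bimodule. -/
noncomputable def evalHom (w : M →ₗ[A] RHom B A) (b : B) : M →ₗ[ℂ] A where
  toFun m := w m b
  map_add' m m' := by rw [map_add]; rfl
  map_smul' c m := by
    refine congrArg (fun f : RHom B A => f b) ((w.restrictScalars ℂ).map_smul c m)

@[simp] theorem evalHom_apply (w : M →ₗ[A] RHom B A) (b : B) (m : M) : evalHom w b m = w m b := rfl

/-- The left factor of `x` comes out because `w m` is linear, and the right factor moves to `m`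
because `w` is. Thus the linear map `evalHom w b : M → A` determines `w` on the whole bimodule
generated by `b`. -/
theorem apply_smul_eq_contract (w : M →ₗ[A] RHom B A) (b : B) (m : M) (x : Env A) :
    w m (x • b) = contract (evalHom w b) m x := by
  induction x using Env.induction_on with
  | zero => simp
  | tmul u v =>
    rw [_root_.tmul_smul, map_smul, contract_tmul, evalHom_apply, w.map_smul]
    rfl
  | add x y hx hy => rw [add_smul, map_add, map_add, hx, hy]

/-- With a finite dual basis of `B`, an `A`-linear `w` is encoded by finitely many maps `M → A` that
are merely linear over `ℂ`. For `B = A ⊗ A` this is `Hom_A(M, Hom_A(B, A)) = Hom_ℂ(M, A)`. -/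
theorem eq_sum_contractHom {m : ℕ} {p : Fin m → B} {β : Fin m → B →ₗ[Env A] Env A}
    (hp : ∀ x, x = ∑ k, β k x • p k) (w : M →ₗ[A] RHom B A) :
    w = ∑ k, contractHom (β k) (evalHom w (p k)) := by
  refine LinearMap.ext fun x => RHom.ext fun b => ?_
  conv_lhs => rw [hp b, map_sum]
  simp only [apply_smul_eq_contract]
  rw [LinearMap.sum_apply]
  symm
  exact map_sum ({toFun := fun f : RHom B A => f b, map_zero' := rfl, map_add' := fun _ _ => rfl} :
    RHom B A →+ A) _ _

end Contraction

/-! ### Exactness of the functors -/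

section Exactness

open scoped ModuleCat

variable {A : Type u} [Ring A] [Algebra ℂ A]

theorem LinearMap.dualMap_exact {K V V' V'' : Type*} [Field K] [AddCommGroup V]
    [Module K V] [AddCommGroup V'] [Module K V'] [AddCommGroup V''] [Module K V'']
    {f : V →ₗ[K] V'} {g : V' →ₗ[K] V''} (h : Function.Exact f g) :
    Function.Exact g.dualMap f.dualMap := by
  intro x
  constructor
  · intro hx
    obtain ⟨y, hy⟩ := LinearMap.exists_comp_eq_of_ker_le g x (fun v hv => by
      obtain ⟨u, rfl⟩ := (h v).1 hv
      exact LinearMap.congr_fun hx u)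
    exact ⟨y, hy⟩
  · rintro ⟨y, rfl⟩
    exact LinearMap.ext fun v => (congrArg y (h.apply_apply_eq_zero v)).trans (map_zero y)

theorem preservesHomology_of_function_exact (F : ModuleCat.{u} A ⥤ ModuleCat.{u} A) [F.Additive]
    (h : ∀ {X Y Z : ModuleCat.{u} A} (f : X ⟶ Y) (g : Y ⟶ Z), Function.Exact f.hom g.hom →
      Function.Exact (F.map f).hom (F.map g).hom) : F.PreservesHomology :=
  ((Functor.exact_tfae F).out 1 2).1 fun (S : ShortComplex (ModuleCat.{u} A)) hS =>
    (ShortComplex.ShortExact.moduleCat_exact_iff_function_exact (S.map F)).2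
      (h S.f S.g ((ShortComplex.ShortExact.moduleCat_exact_iff_function_exact S).1 hS))

instance : (doubleDualFunctor (A := A)).PreservesHomology :=
  preservesHomology_of_function_exact _ fun {X Y Z} f g h => by
    have h' : Function.Exact (f.hom.restrictScalars ℂ) (g.hom.restrictScalars ℂ) := h
    exact LinearMap.dualMap_exact (LinearMap.dualMap_exact h')

theorem rhomFunctor_preservesHomology (B : ModuleCat.{u} (Env A)) [Module.Projective A B] :
    (rhomFunctor B).PreservesHomology :=
  preservesHomology_of_function_exact _ fun {X Y Z} f g h => by
    intro w
    let w' : B →ₗ[A] Y := w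
    constructor
    · intro hw
      have hw' (b : B) : w' b ∈ LinearMap.range f.hom := by
        obtain ⟨x, hx⟩ := (h (w' b)).1 (DFunLike.congr_fun (F := RHom B Z) hw b)
        exact ⟨x, hx⟩
      obtain ⟨v, hv⟩ := Module.projective_lifting_property f.hom.rangeRestrict
        (w'.codRestrict _ hw') f.hom.surjective_rangeRestrict
      exact ⟨v, RHom.ext fun b => congrArg Subtype.val (LinearMap.congr_fun hv b)⟩
    · rintro ⟨v, rfl⟩
      exact RHom.ext fun b => h.apply_apply_eq_zero _

/-- `Hom_A(B, A)` is a summand of a power of the coinduced module `Hom_ℂ(A, A)`, hence injective.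
Concretely, the linear maps that encode `w` are extended over `ℂ` and contracted back. -/
theorem exists_extend_of_exact {B : ModuleCat.{u} (Env A)} [Module.Finite (Env A) B]
    [Module.Projective (Env A) B] {X Y Z : ModuleCat.{u} A} {f : X ⟶ Y} {g : Y ⟶ Z}
    (h : Function.Exact f.hom g.hom) (w : Y →ₗ[A] RHom B A) (hw : w ∘ₗ f.hom = 0) :
    ∃ w' : Z →ₗ[A] RHom B A, w' ∘ₗ g.hom = w := by
  obtain ⟨m, p, β, hp⟩ := Module.Projective.exists_dualBasis (R := Env A) (P := B)
  have key (k : Fin m) : ∃ h : Z →ₗ[ℂ] A, h ∘ₗ g.hom.restrictScalars ℂ = evalHom w (p k) := by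
    refine LinearMap.exists_comp_eq_of_ker_le _ _ fun y hy => ?_
    obtain ⟨x, rfl⟩ := (h y).1 hy
    exact congrArg (fun f : RHom B A => f (p k)) (LinearMap.congr_fun hw x)
  choose h hh using key
  refine ⟨∑ k, contractHom (β k) (h k), ?_⟩
  conv_rhs => rw [eq_sum_contractHom hp w]
  simp only [← hh, ← contractHom_comp]
  exact map_sum (LinearMap.lcomp ℂ (RHom B A) g.hom) _ _

theorem nakTensor_preservesHomology (B : ModuleCat.{u} (Env A)) [Module.Finite (Env A) B]
    [Module.Projective (Env A) B] : (nakTensor B).PreservesHomology :=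
  preservesHomology_of_function_exact _ fun {X Y Z} f g h => by
    refine LinearMap.dualMap_exact (f := LinearMap.lcomp ℂ (RHom B A) g.hom)
      (g := LinearMap.lcomp ℂ (RHom B A) f.hom) fun w => ⟨fun hw => ?_, ?_⟩
    · obtain ⟨w', hw'⟩ := exists_extend_of_exact h w hw
      exact ⟨w', hw'⟩
    · rintro ⟨w', rfl⟩
      refine LinearMap.ext fun x => ?_
      exact (congrArg w' (h.apply_apply_eq_zero x)).trans (map_zero w')

theorem doubleDualUnit_app_isIso (M : ModuleCat.{u} A) (hM : finDimModules A M) :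
    IsIso (doubleDualUnit.app M) := by
  have : FiniteDimensional ℂ M := hM
  rw [ConcreteCategory.isIso_iff_bijective]
  exact Module.bijective_dual_eval ℂ M

end Exactness

/-! ### Short exact sequences of bimodules -/

section ShortExact

open scoped ModuleCat

variable {A : Type u} [Ring A] [Algebra ℂ A] {B B' B'' : ModuleCat.{u} (Env A)}
  {k : B' ⟶ B} {q : B ⟶ B''}

@[simp] theorem rhomMap_comp {B B' B'' : ModuleCat.{u} (Env A)} (f : B ⟶ B') (g : B' ⟶ B'') :
    rhomMap (f ≫ g) = rhomMap g ≫ rhomMap f := rfl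

@[simp] theorem rhomMap_zero {B B' : ModuleCat.{u} (Env A)} :
    rhomMap (0 : B ⟶ B') = 0 := by
  ext Y (f : RHom B' Y)
  exact RHom.ext fun b => map_zero f

@[simp] theorem nakTensorMap_comp (f : B' ⟶ B) (g : B ⟶ B'') :
    nakTensorMap (f ≫ g) = nakTensorMap f ≫ nakTensorMap g := rfl

@[simp] theorem nakTensorMap_zero {B B' : ModuleCat.{u} (Env A)} :
    nakTensorMap (0 : B ⟶ B') = 0 := by
  ext M (x : NakDual A (RHom B A) M)
  refine NakDual.ext fun f => ?_
  refine (congrArg x (LinearMap.ext fun m => RHom.ext fun b => ?_)).trans (map_zero x)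
  exact map_zero (f m)

/-- Although the sequence of bimodules need not split, it splits as a sequence of left modules, and
the retraction `r` extends homomorphisms. -/
theorem rhom_precomp_surjective [Module.Projective A B''] (hk : Function.Injective k.hom)
    (hkq : Function.Exact k.hom q.hom) (hq : Function.Surjective q.hom) (Y : Type u)
    [AddCommGroup Y] [Module A Y] : Function.Surjective (RHom.precomp k Y) := by
  intro f
  obtain ⟨s, hs⟩ := Module.projective_lifting_property (leftLinear q) LinearMap.id hq
  have hs' (x : B'') : q.hom (s x) = x := LinearMap.congr_fun hs x
  have hr (b : B) : b - s (q.hom b) ∈ LinearMap.range (leftLinear k) := by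
    obtain ⟨x, hx⟩ := (hkq (b - s (q.hom b))).1 (by rw [map_sub, hs', sub_self])
    exact ⟨x, hx⟩
  let e := LinearEquiv.ofInjective (leftLinear k) hk
  let r : B →ₗ[A] B' := e.symm.toLinearMap ∘ₗ
    (LinearMap.codRestrict _ (LinearMap.id - s ∘ₗ leftLinear q) hr)
  refine ⟨(f : B' →ₗ[A] Y) ∘ₗ r, RHom.ext fun b => congrArg f ?_⟩
  change e.symm _ = b
  rw [LinearEquiv.symm_apply_eq]
  refine Subtype.ext ?_
  change k.hom b - s (q.hom (k.hom b)) = k.hom b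
  rw [hkq.apply_apply_eq_zero, map_zero, sub_zero]

theorem rhom_precomp_injective (hq : Function.Surjective q.hom) (Y : Type u)
    [AddCommGroup Y] [Module A Y] : Function.Injective (RHom.precomp q Y) := by
  intro f g h
  refine RHom.ext fun b => ?_
  obtain ⟨b, rfl⟩ := hq b
  exact DFunLike.congr_fun h b

theorem rhom_precomp_exact (hkq : Function.Exact k.hom q.hom)
    (hq : Function.Surjective q.hom) (Y : Type u)
    [AddCommGroup Y] [Module A Y] : Function.Exact (RHom.precomp q Y) (RHom.precomp k Y) := by
  intro f
  constructor
  · intro hf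
    have h1 : LinearMap.ker (leftLinear q) ≤ LinearMap.ker (f : B →ₗ[A] Y) := fun b hb => by
      obtain ⟨x, rfl⟩ := (hkq b).1 hb
      exact DFunLike.congr_fun hf x
    let e := (leftLinear q).quotKerEquivOfSurjective hq
    refine ⟨(Submodule.liftQ _ (f : B →ₗ[A] Y) h1) ∘ₗ e.symm.toLinearMap, RHom.ext fun b => ?_⟩
    have h2 : e.symm (q.hom b) = Submodule.Quotient.mk b := by
      rw [LinearEquiv.symm_apply_eq]
      rfl
    change Submodule.liftQ _ (f : B →ₗ[A] Y) h1 (e.symm (q.hom b)) = _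
    rw [h2]
    rfl
  · rintro ⟨g, rfl⟩
    exact RHom.ext fun b => (congrArg g (hkq.apply_apply_eq_zero b)).trans (map_zero g)

theorem rhomFunctor_shortExact [Module.Projective A B''] (w : k ≫ q = 0)
    (h : (ShortComplex.mk k q w).ShortExact) (Y : ModuleCat.{u} A) :
    (ShortComplex.mk ((rhomMap q).app Y) ((rhomMap k).app Y)
      (by rw [← NatTrans.comp_app, ← rhomMap_comp, w, rhomMap_zero]; rfl)).ShortExact where
  exact := (ShortComplex.ShortExact.moduleCat_exact_iff_function_exact _).2
    (rhom_precomp_exact ((ShortComplex.ShortExact.moduleCat_exact_iff_function_exact _).1 h.exact)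
      ((ModuleCat.epi_iff_surjective _).1 h.epi_g) Y)
  mono_f := (ModuleCat.mono_iff_injective _).2
    (rhom_precomp_injective ((ModuleCat.epi_iff_surjective _).1 h.epi_g) Y)
  epi_g := (ModuleCat.epi_iff_surjective _).2
    (rhom_precomp_surjective ((ModuleCat.mono_iff_injective _).1 h.mono_f)
      ((ShortComplex.ShortExact.moduleCat_exact_iff_function_exact _).1 h.exact)
      ((ModuleCat.epi_iff_surjective _).1 h.epi_g) Y)

/-- `Hom_A(-, A)` is exact on the sequence because it splits on the left, `Hom_A(M, -)` preserves
this because `M` is projective, and duality over `ℂ` is exact. The two reversals of arrows cancel.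
-/
theorem nakTensor_shortExact [Module.Projective A B''] (w : k ≫ q = 0)
    (h : (ShortComplex.mk k q w).ShortExact) (M : ModuleCat.{u} A) [Module.Projective A M] :
    (ShortComplex.mk ((nakTensorMap k).app M) ((nakTensorMap q).app M)
      (by rw [← NatTrans.comp_app, ← nakTensorMap_comp, w, nakTensorMap_zero]; rfl)).ShortExact :=
    by
  have hi := rhom_precomp_injective (A := A) ((ModuleCat.epi_iff_surjective _).1 h.epi_g) A
  have he := rhom_precomp_exact (A := A)
    ((ShortComplex.ShortExact.moduleCat_exact_iff_function_exact _).1 h.exact)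
      ((ModuleCat.epi_iff_surjective _).1 h.epi_g) A
  have hs := rhom_precomp_surjective (A := A) ((ModuleCat.mono_iff_injective _).1 h.mono_f)
      ((ShortComplex.ShortExact.moduleCat_exact_iff_function_exact _).1 h.exact)
      ((ModuleCat.epi_iff_surjective _).1 h.epi_g) A
  let u : (M →ₗ[A] RHom B'' A) →ₗ[ℂ] (M →ₗ[A] RHom B A) :=
    { toFun := fun f => (RHom.precomp q A).comp f
      map_add' := fun _ _ => LinearMap.comp_add _ _ _
      map_smul' := fun _ _ => rfl }
  let v : (M →ₗ[A] RHom B A) →ₗ[ℂ] (M →ₗ[A] RHom B' A) :=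
    { toFun := fun f => (RHom.precomp k A).comp f
      map_add' := fun _ _ => LinearMap.comp_add _ _ _
      map_smul' := fun _ _ => rfl }
  have hu : Function.Injective u := fun f g hfg => LinearMap.ext fun m =>
    hi (LinearMap.congr_fun hfg m)
  have hv : Function.Surjective v := fun f => by
    obtain ⟨g, hg⟩ := Module.projective_lifting_property (RHom.precomp k A) f hs
    exact ⟨g, hg⟩
  have huv : Function.Exact u v := by
    intro f
    constructor
    · intro hf
      have hf' (m : M) : f m ∈ LinearMap.range (RHom.precomp q A) := by
        obtain ⟨x, hx⟩ := (he (f m)).1 (LinearMap.congr_fun hf m)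
        exact ⟨x, hx⟩
      let e := LinearEquiv.ofInjective _ hi
      refine ⟨e.symm.toLinearMap ∘ₗ f.codRestrict _ hf', LinearMap.ext fun m => ?_⟩
      exact congrArg Subtype.val (e.apply_symm_apply ⟨f m, hf' m⟩)
    · rintro ⟨g, rfl⟩
      exact LinearMap.ext fun m => he.apply_apply_eq_zero (g m)
  exact
    { exact := (ShortComplex.ShortExact.moduleCat_exact_iff_function_exact _).2
        (LinearMap.dualMap_exact huv)
      mono_f := (ModuleCat.mono_iff_injective _).2 (LinearMap.dualMap_injective_of_surjective hv)
      epi_g := (ModuleCat.epi_iff_surjective _).2 (LinearMap.dualMap_surjective_of_injective hu) }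

end ShortExact

/-! ### The comparison of `Hom_A(P ⊗_A M, A)^*` with `Hom_A(P^∨, M^**)` -/

section Comparison

open scoped ModuleCat

variable {A : Type u} [Ring A] [Algebra ℂ A]

theorem bimoduleDual_smul_apply {B : ModuleCat.{u} (Env A)} (a b : A) (ν : bimoduleDual B) (x : B) :
    (DFunLike.coe (F := B →ₗ[Env A] Env A) (Env.tmul a b • ν) x) =
      DFunLike.coe (F := B →ₗ[Env A] Env A) ν x * Env.tmul b a :=
  dualModule_tmul_smul B a b ν x

/-- An element of the dual of a bimodule as a homomorphism. -/
abbrev bimoduleDualHom {B : ModuleCat.{u} (Env A)} (ν : bimoduleDual B) : B →ₗ[Env A] Env A := ν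

/-- A homomorphism to the enveloping algebra as an element of the dual of a bimodule. -/
abbrev toBimoduleDual {B : ModuleCat.{u} (Env A)} (ν : B →ₗ[Env A] Env A) : bimoduleDual B := ν

variable {M N : ModuleCat.{u} A} {B B' : ModuleCat.{u} (Env A)}

/-- A linear form as a map with values in `ℂ ⊆ A`. -/
noncomputable def dualToHom : Module.Dual ℂ M →ₗ[ℂ] (M →ₗ[ℂ] A) :=
  LinearMap.llcomp ℂ M ℂ A (Algebra.linearMap ℂ A)

theorem dualToHom_apply (ξ : Module.Dual ℂ M) (m : M) :
    dualToHom ξ m = algebraMap ℂ A (ξ m) := rfl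

theorem contractHom_tmul_smul (a b : A) (ν : bimoduleDual B) (h : M →ₗ[ℂ] A) :
    contractHom (bimoduleDualHom (Env.tmul a b • ν)) h =
      contractHom (bimoduleDualHom ν) (LinearMap.mulLeft ℂ b ∘ₗ h ∘ₗ Algebra.lsmul ℂ ℂ M a) :=
  LinearMap.ext fun m => RHom.ext fun x =>
    (congrArg (contract h m) (bimoduleDual_smul_apply a b ν x)).trans (contract_mul_tmul h m b a _)

theorem contractHom_left_smul (a : A) (ν : bimoduleDual B) (ξ : Module.Dual ℂ M) :
    contractHom (bimoduleDualHom (a • ν)) (dualToHom ξ) =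
      contractHom (bimoduleDualHom ν) (dualToHom (ξ ∘ₗ Algebra.lsmul ℂ ℂ M a)) :=
  (contractHom_tmul_smul a 1 ν _).trans
    (congrArg (contractHom (bimoduleDualHom ν)) (LinearMap.ext fun _ => one_mul _))

/-- For maps `M → A` with scalar values, multiplying inside the contraction and multiplying its
result agree, since scalars are central. This makes the comparison map `A`-linear. -/
theorem contractHom_right_smul (a : A) (ν : bimoduleDual B) (ξ : Module.Dual ℂ M) :
    contractHom (bimoduleDualHom (op a • ν)) (dualToHom ξ) =
      op a • contractHom (bimoduleDualHom ν) (dualToHom ξ) := by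
  refine (contractHom_tmul_smul 1 a ν _).trans (LinearMap.ext fun m => RHom.ext fun x => ?_)
  change contract _ m (bimoduleDualHom ν x) = contract _ m (bimoduleDualHom ν x) * a
  generalize bimoduleDualHom ν x = y
  induction y using Env.induction_on with
  | zero => simp
  | tmul u v =>
    rw [contract_tmul, contract_tmul, mul_assoc]
    refine congrArg (u * ·) ?_
    change a * algebraMap ℂ A (ξ ((1 : A) • v • m)) = algebraMap ℂ A (ξ (v • m)) * a
    rw [one_smul, Algebra.commutes]
  | add y y' hy hy' => simp only [map_add, hy, hy', add_mul]

/-- The natural map `Hom_A(M, Hom_A(B, A))^* → Hom_A(B^∨, M^**)`. -/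
noncomputable def nakToRhom (B : ModuleCat.{u} (Env A)) :
    nakTensor B ⟶ rhomDual (bimoduleDual B) where
  app M := ModuleCat.ofHom (Y := RHom (bimoduleDual B) (DoubleDual M))
    { toFun := fun x =>
        ({ toFun := fun ν =>
            ({ toFun := fun ξ => x (contractHom (bimoduleDualHom ν) (dualToHom ξ))
               map_add' := fun ξ ξ' => by rw [map_add, contractHom_add_right, map_add]
               map_smul' := fun c ξ => by
                rw [map_smul, contractHom_smul_right, map_smul]; rfl } :
                Module.Dual ℂ (Module.Dual ℂ M))
           map_add' := fun ν ν' => DoubleDual.ext fun ξ =>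
            (congrArg x (contractHom_add _ _ _)).trans (map_add x _ _)
           map_smul' := fun a ν => DoubleDual.ext fun ξ =>
            congrArg x (contractHom_left_smul a ν ξ) } : bimoduleDual B →ₗ[A] DoubleDual M)
      map_add' := fun _ _ => rfl
      map_smul' := fun a x => RHom.ext fun ν => DoubleDual.ext fun ξ =>
        congrArg x (contractHom_right_smul a ν ξ).symm }
  naturality M N f := by
    ext (x : NakDual A (RHom B A) M)
    exact RHom.ext fun ν => DoubleDual.ext fun ξ => congrArg x (contractHom_comp f _ _)

/-- Naturality in the bimodule is what turns the selfduality relation into the commutative squares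
of the ladder. -/
theorem nakToRhom_naturality (g : B ⟶ B') :
    nakTensorMap g ≫ nakToRhom B' = nakToRhom B ≫ rhomDualMap (bimoduleDualMap g) := rfl

theorem tmul_one_mul_algebraMap (b : A) (c : ℂ) :
    Env.tmul 1 (b * algebraMap ℂ A c) = Env.tmul (algebraMap ℂ A c) 1 * Env.tmul 1 b := by
  rw [algebraMap_tmul_one, Env.tmul_mul_tmul, mul_one]

/-- Left multiplications on `β` pass through `F` to the linear form, which is expanded in the dual
basis of `M`; only right multiplications of `β` survive. `envFlip` appears because the action on
`B^∨` is right multiplication in `Env A`. -/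
theorem apply_smul_eq_sum {ι : Type*} [Fintype ι] (e : Module.Basis ι ℂ M)
    (F : RHom (bimoduleDual B) (DoubleDual M)) (β : bimoduleDual B) (ξ : Module.Dual ℂ M)
    (y : Env A) :
    F (y • β) ξ =
      ∑ l, F (Env.tmul 1 (contract (dualToHom ξ) (e l) (envFlip A y).unop) • β) (e.coord l) := by
  induction y using Env.induction_on with
  | zero =>
    have h0 : Env.tmul (1 : A) 0 = 0 := TensorProduct.tmul_zero _ _
    simp only [map_zero, MulOpposite.unop_zero, h0, zero_smul]
    exact (Finset.sum_eq_zero fun _ _ => rfl).symm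
  | tmul a b =>
    have h1 : ξ ∘ₗ Algebra.lsmul ℂ ℂ M a = ∑ l, ξ (a • e l) • e.coord l :=
      e.ext fun i => by
        rw [LinearMap.sum_apply, Finset.sum_eq_single i]
        · simp
        · intro l _ hl
          simp [hl.symm]
        · simp
    have h2 (l : ι) : F (Env.tmul 1 (contract (dualToHom ξ) (e l)
        (envFlip A (Env.tmul a b)).unop) • β) (e.coord l) =
        ξ (a • e l) * F (op b • β) (e.coord l) := by
      rw [envFlip_tmul, unop_op, contract_tmul, dualToHom_apply, tmul_one_mul_algebraMap, mul_smul]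
      have h3 : F (algebraMap ℂ A (ξ (a • e l)) • op b • β) =
        algebraMap ℂ A (ξ (a • e l)) • F (op b • β) := map_smul F _ _
      refine (DFunLike.congr_fun h3 (e.coord l)).trans ?_
      rw [DoubleDual.smul_apply]
      have h4 : e.coord l ∘ₗ Algebra.lsmul ℂ ℂ M (algebraMap ℂ A (ξ (a • e l))) =
          ξ (a • e l) • e.coord l := LinearMap.ext fun m => by
        change e.coord l (algebraMap ℂ A (ξ (a • e l)) • m) = _
        rw [algebraMap_smul, map_smul]
        rfl
      rw [h4, map_smul, smul_eq_mul]
    simp only [h2]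
    rw [_root_.tmul_smul, map_smul F, DoubleDual.smul_apply, h1, map_sum]
    exact Finset.sum_congr rfl fun l _ => map_smul (F (op b • β)) _ _
  | add y y' hy hy' =>
    have h0 (a a' : A) : Env.tmul (1 : A) (a + a') = Env.tmul 1 a + Env.tmul 1 a' :=
      TensorProduct.tmul_add _ _ _
    simp only [add_smul, map_add, MulOpposite.unop_add, h0, DoubleDual.add_apply,
      Finset.sum_add_distrib, hy, hy']

theorem bimoduleDual_eq_sum {m : ℕ} {p : Fin m → B} {β : Fin m → B →ₗ[Env A] Env A}
    (hp : ∀ x, x = ∑ k, β k x • p k) (ν : bimoduleDual B) :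
    ν = ∑ k, (envFlip A).symm (op (bimoduleDualHom ν (p k))) •
      toBimoduleDual (β k) := by
  refine LinearMap.ext (f := bimoduleDualHom ν) fun x => ?_
  conv_lhs => rw [hp x, map_sum]
  refine Eq.trans ?_ (map_sum ({ toFun := fun ν : bimoduleDual B => bimoduleDualHom ν x,
                                 map_zero' := rfl, map_add' := fun _ _ => rfl } :
    bimoduleDual B →+ Env A) _ _).symm
  refine Finset.sum_congr rfl fun k _ => ?_
  rw [map_smul]
  change _ = β k x * (envFlip A ((envFlip A).symm (op (bimoduleDualHom ν (p k))))).unop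
  rw [AlgEquiv.apply_symm_apply]
  rfl

/-- For finite dimensional `M`, maps `M → A` are combinations of coordinate forms with coefficients
in `A`, and the inner structure absorbs these coefficients into the `β k`. So contractions with
scalar forms span, which gives injectivity of the comparison map. -/
theorem eq_sum_contractHom_of_basis {ι : Type*} [Fintype ι] (e : Module.Basis ι ℂ M)
    {m : ℕ} {p : Fin m → B} {β : Fin m → B →ₗ[Env A] Env A}
    (hp : ∀ x, x = ∑ k, β k x • p k) (w : M →ₗ[A] RHom B A) :
    w = ∑ k, ∑ l, contractHom (bimoduleDualHom (Env.tmul 1 (w (e l) (p k)) •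
      toBimoduleDual (β k))) (dualToHom (e.coord l)) := by
  conv_lhs => rw [eq_sum_contractHom hp w]
  refine Finset.sum_congr rfl fun k _ => ?_
  have h1 : evalHom w (p k) = ∑ l, LinearMap.mulLeft ℂ (w (e l) (p k)) ∘ₗ
      dualToHom (e.coord l) := e.ext fun i => by
    rw [LinearMap.sum_apply, Finset.sum_eq_single i]
    · change _ = w (e i) (p k) * algebraMap ℂ A (e.coord i (e i))
      simp
    · intro l _ hl
      change w (e l) (p k) * algebraMap ℂ A (e.coord l (e i)) = 0
      simp [hl.symm]
    · simp
  rw [h1]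
  refine (map_sum ({ toFun := contractHom (β k)
                     map_add' := contractHom_add_right (β k)
                     map_smul' := fun c h => contractHom_smul_right c (β k) h } :
    (M →ₗ[ℂ] A) →ₗ[ℂ] (M →ₗ[A] RHom B A)) _ _).trans (Finset.sum_congr rfl fun l _ => ?_)
  refine Eq.symm ((contractHom_tmul_smul 1 (w (e l) (p k)) (toBimoduleDual (β k)) _).trans ?_)
  refine congrArg (contractHom (β k)) (LinearMap.ext fun x => ?_)
  change _ * dualToHom (e.coord l) ((1 : A) • x) = _ * dualToHom (e.coord l) x
  rw [one_smul]

/-- For `B = A ⊗ A` the source is `Hom_ℂ(M, A)^* = (M^* ⊗ A)^*`, which is `Hom_ℂ(A, M^**)`, the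
target. Finite dimension of `M` is needed for the first equality, and dual bases handle the summands
of powers of `A ⊗ A`. -/
theorem nakToRhom_app_isIso (B : ModuleCat.{u} (Env A)) [Module.Finite (Env A) B]
    [Module.Projective (Env A) B] (M : ModuleCat.{u} A) (hM : finDimModules A M) :
    IsIso ((nakToRhom B).app M) := by
  have : FiniteDimensional ℂ M := hM
  obtain ⟨m, p, β, hp⟩ := Module.Projective.exists_dualBasis (R := Env A) (P := B)
  let e := Module.finBasis ℂ M
  rw [ConcreteCategory.isIso_iff_bijective]
  constructor
  · refine (injective_iff_map_eq_zero ((nakToRhom B).app M).hom).2 fun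
      (x : NakDual A (RHom B A) M) hx => ?_
    refine NakDual.ext (x := x) (y := 0) fun w => ?_
    rw [eq_sum_contractHom_of_basis e hp w]
    refine (map_sum (x : Module.Dual ℂ (M →ₗ[A] RHom B A)) _ _).trans
      (Finset.sum_eq_zero fun k _ => ?_)
    refine (map_sum (x : Module.Dual ℂ (M →ₗ[A] RHom B A)) _ _).trans
      (Finset.sum_eq_zero fun l _ => ?_)
    exact DFunLike.congr_fun (F := DoubleDual M)
      (DFunLike.congr_fun (F := RHom (bimoduleDual B) (DoubleDual M)) hx _) _
  · intro (F : RHom (bimoduleDual B) (DoubleDual M))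
    let b (k : Fin m) : bimoduleDual B := β k
    let t (k : Fin m) (a : A) : bimoduleDual B := Env.tmul 1 a • b k
    have ht (k : Fin m) (a a' : A) : t k (a + a') = t k a + t k a' := by
      change Env.tmul 1 (a + a') • b k = Env.tmul 1 a • b k + Env.tmul 1 a' • b k
      rw [← add_smul]
      exact congrArg (· • b k) (TensorProduct.tmul_add _ _ _)
    have ht' (k : Fin m) (c : ℂ) (a : A) (ξ : Module.Dual ℂ M) :
        F (t k (c • a)) ξ = c • F (t k a) ξ := by
      have h1 : t k (c • a) = algebraMap ℂ A c • t k a := by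
        change Env.tmul 1 (c • a) • b k = Env.tmul (algebraMap ℂ A c) 1 • Env.tmul 1 a • b k
        rw [smul_smul, ← tmul_one_mul_algebraMap, Algebra.smul_def, Algebra.commutes]
      have h3 : F (t k (c • a)) = algebraMap ℂ A c • F (t k a) :=
        (congrArg F h1).trans (map_smul F _ _)
      refine (DFunLike.congr_fun h3 ξ).trans ?_
      rw [DoubleDual.smul_apply]
      have h4 : ξ ∘ₗ Algebra.lsmul ℂ ℂ M (algebraMap ℂ A c) = c • ξ := LinearMap.ext fun m => by
        change ξ (algebraMap ℂ A c • m) = _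
        rw [algebraMap_smul, map_smul]
        rfl
      rw [h4, map_smul]
    -- The formula is forced: expand `w` into contractions with scalar forms and prescribe on each
    -- of them the value dictated by `F`.
    let x : Module.Dual ℂ (M →ₗ[A] RHom B A) :=
      { toFun := fun w => ∑ k, ∑ l, F (t k (w (e l) (p k))) (e.coord l)
        map_add' := fun w w' => by
          rw [← Finset.sum_add_distrib]
          refine Finset.sum_congr rfl fun k _ => ?_
          rw [← Finset.sum_add_distrib]
          refine Finset.sum_congr rfl fun l _ => ?_
          rw [← DoubleDual.add_apply, ← map_add F, ← ht]
          rfl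
        map_smul' := fun c w => by
          rw [RingHom.id_apply, Finset.smul_sum]
          refine Finset.sum_congr rfl fun k _ => ?_
          rw [Finset.smul_sum]
          refine Finset.sum_congr rfl fun l _ => ?_
          rw [← ht']
          rfl }
    refine ⟨x, RHom.ext fun ν => DoubleDual.ext fun ξ => ?_⟩
    change ∑ k, ∑ l, F (t k (contractHom (bimoduleDualHom ν) (dualToHom ξ) (e l) (p k)))
      (e.coord l) = F ν ξ
    refine Eq.trans ?_ (congrArg (fun ν' => F ν' ξ) (bimoduleDual_eq_sum hp ν)).symm
    refine Eq.trans ?_ (DFunLike.congr_fun (map_sum F _ _) ξ).symm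
    refine Eq.trans (Finset.sum_congr rfl fun k _ => ?_)
      (map_sum ({ toFun := fun z : DoubleDual M => z ξ,
                  map_zero' := rfl, map_add' := fun _ _ => rfl } :
                 DoubleDual M →+ ℂ) _ _).symm
    refine Eq.trans ?_ (apply_smul_eq_sum e F (b k) ξ _).symm
    rw [AlgEquiv.apply_symm_apply]
    rfl

end Comparison

/-! ### Syzygies -/

section Syzygies

variable {C D : Type*} [Category* C] [Abelian C] [Category* D] [Abelian D]

namespace CategoryTheory.ProjectiveResolution

variable {Z : C} (P : ProjectiveResolution Z)

theorem fromOpcycles_pOpcycles (i : ℕ) :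
    P.complex.fromOpcycles (i + 1) i ≫ P.complex.pOpcycles i = 0 := by
  rw [← cancel_epi (P.complex.pOpcycles (i + 1)), HomologicalComplex.p_fromOpcycles_assoc,
    HomologicalComplex.d_pOpcycles, comp_zero]

/-- The cokernel of `d : X_{i+1} → X_i` serves as `i`-th syzygy, so that `Ω_0` is the resolved
object. Exactness in degree `i + 1` embeds `Ω_{i+1}` in `X_i`. -/
theorem syzygy_shortExact (i : ℕ) :
    (ShortComplex.mk _ _ (P.fromOpcycles_pOpcycles i)).ShortExact where
  exact := by
    let φ : ShortComplex.mk _ _ (P.complex.d_pOpcycles (i + 1) i) ⟶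
        ShortComplex.mk _ _ (P.fromOpcycles_pOpcycles i) :=
      { τ₁ := P.complex.pOpcycles (i + 1)
        τ₂ := 𝟙 _
        τ₃ := 𝟙 _ }
    have h₁ : Epi φ.τ₁ := inferInstanceAs (Epi (P.complex.pOpcycles (i + 1)))
    have h₂ : IsIso φ.τ₂ := inferInstanceAs (IsIso (𝟙 _))
    have h₃ : Mono φ.τ₃ := inferInstanceAs (Mono (𝟙 _))
    exact (ShortComplex.exact_iff_of_epi_of_isIso_of_mono φ).1
      (ShortComplex.exact_of_g_is_cokernel _ (P.complex.opcyclesIsCokernel (i + 1) i (by simp)))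
  mono_f := Preadditive.mono_of_isZero_kernel' _
    (P.complex.homologyIsKernel (i + 1) i (by simp)) (P.complex_exactAt_succ i).isZero_homology
  epi_g := inferInstanceAs (Epi (P.complex.pOpcycles i))

/-- The zeroth syzygy is the resolved object. -/
noncomputable def opcyclesZeroIso : P.complex.opcycles 0 ≅ Z :=
  IsColimit.coconePointUniqueUpToIso (P.complex.opcyclesIsCokernel 1 0 (by simp))
    P.isColimitCokernelCofork

/-- Once the image of `Ω_i` is projective, the sequence splits and the image of `Ω_{i+1}` is a
summand of a projective. The use is for restriction to one side, where the diagonal bimodule becomes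
free and so starts the induction. -/
theorem projective_map_opcycles (F : C ⥤ D) [F.Additive] [PreservesFiniteLimits F]
    [PreservesFiniteColimits F] (hZ : Projective (F.obj Z))
    (hP : ∀ i, Projective (F.obj (P.complex.X i))) (i : ℕ) :
    Projective (F.obj (P.complex.opcycles i)) := by
  induction i with
  | zero => exact Projective.of_iso (F.mapIso P.opcyclesZeroIso.symm) hZ
  | succ i ih =>
    have hS := (P.syzygy_shortExact i).map_of_exact F
    have : Projective ((ShortComplex.mk _ _ (P.fromOpcycles_pOpcycles i)).map F).X₃ := ih
    have : Projective ((ShortComplex.mk _ _ (P.fromOpcycles_pOpcycles i)).map F).X₂ := hP i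
    have s := hS.splittingOfProjective
    exact Retract.projective (Y := F.obj (P.complex.X i))
      { i := F.map (P.complex.fromOpcycles (i + 1) i), r := s.r, retract := s.f_r }

theorem isZero_opcycles {i : ℕ} (h : IsZero (P.complex.X i)) : IsZero (P.complex.opcycles i) :=
  IsZero.of_epi (P.complex.pOpcycles i) h

end CategoryTheory.ProjectiveResolution

end Syzygies

/-! ### Projectivity of bimodules on either side -/

section Projectivity

theorem Module.Projective.of_isScalarTower (R E P : Type*) [Ring R] [Ring E] [AddCommGroup P]
    [Module R E] [Module E P] [Module R P] [IsScalarTower R E P] [IsScalarTower R E E]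
    [Module.Projective R E] [Module.Projective E P] : Module.Projective R P := by
  obtain ⟨s, hs⟩ := Module.Projective.out (R := E) (P := P)
  have : Module.Projective R (P →₀ E) := by
    classical exact Module.Projective.of_equiv (finsuppLequivDFinsupp R).symm
  refine Module.Projective.of_split (s.restrictScalars R)
    ((Finsupp.linearCombination E id).restrictScalars R) (LinearMap.ext hs)

theorem ModuleCat.projective_restrictScalars {R E : Type u} [Ring R] [Ring E] (f : R →+* E)
    (F : ModuleCat.{u} E) (e : F ≃ₗ[E] E)
    (h : Projective ((ModuleCat.restrictScalars f).obj F)) (P : ModuleCat.{u} E) [Projective P] :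
    Projective ((ModuleCat.restrictScalars f).obj P) := by
  let _ : Module R E := Module.compHom E f
  let _ : Module R P := Module.compHom P f
  let _ : Module R F := Module.compHom F f
  have : Module.Projective R F := (IsProjective.iff_projective (R := R) F).2 h
  let e' : F ≃ₗ[R] E := { e with map_smul' := fun r x => e.map_smul (f r) x }
  have : Module.Projective R E := Module.Projective.of_equiv e'
  have : IsScalarTower R E E := ⟨fun r x y => mul_assoc (f r) x y⟩
  have : IsScalarTower R E P := ⟨fun r x y => mul_smul (f r) x y⟩
  have : Module.Projective E P := (IsProjective.iff_projective _).2 ‹_›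
  have : Module.Projective R P := Module.Projective.of_isScalarTower R E P
  exact (IsProjective.iff_projective (R := R) P).1 this

theorem ModuleCat.restrictScalars_exact {R E : Type u} [Ring R] [Ring E] (f : R →+* E) :
    PreservesFiniteLimits (ModuleCat.restrictScalars.{u} f) ∧
      PreservesFiniteColimits (ModuleCat.restrictScalars.{u} f) :=
  ((Functor.exact_tfae (ModuleCat.restrictScalars.{u} f)).out 1 3).1
    fun (S : ShortComplex (ModuleCat.{u} E)) hS =>
      (ShortComplex.ShortExact.moduleCat_exact_iff_function_exact
        (S.map (ModuleCat.restrictScalars.{u} f))).2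
        ((ShortComplex.ShortExact.moduleCat_exact_iff_function_exact S).1 hS)

variable (A : Type u) [Ring A] [Algebra ℂ A]

/-- The free bimodule of rank one. -/
noncomputable def freeBimodule : ModuleCat.{u} (Env A) := ModuleCat.of (Env A) (Env A)

/-- The free bimodule of rank one is the enveloping algebra. -/
noncomputable def freeBimoduleEquiv : freeBimodule A ≃ₗ[Env A] Env A := LinearEquiv.refl _ _

theorem projective_env_left :
    Projective ((ModuleCat.restrictScalars Env.left).obj (freeBimodule A)) := by
  refine (IsProjective.iff_projective (R := A) (freeBimodule A)).1 ?_
  let e : (A ⊗[ℂ] Aᵐᵒᵖ) ≃ₗ[A] freeBimodule A :=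
    { AddEquiv.refl (A ⊗[ℂ] Aᵐᵒᵖ) with
      map_smul' := fun a x => by
        change a • x = (a ⊗ₜ[ℂ] (1 : Aᵐᵒᵖ)) * x
        induction x using TensorProduct.induction_on with
        | zero => simp
        | tmul u v => simp [TensorProduct.smul_tmul']
        | add x y hx hy => rw [smul_add, mul_add, hx, hy] }
  exact Module.Projective.of_equiv e

theorem projective_env_right :
    Projective ((ModuleCat.restrictScalars Env.right).obj (freeBimodule A)) := by
  refine (IsProjective.iff_projective (R := Aᵐᵒᵖ) (freeBimodule A)).1 ?_
  let e : (Aᵐᵒᵖ ⊗[ℂ] A) ≃ₗ[Aᵐᵒᵖ] freeBimodule A :=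
    { (TensorProduct.comm ℂ Aᵐᵒᵖ A).toAddEquiv with
      map_smul' := fun a x => by
        change TensorProduct.comm ℂ Aᵐᵒᵖ A (a • x) =
          ((1 : A) ⊗ₜ[ℂ] a) * TensorProduct.comm ℂ Aᵐᵒᵖ A x
        induction x using TensorProduct.induction_on with
        | zero => simp
        | tmul u v => simp [TensorProduct.smul_tmul']
        | add x y hx hy => rw [smul_add, map_add, map_add, mul_add, hx, hy] }
  exact Module.Projective.of_equiv e

variable {A}

theorem diagonalBimodule_left_projective :
    Projective ((ModuleCat.restrictScalars (Env.left (A := A))).obj (diagonalBimodule A)) := by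
  refine (IsProjective.iff_projective (R := A) (diagonalBimodule A)).1 ?_
  let e : A ≃ₗ[A] diagonalBimodule A :=
    { AddEquiv.refl A with
      map_smul' := fun a x => by
        refine Eq.symm ((diagonalModule_tmul_smul A a 1 x).trans ?_)
        exact mul_one _ }
  exact Module.Projective.of_equiv e

theorem diagonalBimodule_right_projective :
    Projective ((ModuleCat.restrictScalars (Env.right (A := A))).obj (diagonalBimodule A)) := by
  refine (IsProjective.iff_projective (R := Aᵐᵒᵖ) (diagonalBimodule A)).1 ?_
  let e : Aᵐᵒᵖ ≃ₗ[Aᵐᵒᵖ] diagonalBimodule A :=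
    { (opAddEquiv (α := A)).symm with
      map_smul' := fun a x => by
        refine Eq.symm ((diagonalModule_tmul_smul A 1 a.unop x.unop).trans ?_)
        rw [one_mul]
        rfl }
  exact Module.Projective.of_equiv e

/-- A basis of `T` generates this quotient of `Env A ⊗ T`. Together with projectivity, this provides
the finite dual bases over `Env A`. -/
theorem standardBimodule_finite (S : Subalgebra ℂ A) (T : Type u) [AddCommGroup T] [Module ℂ T]
    [Module S T] [Module Sᵐᵒᵖ T] [FiniteDimensional ℂ T] :
    Module.Finite (Env A) (standardBimodule S T) :=
  inferInstanceAs (Module.Finite (Env A) ((Env A ⊗[ℂ] T) ⧸ balancedRelations S T))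

theorem IsStandardBimodule.finite {S : Subalgebra ℂ A} {M : ModuleCat.{u} (Env A)}
    (h : IsStandardBimodule S M) : Module.Finite (Env A) M := by
  obtain ⟨T, _, _, _, _, _, _, _, _, ⟨e⟩⟩ := h
  have := standardBimodule_finite S T
  exact Module.Finite.equiv e.toLinearEquiv.symm

variable (P : ProjectiveResolution (diagonalBimodule A))

theorem resolution_left_projective (i : ℕ) : Module.Projective A (P.complex.X i) :=
  (IsProjective.iff_projective _).2 (ModuleCat.projective_restrictScalars Env.left
    _ (freeBimoduleEquiv A) (projective_env_left A) (P.complex.X i))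

theorem restrictScalars_right_projective (B : ModuleCat.{u} (Env A)) [Projective B] :
    Projective ((ModuleCat.restrictScalars (Env.right (A := A))).obj B) := by
  have h₁ := @ModuleCat.projective_restrictScalars Aᵐᵒᵖ (Env A) _ _ Env.right (freeBimodule A)
    (freeBimoduleEquiv A)
  have h₂ := h₁ (projective_env_right A)
  exact h₂ B

theorem syzygy_left_projective (i : ℕ) : Module.Projective A (P.complex.opcycles i) := by
  obtain ⟨h, h'⟩ := ModuleCat.restrictScalars_exact (Env.left (A := A))
  have := P.projective_map_opcycles (ModuleCat.restrictScalars (Env.left (A := A)))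
    diagonalBimodule_left_projective (fun j => ModuleCat.projective_restrictScalars Env.left
      _ (freeBimoduleEquiv A) (projective_env_left A) (P.complex.X j)) i
  exact (IsProjective.iff_projective (R := A) (P.complex.opcycles i)).2 this

theorem syzygy_right_projective (i : ℕ) : Module.Projective Aᵐᵒᵖ (P.complex.opcycles i) := by
  obtain ⟨h, h'⟩ := ModuleCat.restrictScalars_exact (Env.right (A := A))
  have := P.projective_map_opcycles (ModuleCat.restrictScalars (Env.right (A := A)))
    diagonalBimodule_right_projective
      (fun j => restrictScalars_right_projective (P.complex.X j)) i
  exact (IsProjective.iff_projective (R := Aᵐᵒᵖ) (P.complex.opcycles i)).2 this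

end Projectivity

/-! ### Natural transformations and quasi-isomorphisms -/

/-- Exact functors commute with homology, so on `H^i` the map is `τ` at `H^i(K)`. Invertibility is
thus needed on cohomology only, not on the terms. -/
theorem quasiIso_mapHomologicalComplex_app {C D : Type*} [Category* C] [Abelian C] [Category* D]
    [Abelian D] {F G : C ⥤ D} [F.Additive] [G.Additive] [F.PreservesHomology]
    [G.PreservesHomology] (τ : F ⟶ G) (K : CochainComplex C ℤ)
    (h : ∀ i, IsIso (τ.app (K.homology i))) :
    QuasiIso ((NatTrans.mapHomologicalComplex τ (ComplexShape.up ℤ)).app K) where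
  quasiIsoAt i := by
    rw [quasiIsoAt_iff_isIso_homologyMap]
    have h1 := NatTrans.app_homology τ (K.sc i)
    have h2 : IsIso (τ.app (K.sc i).homology) := h i
    rw [h1, isIso_comp_left_iff, isIso_comp_right_iff] at h2
    exact h2

/-! ### The Nakayama functor and the shift -/

section NakayamaShift

open scoped ModuleCat

variable {A : Type u} [Ring A] [Algebra ℂ A]

/-- The functors `Hom_A(-, I)^*` for isomorphic bimodules are isomorphic. -/
noncomputable def nakFunctorIso (I I' : Type u) [AddCommGroup I] [Module A I] [Module Aᵐᵒᵖ I]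
    [Module ℂ I] [SMulCommClass A Aᵐᵒᵖ I] [SMulCommClass A ℂ I] [SMulCommClass Aᵐᵒᵖ ℂ I]
    [AddCommGroup I'] [Module A I'] [Module Aᵐᵒᵖ I'] [Module ℂ I'] [SMulCommClass A Aᵐᵒᵖ I']
    [SMulCommClass A ℂ I'] [SMulCommClass Aᵐᵒᵖ ℂ I'] (e : I ≃ₗ[A] I')
    (he : ∀ (a : A) x, e (op a • x) = op a • e x) (he' : ∀ (c : ℂ) x, e (c • x) = c • e x) :
    nakFunctor (A := A) I ≅ nakFunctor I' :=
  NatIso.ofComponents (fun M =>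
    let u : (M →ₗ[A] I) ≃ₗ[ℂ] (M →ₗ[A] I') :=
      { toFun := fun f => e.toLinearMap ∘ₗ f
        invFun := fun f => e.symm.toLinearMap ∘ₗ f
        map_add' := fun f g => LinearMap.ext fun m => map_add e (f m) (g m)
        map_smul' := fun c f => LinearMap.ext fun m => he' c (f m)
        left_inv := fun f => LinearMap.ext fun m => e.symm_apply_apply (f m)
        right_inv := fun f => LinearMap.ext fun m => e.apply_symm_apply (f m) }
    LinearEquiv.toModuleIso (X₁ := NakDual A I M) (X₂ := NakDual A I' M)
      { u.symm.dualMap.toAddEquiv with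
        map_smul' := fun a x => by
          refine NakDual.ext fun f => ?_
          refine congrArg x (LinearMap.ext fun m => ?_)
          refine ((LinearEquiv.symm_apply_eq e).2 ?_).symm
          exact (congrArg (op a • ·) (e.apply_symm_apply (f m)).symm).trans
            (he a (e.symm (f m))).symm }) fun f => rfl

/-- Homomorphisms out of the diagonal bimodule. -/
noncomputable def rhomDiagonalEquiv (Y : Type u) [AddCommGroup Y] [Module A Y] :
    RHom (diagonalBimodule A) Y ≃ₗ[A] Y where
  toFun f := f (show diagonalBimodule A from (1 : A))
  invFun y := LinearMap.toSpanSingleton A Y y ∘ₗ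
    ({ toFun := fun a => a
       map_add' := fun _ _ => rfl
       map_smul' := fun a x => (diagonalModule_tmul_smul A a 1 x).trans (mul_one _) } :
      diagonalBimodule A →ₗ[A] A)
  map_add' _ _ := rfl
  map_smul' a f := by
    have h1 : op a • (show diagonalBimodule A from (1 : A)) =
        (a • (show diagonalBimodule A from (1 : A))) :=
      (diagonalModule_tmul_smul A 1 a 1).trans
        ((by simp : (1 : A) * 1 * a = a * 1 * 1).trans (diagonalModule_tmul_smul A a 1 1).symm)
    exact (congrArg f h1).trans (map_smul f a _)
  left_inv f := by
    refine RHom.ext fun (a : A) => ?_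
    have h1 : (a • (show diagonalBimodule A from (1 : A))) = a :=
      (diagonalModule_tmul_smul A a 1 1).trans (by simp)
    exact (map_smul f a _).symm.trans (congrArg f h1)
  right_inv y := one_smul A y

/-- `Hom_A(A, -)` is the identity. -/
noncomputable def rhomDiagonalIso : rhomFunctor (diagonalBimodule A) ≅ 𝟭 (ModuleCat.{u} A) :=
  NatIso.ofComponents (fun Y => LinearEquiv.toModuleIso (X₁ := RHom (diagonalBimodule A) Y)
    (rhomDiagonalEquiv Y)) fun _ => rfl

/-- `Hom_A(A ⊗_A -, A)^*` is the Nakayama functor. -/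
noncomputable def nakTensorDiagonalIso : nakTensor (diagonalBimodule A) ≅ nakFunctor (A := A) A :=
  nakFunctorIso _ _ (rhomDiagonalEquiv A) (fun _ _ => rfl) (fun _ _ => rfl)

/-- `nakTensor` on isomorphisms of bimodules. -/
noncomputable def nakTensorMapIso {B B' : ModuleCat.{u} (Env A)} (e : B ≅ B') :
    nakTensor B ≅ nakTensor B' where
  hom := nakTensorMap e.hom
  inv := nakTensorMap e.inv
  hom_inv_id := by rw [← nakTensorMap_comp, e.hom_inv_id]; rfl
  inv_hom_id := by rw [← nakTensorMap_comp, e.inv_hom_id]; rfl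

/-- `rhomFunctor` on isomorphisms of bimodules. -/
noncomputable def rhomMapIso {B B' : ModuleCat.{u} (Env A)} (e : B ≅ B') :
    rhomFunctor B' ≅ rhomFunctor B where
  hom := rhomMap e.hom
  inv := rhomMap e.inv
  hom_inv_id := by rw [← rhomMap_comp, e.inv_hom_id]; rfl
  inv_hom_id := by rw [← rhomMap_comp, e.hom_inv_id]; rfl

variable (A) in
/-- The bounded complexes of finitely generated projective modules. -/
def perfectComplexes : ObjectProperty (CochainComplex (ModuleCat.{u} A) ℤ) := fun K =>
  (∃ a b : ℤ, K.IsStrictlyGE a ∧ K.IsStrictlyLE b) ∧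
    ∀ i, Module.Projective A (K.X i) ∧ Module.Finite A (K.X i)

variable (A) in
/-- The bounded complexes of finitely generated projective modules with finite dimensional
cohomology. -/
def perfectFinDim : ObjectProperty (CochainComplex (ModuleCat.{u} A) ℤ) :=
  perfectComplexes A ⊓ fun K => ∀ i, finDimModules A (K.homology i)

/-- The functor on complexes induced by an additive functor. -/
noncomputable abbrev onPerfect (F : ModuleCat.{u} A ⥤ ModuleCat.{u} A) [F.Additive] :
    (perfectFinDim A).FullSubcategory ⥤ CochainComplex (ModuleCat.{u} A) ℤ :=
  (perfectFinDim A).ι ⋙ F.mapHomologicalComplex (ComplexShape.up ℤ)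

/-- The natural transformation on complexes induced by a natural transformation. -/
noncomputable abbrev onPerfectMap {F G : ModuleCat.{u} A ⥤ ModuleCat.{u} A} [F.Additive]
    [G.Additive] (τ : F ⟶ G) : onPerfect F ⟶ onPerfect G :=
  Functor.whiskerLeft _ (NatTrans.mapHomologicalComplex τ (ComplexShape.up ℤ))

theorem onPerfectMap_comp {F G H : ModuleCat.{u} A ⥤ ModuleCat.{u} A} [F.Additive]
    [G.Additive] [H.Additive] (τ : F ⟶ G) (σ : G ⟶ H) :
    onPerfectMap (τ ≫ σ) = onPerfectMap τ ≫ onPerfectMap σ := rfl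

theorem onPerfectMap_zero (F G : ModuleCat.{u} A ⥤ ModuleCat.{u} A) [F.Additive]
    [G.Additive] : onPerfectMap (0 : F ⟶ G) = 0 := rfl

/-- The isomorphism on complexes induced by an isomorphism of functors. -/
noncomputable def onPerfectIso {F G : ModuleCat.{u} A ⥤ ModuleCat.{u} A} [F.Additive]
    [G.Additive] (e : F ≅ G) : onPerfect F ≅ onPerfect G :=
  Functor.isoWhiskerLeft _ (NatIso.mapHomologicalComplex e _)

theorem onPerfectMap_app_quasiIso {F G : ModuleCat.{u} A ⥤ ModuleCat.{u} A} [F.Additive]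
    [G.Additive] [F.PreservesHomology] [G.PreservesHomology] (τ : F ⟶ G)
    (h : ∀ M, finDimModules A M → IsIso (τ.app M)) (K : (perfectFinDim A).FullSubcategory) :
    QuasiIso ((onPerfectMap τ).app K) :=
  quasiIso_mapHomologicalComplex_app τ K.obj fun i => h _ (K.property.2 i)

theorem doubleDual_comp_Q_iso [HasDerivedCategory.{w} (ModuleCat.{u} A)] :
    Nonempty ((perfectFinDim A).ι ⋙ DerivedCategory.Q ≅
      onPerfect (doubleDualFunctor (A := A)) ⋙ DerivedCategory.Q) := by
  let τ : (perfectFinDim A).ι ⟶ onPerfect (doubleDualFunctor (A := A)) :=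
    { app := fun K => { f := fun i => doubleDualUnit.app (K.obj.X i) } }
  have h (K : (perfectFinDim A).FullSubcategory) :
      IsIso ((Functor.whiskerRight τ DerivedCategory.Q).app K) := by
    have h1 : QuasiIso ((NatTrans.mapHomologicalComplex (doubleDualUnit (A := A))
        (ComplexShape.up ℤ)).app K.obj) :=
      quasiIso_mapHomologicalComplex_app _ K.obj fun i =>
        doubleDualUnit_app_isIso _ (K.property.2 i)
    have h2 : QuasiIso (τ.app K) := by
      have h3 : τ.app K = (Functor.mapHomologicalComplexIdIso _ _).inv.app K.obj ≫
        (NatTrans.mapHomologicalComplex (doubleDualUnit (A := A))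
          (ComplexShape.up ℤ)).app K.obj := rfl
      rw [h3]
      infer_instance
    change IsIso (DerivedCategory.Q.map (τ.app K))
    infer_instance
  have := NatIso.isIso_of_isIso_app (Functor.whiskerRight τ DerivedCategory.Q)
  exact ⟨asIso (Functor.whiskerRight τ DerivedCategory.Q)⟩

end NakayamaShift

/-! ### The Nakayama functor is the shift by `n`. -/

section SelfdualLadder

open scoped ModuleCat

variable {A : Type u} [Ring A] [Algebra ℂ A]

/-- Replacing `α_i` by `(-1)^i α_i` absorbs the sign in the selfduality relation. -/
theorem IsSelfdual.exists_iso {M : ModuleCat.{u} (Env A)} {P : ProjectiveResolution M} {n : ℕ}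
    (h : IsSelfdual P n) :
    ∃ α : ∀ i j : ℕ, i + j = n → (P.complex.X i ≅ bimoduleDual (P.complex.X j)),
      ∀ (i j : ℕ) (h : (i + 1) + j = n),
        P.complex.d (i + 1) i ≫ (α i (j + 1) (by omega)).hom =
          (α (i + 1) j h).hom ≫ bimoduleDualMap (P.complex.d (j + 1) j) := by
  obtain ⟨-, α, hα⟩ := h
  refine ⟨fun i j h => ((-1 : ℤˣ) ^ i) • α i j h, fun i j h => ?_⟩
  have := hα i j h
  change P.complex.d (i + 1) i ≫ ((((-1 : ℤˣ) ^ i) : ℤˣ) • (α i (j + 1) _).hom) =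
    (((-1 : ℤˣ) ^ (i + 1)) • (α (i + 1) j h).hom) ≫ _
  rw [Linear.comp_units_smul, Linear.units_smul_comp, this, Preadditive.comp_neg, pow_succ]
  simp

theorem shortExact_onPerfect {F G H : ModuleCat.{u} A ⥤ ModuleCat.{u} A} [F.Additive]
    [G.Additive] [H.Additive] (τ : F ⟶ G) (σ : G ⟶ H) (w : τ ≫ σ = 0)
    (w' : onPerfectMap τ ≫ onPerfectMap σ = 0)
    (h : ∀ M : ModuleCat.{u} A, Module.Projective A M → (ShortComplex.mk (τ.app M) (σ.app M)
      (by rw [← NatTrans.comp_app, w]; rfl)).ShortExact)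
    (K : (perfectFinDim A).FullSubcategory) :
    ((ShortComplex.mk _ _ w').map
      ((evaluation _ (CochainComplex (ModuleCat.{u} A) ℤ)).obj K)).ShortExact :=
  HomologicalComplex.shortExact_of_degreewise_shortExact _ fun i =>
    h (K.obj.X i) (K.property.1.2 i).1

theorem isZero_of_subsingleton_obj {C D : Type*} [Category* C] [Category* D] [Abelian D]
    {F : C ⥤ CochainComplex D ℤ} (h : ∀ K i, IsZero ((F.obj K).X i)) (K : C) :
    IsZero (F.obj K) := by
  rw [IsZero.iff_id_eq_zero]
  ext i
  exact (h K i).eq_of_src _ _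

theorem isZero_nakTensor_obj {B : ModuleCat.{u} (Env A)} (h : IsZero B) (M : ModuleCat.{u} A) :
    IsZero ((nakTensor B).obj M) := by
  rw [IsZero.iff_id_eq_zero]
  have h1 : nakTensorMap (𝟙 B) = 0 := by rw [h.eq_of_src (𝟙 B) 0, nakTensorMap_zero]
  exact congrArg (fun τ => NatTrans.app τ M) h1

theorem isZero_rhomDual_obj {B : ModuleCat.{u} (Env A)} (h : IsZero B) (M : ModuleCat.{u} A) :
    IsZero ((rhomDual B).obj M) := by
  rw [IsZero.iff_id_eq_zero]
  have h1 : rhomMap (𝟙 B) = 0 := by rw [h.eq_of_src (𝟙 B) 0, rhomMap_zero]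
  exact congrArg (fun τ => NatTrans.app τ (doubleDualFunctor.obj M)) h1

/-- The ladder is applied to the syzygies `Ω i`, functorially in the complex. Its two ends are `Ω 0
= A`, where the functors become `ν` and the double dual, and `Ω (n + 1) = 0`. -/
theorem nakFunctor_iso_shift (n : ℕ) (P : ProjectiveResolution (diagonalBimodule A))
    (hP : ∀ i, Module.Finite (Env A) (P.complex.X i)) (hsd : IsSelfdual P n)
    [HasDerivedCategory.{w} (ModuleCat.{u} A)] :
    Nonempty (onPerfect (nakFunctor (A := A) A) ⋙ DerivedCategory.Q ≅
      ((perfectFinDim A).ι ⋙ DerivedCategory.Q) ⋙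
        shiftFunctor (DerivedCategory (ModuleCat.{u} A)) (n : ℤ)) := by
  obtain ⟨α, hα⟩ := hsd.exists_iso
  let Ω (i : ℕ) : ModuleCat.{u} (Env A) := P.complex.opcycles i
  let X (i : ℕ) : ModuleCat.{u} (Env A) := P.complex.X i
  let k (i : ℕ) : Ω (i + 1) ⟶ X i := P.complex.fromOpcycles (i + 1) i
  let q (i : ℕ) : X i ⟶ Ω i := P.complex.pOpcycles i
  have hkq (i : ℕ) : k i ≫ q i = 0 := P.fromOpcycles_pOpcycles i
  have hqk (i : ℕ) : q (i + 1) ≫ k i = P.complex.d (i + 1) i :=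
    P.complex.p_fromOpcycles (i + 1) i
  have hΩ (i : ℕ) : Module.Projective A (Ω i) := syzygy_left_projective P i
  have hX (i : ℕ) : Module.Projective A (X i) := resolution_left_projective P i
  have hX' (i : ℕ) : Module.Projective (Env A) (X i) :=
    (IsProjective.iff_projective (X i)).2 (P.projective i)
  have hX'' (i : ℕ) : Module.Finite (Env A) (X i) := hP i
  have hn : IsZero (Ω (n + 1)) := P.isZero_opcycles (hsd.1 (n + 1) (by omega))
  have h1 (i : ℕ) : nakTensorMap (k i) ≫ nakTensorMap (q i) = 0 := by
    rw [← nakTensorMap_comp, hkq, nakTensorMap_zero]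
  have h2 (i : ℕ) : rhomDualMap (q i) ≫ rhomDualMap (k i) = 0 := by
    rw [← Functor.whiskerLeft_comp, ← rhomMap_comp, hkq, rhomMap_zero]
    rfl
  have h1' (i : ℕ) : onPerfectMap (nakTensorMap (k i)) ≫ onPerfectMap (nakTensorMap (q i)) = 0 := by
    rw [← onPerfectMap_comp, h1, onPerfectMap_zero]
  have h2' (i : ℕ) : onPerfectMap (rhomDualMap (q i)) ≫ onPerfectMap (rhomDualMap (k i)) = 0 := by
    rw [← onPerfectMap_comp, h2, onPerfectMap_zero]
  have (i : ℕ) : (nakTensor (X i)).PreservesHomology := nakTensor_preservesHomology (X i)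
  have (i : ℕ) : (rhomFunctor (X i)).PreservesHomology := rhomFunctor_preservesHomology (X i)
  have (i : ℕ) : (rhomDual (X i)).PreservesHomology :=
    ((Functor.exact_tfae (rhomDual (X i))).out 1 2).1
      fun (S : ShortComplex (ModuleCat.{u} A)) (hS : S.Exact) =>
        (hS.map doubleDualFunctor).map (rhomFunctor (X i))
  -- Comparison with `Hom_A(X_i^∨, M^**)`, followed by the isomorphism `X_j ≅ X_i^∨` of selfduality.
  let φ (i j : ℕ) (h : i + j = n) : nakTensor (X i) ⟶ rhomDual (X j) :=
    nakToRhom (X i) ≫ rhomDualMap (α j i (by omega)).hom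
  obtain ⟨e⟩ := iso_shift_of_ladder n (fun i => onPerfect (nakTensor (Ω i)))
    (fun i => onPerfect (rhomDual (Ω i))) (fun i => onPerfect (nakTensor (X i)))
    (fun i => onPerfect (rhomDual (X i)))
    (fun i => onPerfectMap (nakTensorMap (k i))) (fun i => onPerfectMap (nakTensorMap (q i))) h1'
    (fun i => onPerfectMap (rhomDualMap (q i))) (fun i => onPerfectMap (rhomDualMap (k i))) h2'
    (fun i K => shortExact_onPerfect _ _ (h1 i) (h1' i)
      (fun M hM => nakTensor_shortExact (hkq i) (P.syzygy_shortExact i) M) K)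
    (fun i K => shortExact_onPerfect _ _ (h2 i) (h2' i)
      (fun M hM => rhomFunctor_shortExact (hkq i) (P.syzygy_shortExact i) _) K)
    (fun i j h => onPerfectMap (φ i j h))
    (fun i j h K => onPerfectMap_app_quasiIso (φ i j h) (fun M hM => by
      have := nakToRhom_app_isIso (X i) M hM
      have : IsIso ((rhomDualMap (α j i (by omega)).hom).app M) :=
        inferInstanceAs (IsIso ((rhomMapIso (α j i (by omega))).hom.app _))
      exact IsIso.comp_isIso' ‹_› ‹_›) K)
    (fun i j h => by
      simp only [← onPerfectMap_comp]
      congr 1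
      simp only [φ]
      rw [← nakTensorMap_comp, hqk, ← Category.assoc, nakToRhom_naturality, Category.assoc,
        Category.assoc]
      congr 1
      simp only [← Functor.whiskerLeft_comp, ← rhomMap_comp]
      rw [hqk, hα j i (by omega)])
    (fun K => isZero_of_subsingleton_obj (F := onPerfect (nakTensor (Ω (n + 1))))
      (fun K i => isZero_nakTensor_obj hn _) K)
    (fun K => isZero_of_subsingleton_obj (F := onPerfect (rhomDual (Ω (n + 1))))
      (fun K i => isZero_rhomDual_obj hn _) K)
  obtain ⟨d⟩ := doubleDual_comp_Q_iso (A := A)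
  let e₀ : Ω 0 ≅ diagonalBimodule A := P.opcyclesZeroIso
  let eZ : nakFunctor (A := A) A ≅ nakTensor (Ω 0) :=
    nakTensorDiagonalIso.symm ≪≫ nakTensorMapIso e₀.symm
  let eV : rhomDual (Ω 0) ≅ doubleDualFunctor :=
    Functor.isoWhiskerLeft _ (rhomMapIso e₀.symm ≪≫ rhomDiagonalIso) ≪≫ Functor.rightUnitor _
  exact ⟨Functor.isoWhiskerRight (onPerfectIso eZ) _ ≪≫ e ≪≫
    Functor.isoWhiskerRight (Functor.isoWhiskerRight (onPerfectIso eV) _ ≪≫ d.symm) _⟩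

end SelfdualLadder

/-! ### The trace of a finitely generated projective module -/

section NakayamaTrace

open scoped ModuleCat

variable {A : Type u} [Ring A] [Algebra ℂ A]

/-- The Nakayama functor `M ↦ Hom_A(M, A)^*`. -/
noncomputable abbrev nakayama : ModuleCat.{u} A ⥤ ModuleCat.{u} A := nakFunctor A

/-- The pairing of an element of `Hom_A(M, A)^*` with a linear form. -/
abbrev nakEval {M : ModuleCat.{u} A} (x : nakayama.obj M) (f : M →ₗ[A] A) : ℂ :=
  DFunLike.coe (F := NakDual A A M) x f

variable {M N Y : ModuleCat.{u} A}

theorem nakEval_sum {ι : Type*} (s : Finset ι) (x : ι → nakayama.obj M) (f : M →ₗ[A] A) :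
    nakEval (∑ i ∈ s, x i) f = ∑ i ∈ s, nakEval (x i) f :=
  map_sum ({ toFun := fun x => nakEval x f, map_zero' := rfl, map_add' := fun _ _ => rfl } :
    nakayama.obj M →+ ℂ) _ _

theorem nakEval_sum_right {ι : Type*} (s : Finset ι) (x : nakayama.obj M) (f : ι → M →ₗ[A] A) :
    nakEval x (∑ i ∈ s, f i) = ∑ i ∈ s, nakEval x (f i) :=
  map_sum (show Module.Dual ℂ (M →ₗ[A] A) from x) _ _

theorem nakEval_smul (a : A) (x : nakayama.obj M) (f : M →ₗ[A] A) :
    nakEval (a • x) f = nakEval x (op a • f) := rfl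

theorem nakEval_complex_smul (c : ℂ) (g : Y ⟶ nakayama.obj M) (y : Y) (f : M →ₗ[A] A) :
    nakEval ((c • g).hom y) f = c * nakEval (g.hom y) f := by
  have h1 : (c • g).hom y = algebraMap ℂ A c • g.hom y := rfl
  rw [h1, nakEval_smul]
  have h2 : op (algebraMap ℂ A c) • f = c • f := LinearMap.ext fun m => by
    change f m * algebraMap ℂ A c = c • f m
    rw [← Algebra.commutes, Algebra.smul_def]
  rw [h2]
  exact map_smul (show Module.Dual ℂ (M →ₗ[A] A) from g.hom y) c f

section

variable {m : ℕ} (p : Fin m → M) (β : Fin m → M →ₗ[A] A)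

/-- The trace given by a dual basis. -/
noncomputable def dualBasisTrace : (M ⟶ nakayama.obj M) →ₗ[ℂ] ℂ where
  toFun g := ∑ k, nakEval (g.hom (p k)) (β k)
  map_add' g g' := by
    rw [← Finset.sum_add_distrib]
    rfl
  map_smul' c g := by
    simp only [nakEval_complex_smul, RingHom.id_apply, smul_eq_mul, Finset.mul_sum]

theorem dualBasisTrace_apply (g : M ⟶ nakayama.obj M) :
    dualBasisTrace p β g = ∑ k, nakEval (g.hom (p k)) (β k) := rfl

variable {p β}

/-- Cyclicity: expand `u (p k)` in the dual basis of `N`, then recombine `β' l ∘ u` in that of `M`.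
The case where `u` is the identity shows that the trace does not depend on the dual basis. -/
theorem dualBasisTrace_comp (hp : ∀ x, x = ∑ k, β k x • p k) {m' : ℕ} {p' : Fin m' → N}
    {β' : Fin m' → N →ₗ[A] A} (hp' : ∀ x, x = ∑ k, β' k x • p' k) (u : M ⟶ N)
    (g : N ⟶ nakayama.obj M) :
    dualBasisTrace p β (u ≫ g) = dualBasisTrace p' β' (g ≫ nakayama.map u) := by
  simp only [dualBasisTrace_apply]
  have h1 (k : Fin m) : nakEval ((u ≫ g).hom (p k)) (β k) =
      ∑ l, nakEval (g.hom (p' l)) (op (β' l (u.hom (p k))) • β k) := by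
    change nakEval (g.hom (u.hom (p k))) (β k) = _
    conv_lhs => rw [hp' (u.hom (p k)), map_sum, nakEval_sum]
    refine Finset.sum_congr rfl fun l _ => ?_
    rw [g.hom.map_smul, nakEval_smul]
  simp only [h1]
  rw [Finset.sum_comm]
  refine Finset.sum_congr rfl fun l _ => ?_
  change _ = nakEval (g.hom (p' l)) (β' l ∘ₗ u.hom)
  rw [← nakEval_sum_right]
  congr 1
  refine LinearMap.ext fun x => ?_
  rw [LinearMap.sum_apply]
  conv_rhs => rw [hp x, map_sum]
  refine Finset.sum_congr rfl fun k _ => ?_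
  rw [map_smul]
  rfl

end

open Classical in
/-- The trace `Hom_A(M, Hom_A(M, A)^*) → ℂ` of a finitely generated projective module `M`; it is
defined to be zero if `M` is not finitely generated projective. -/
noncomputable def nakTrace (M : ModuleCat.{u} A) : (M ⟶ nakayama.obj M) →ₗ[ℂ] ℂ :=
  if h : Module.Finite A M ∧ Module.Projective A M then
    have := h.1
    have := h.2
    let e := Module.Projective.exists_dualBasis (R := A) (P := M)
    dualBasisTrace e.choose_spec.choose e.choose_spec.choose_spec.choose
  else 0

theorem exists_nakTrace_eq (M : ModuleCat.{u} A) [Module.Finite A M] [Module.Projective A M] :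
    ∃ (m : ℕ) (p : Fin m → M) (β : Fin m → M →ₗ[A] A), (∀ x, x = ∑ k, β k x • p k) ∧
      nakTrace M = dualBasisTrace p β := by
  let e := Module.Projective.exists_dualBasis (R := A) (P := M)
  exact ⟨e.choose, e.choose_spec.choose, e.choose_spec.choose_spec.choose,
    e.choose_spec.choose_spec.choose_spec, dif_pos ⟨‹_›, ‹_›⟩⟩

theorem nakTrace_comp [Module.Finite A M] [Module.Projective A M] [Module.Finite A N]
    [Module.Projective A N] (u : M ⟶ N) (g : N ⟶ nakayama.obj M) :
    nakTrace M (u ≫ g) = nakTrace N (g ≫ nakayama.map u) := by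
  obtain ⟨m, p, β, hp, h⟩ := exists_nakTrace_eq M
  obtain ⟨m', p', β', hp', h'⟩ := exists_nakTrace_eq N
  rw [h, h', dualBasisTrace_comp hp hp']

theorem nakTrace_eq_zero_of_isZero (hM : IsZero M) (g : M ⟶ nakayama.obj M) :
    nakTrace M g = 0 := by
  rw [hM.eq_of_src g 0, map_zero]

/-- Maps factoring through `A` already recover every value of `g`, which is why the trace pairing is
nondegenerate. -/
theorem nakTrace_smulRight [Module.Finite A M] [Module.Projective A M] (f : M →ₗ[A] A) (y : Y)
    (g : Y ⟶ nakayama.obj M) :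
    nakTrace M (ModuleCat.ofHom (LinearMap.toSpanSingleton A Y y ∘ₗ f) ≫ g) =
      nakEval (g.hom y) f := by
  obtain ⟨m, p, β, hp, h⟩ := exists_nakTrace_eq M
  rw [h, dualBasisTrace_apply]
  have h1 (k : Fin m) : nakEval ((ModuleCat.ofHom (LinearMap.toSpanSingleton A Y y ∘ₗ f) ≫
      g).hom (p k)) (β k) = nakEval (g.hom y) (op (f (p k)) • β k) := by
    change nakEval (g.hom (f (p k) • y)) (β k) = _
    rw [g.hom.map_smul, nakEval_smul]
  simp only [h1]
  rw [← nakEval_sum_right]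
  congr 1
  refine LinearMap.ext fun x => ?_
  rw [LinearMap.sum_apply]
  conv_rhs => rw [hp x, map_sum]
  refine Finset.sum_congr rfl fun k _ => ?_
  rw [map_smul]
  rfl

theorem eq_zero_of_nakTrace [Module.Finite A M] [Module.Projective A M] (g : Y ⟶ nakayama.obj M)
    (h : ∀ u : M ⟶ Y, nakTrace M (u ≫ g) = 0) : g = 0 := by
  ext y
  refine NakDual.ext (x := g.hom y) (y := 0) fun f => ?_
  exact (nakTrace_smulRight f y g).symm.trans (h _)

/-- Maps through `A` force `g(y)(f) = θ(f(-) y)`, and these maps span `Hom_A(M, Y)` by the dual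
basis. Conceptually, `Hom_A(Y, Hom_A(M, A)^*) = (Hom_A(M, A) ⊗_A Y)^* = Hom_A(M, Y)^*`. -/
theorem exists_nakTrace_comp_eq [Module.Finite A M] [Module.Projective A M]
    (θ : (M ⟶ Y) →ₗ[ℂ] ℂ) :
    ∃ g : Y ⟶ nakayama.obj M, ∀ u : M ⟶ Y, nakTrace M (u ≫ g) = θ u := by
  let r (y : Y) (f : M →ₗ[A] A) : M ⟶ Y := ModuleCat.ofHom (LinearMap.toSpanSingleton A Y y ∘ₗ f)
  have r_apply (y : Y) (f : M →ₗ[A] A) (x : M) : (r y f).hom x = f x • y := rfl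
  let g : Y ⟶ nakayama.obj M := ModuleCat.ofHom (Y := NakDual A A M)
    { toFun := fun y =>
        ({ toFun := fun f => θ (r y f)
           map_add' := fun f f' => by
            rw [← map_add]
            congr 1
            ext x
            change (f x + f' x) • y = f x • y + f' x • y
            rw [add_smul]
           map_smul' := fun c f => by
            rw [RingHom.id_apply, ← map_smul]
            congr 1
            ext x
            change (c • f x) • y = algebraMap ℂ A c • f x • y
            rw [smul_smul, Algebra.smul_def] } : Module.Dual ℂ (M →ₗ[A] A))
      map_add' := fun y y' => NakDual.ext fun f => by
        change θ (r (y + y') f) = θ (r y f) + θ (r y' f)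
        rw [← map_add]
        congr 1
        ext x
        exact smul_add (f x) y y'
      map_smul' := fun a y => NakDual.ext fun f => by
        change θ (r (a • y) f) = θ (r y (op a • f))
        congr 1
        ext x
        change f x • a • y = (f x * a) • y
        rw [smul_smul] }
  refine ⟨g, fun u => ?_⟩
  obtain ⟨m, p, β, hp, h⟩ := exists_nakTrace_eq M
  rw [h, dualBasisTrace_apply]
  change ∑ k, θ (r (u.hom (p k)) (β k)) = θ u
  rw [← map_sum]
  congr 1
  ext x
  conv_rhs => rw [hp x, map_sum]
  refine Eq.trans (map_sum ({ toFun := fun (v : M ⟶ Y) => v.hom x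
                              map_zero' := rfl
                              map_add' := fun _ _ => rfl } : (M ⟶ Y) →+ Y) _ _)
    (Finset.sum_congr rfl fun k _ => ?_)
  exact (u.hom.map_smul (β k x) (p k)).symm

end NakayamaTrace

/-! ### The supertrace of a perfect complex -/

section SuperTrace

open scoped ModuleCat
open CochainComplex CochainComplex.HomComplex

variable {A : Type u} [Ring A] [Algebra ℂ A]

theorem perfectComplexes.exists_finset {K : CochainComplex (ModuleCat.{u} A) ℤ}
    (hK : perfectComplexes A K) : ∃ I : Finset ℤ, ∀ i ∉ I, IsZero (K.X i) := by
  obtain ⟨⟨a, b, ha, hb⟩, -⟩ := hK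
  refine ⟨Finset.Icc a b, fun i hi => ?_⟩
  by_cases h : i < a
  · exact K.isZero_of_isStrictlyGE a i h
  · refine K.isZero_of_isStrictlyLE b i ?_
    by_contra h'
    exact hi (Finset.mem_Icc.2 ⟨by omega, by omega⟩)

/-- The Nakayama functor on complexes. -/
noncomputable abbrev nakayamaComplex :
    CochainComplex (ModuleCat.{u} A) ℤ ⥤ CochainComplex (ModuleCat.{u} A) ℤ :=
  nakayama.mapHomologicalComplex (ComplexShape.up ℤ)

variable {K L : CochainComplex (ModuleCat.{u} A) ℤ}

variable (K) in
/-- The trace on the component of degree `i`. -/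
noncomputable def componentTrace (i : ℤ) :
    (K.X i ⟶ (nakayamaComplex.obj K).X i) →ₗ[ℂ] ℂ := nakTrace (K.X i)

theorem componentTrace_eq_zero {i : ℤ} (h : IsZero (K.X i))
    (g : K.X i ⟶ (nakayamaComplex.obj K).X i) : componentTrace K i g = 0 :=
  nakTrace_eq_zero_of_isZero h g

theorem perfectComplexes.eq_zero_of_componentTrace (hK : perfectComplexes A K) {i : ℤ}
    {Y : ModuleCat.{u} A} (g : Y ⟶ (nakayamaComplex.obj K).X i)
    (h : ∀ u : K.X i ⟶ Y, componentTrace K i (u ≫ g) = 0) : g = 0 :=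
  have := (hK.2 i).1
  have := (hK.2 i).2
  eq_zero_of_nakTrace (M := K.X i) g h

theorem perfectComplexes.exists_componentTrace_eq (hK : perfectComplexes A K) (i : ℤ)
    {Y : ModuleCat.{u} A} (θ : (K.X i ⟶ Y) →ₗ[ℂ] ℂ) :
    ∃ g : Y ⟶ (nakayamaComplex.obj K).X i, ∀ u, componentTrace K i (u ≫ g) = θ u :=
  have := (hK.2 i).1
  have := (hK.2 i).2
  exists_nakTrace_comp_eq (M := K.X i) θ

theorem perfectComplexes.componentTrace_d_comp (hK : perfectComplexes A K) (i j : ℤ)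
    (g : K.X j ⟶ (nakayamaComplex.obj K).X i) :
    componentTrace K i (K.d i j ≫ g) = componentTrace K j (g ≫ (nakayamaComplex.obj K).d i j) :=
  have := (hK.2 i).1
  have := (hK.2 i).2
  have := (hK.2 j).1
  have := (hK.2 j).2
  nakTrace_comp (M := K.X i) (N := K.X j) (K.d i j) g

open Classical in
variable (K) in
/-- The alternating sum of the traces of the components of a cochain. -/
noncomputable def superTrace : Cochain K (nakayamaComplex.obj K) 0 →ₗ[ℂ] ℂ where
  -- The chosen `I` is immaterial, since terms outside the support of `K` vanish. The value `0` for
  -- other complexes merely makes the definition total.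
  toFun z := if h : ∃ I : Finset ℤ, ∀ i ∉ I, IsZero (K.X i) then
    ∑ i ∈ h.choose, i.negOnePow • componentTrace K i (z.v i i (add_zero i)) else 0
  map_add' z z' := by
    split_ifs
    · rw [← Finset.sum_add_distrib]
      refine Finset.sum_congr rfl fun i _ => ?_
      rw [Cochain.add_v, map_add, smul_add]
    · simp
  map_smul' c z := by
    split_ifs
    · rw [RingHom.id_apply, Finset.smul_sum]
      refine Finset.sum_congr rfl fun i _ => ?_
      rw [Cochain.smul_v, map_smul, smul_comm]
    · simp

theorem support_superTrace_subset {I : Finset ℤ} (hI : ∀ i ∉ I, IsZero (K.X i))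
    (g : ∀ i, K.X i ⟶ (nakayamaComplex.obj K).X i) :
    (Function.support fun i : ℤ => i.negOnePow • componentTrace K i (g i)) ⊆ I := by
  intro i hi
  by_contra h
  refine hi ?_
  change _ • componentTrace K i _ = (0 : ℂ)
  rw [componentTrace_eq_zero (hI i h), smul_zero]

theorem superTrace_eq_sum {I : Finset ℤ} (hI : ∀ i ∉ I, IsZero (K.X i))
    (z : Cochain K (nakayamaComplex.obj K) 0) :
    superTrace K z = ∑ i ∈ I, i.negOnePow • componentTrace K i (z.v i i (add_zero i)) := by
  have h : ∃ I : Finset ℤ, ∀ i ∉ I, IsZero (K.X i) := ⟨I, hI⟩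
  refine (dif_pos h).trans ?_
  rw [← finsum_eq_sum_of_support_subset _ (support_superTrace_subset h.choose_spec _),
    ← finsum_eq_sum_of_support_subset _ (support_superTrace_subset hI _)]

/-- By cyclicity of the trace the two halves of the coboundary contribute `f i` and `-f (i + 1)` in
degree `i`, and the alternating sum telescopes. -/
theorem superTrace_δ (hK : perfectComplexes A K) (z : Cochain K (nakayamaComplex.obj K) (-1)) :
    superTrace K (δ (-1) 0 z) = 0 := by
  obtain ⟨I, hI⟩ := hK.exists_finset
  let g (i : ℤ) : K.X i ⟶ (nakayamaComplex.obj K).X i :=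
    z.v i (i - 1) (by omega) ≫ (nakayamaComplex.obj K).d (i - 1) i
  let f (i : ℤ) : ℂ := i.negOnePow • componentTrace K i (g i)
  have hf : (Function.support f) ⊆ I := support_superTrace_subset hI g
  have h1 (i : ℤ) : i.negOnePow • componentTrace K i ((δ (-1) 0 z).v i i (add_zero i)) =
      f i - f (i + 1) := by
    rw [δ_v (-1) 0 (by simp) z i i (by simp) (i - 1) (i + 1) rfl rfl]
    have h2 : componentTrace K i (K.d i (i + 1) ≫ z.v (i + 1) i (by omega)) =
        componentTrace K (i + 1) (z.v (i + 1) i (by omega) ≫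
          (nakayamaComplex.obj K).d i (i + 1)) := hK.componentTrace_d_comp _ _ _
    -- `g (i + 1)` passes through degree `i + 1 - 1`, which equals `i` only propositionally.
    have hg (j : ℤ) (hj : j = i) : z.v (i + 1) j (by omega) ≫ (nakayamaComplex.obj K).d j (i + 1) =
        z.v (i + 1) i (by omega) ≫ (nakayamaComplex.obj K).d i (i + 1) := by
      subst hj
      rfl
    have h3 : g (i + 1) = z.v (i + 1) i (by omega) ≫ (nakayamaComplex.obj K).d i (i + 1) :=
      hg (i + 1 - 1) (by omega)
    rw [Int.negOnePow_zero, one_smul, map_add, h2, ← h3, smul_add]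
    simp only [f, Int.negOnePow_succ]
    rw [Units.neg_smul, sub_neg_eq_add]
  rw [superTrace_eq_sum hI, ← finsum_eq_sum_of_support_subset _ (support_superTrace_subset hI _),
    finsum_congr h1, finsum_sub_distrib]
  · rw [sub_eq_zero]
    exact (finsum_comp_equiv (Equiv.addRight (1 : ℤ)) (f := f)).symm
  · exact I.finite_toSet.subset hf
  · refine ((I.finite_toSet.subset hf).preimage (Equiv.addRight (1 : ℤ)).injective.injOn).subset ?_
    exact fun i hi => hi

theorem superTrace_comp (hK : perfectComplexes A K) (hL : perfectComplexes A L) (f : K ⟶ L)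
    (g : L ⟶ nakayamaComplex.obj K) :
    superTrace K (Cochain.ofHom (f ≫ g)) =
      superTrace L (Cochain.ofHom (g ≫ nakayamaComplex.map f)) := by
  obtain ⟨I, hI⟩ := hK.exists_finset
  obtain ⟨J, hJ⟩ := hL.exists_finset
  have h₁ (i : ℤ) : Module.Projective A (K.X i) := (hK.2 i).1
  have h₂ (i : ℤ) : Module.Finite A (K.X i) := (hK.2 i).2
  have h₃ (i : ℤ) : Module.Projective A (L.X i) := (hL.2 i).1
  have h₄ (i : ℤ) : Module.Finite A (L.X i) := (hL.2 i).2
  rw [superTrace_eq_sum hI, superTrace_eq_sum hJ,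
    ← finsum_eq_sum_of_support_subset _ (support_superTrace_subset hI _),
    ← finsum_eq_sum_of_support_subset _ (support_superTrace_subset hJ _)]
  refine finsum_congr fun i => ?_
  congr 1
  exact nakTrace_comp (f.f i) (g.f i)

variable {p q : ℤ}

theorem superTrace_comp_eq_sum {I : Finset ℤ} (hI : ∀ i ∉ I, IsZero (K.X i)) (h : p + q = 0)
    (z : Cochain K L p) (y : Cochain L (nakayamaComplex.obj K) q) :
    superTrace K (z.comp y h) = ∑ i ∈ I, i.negOnePow •
      componentTrace K i (z.v i (i + p) rfl ≫ y.v (i + p) i (by omega)) := by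
  rw [superTrace_eq_sum hI]
  refine Finset.sum_congr rfl fun i _ => ?_
  rw [Cochain.comp_v z y h i (i + p) i rfl (by omega)]

theorem superTrace_single_comp (hK : perfectComplexes A K) (h : p + q = 0) (i j : ℤ)
    (hj : i + p = j) (u : K.X i ⟶ L.X j) (y : Cochain L (nakayamaComplex.obj K) q) :
    superTrace K ((Cochain.single u p).comp y h) =
      i.negOnePow • componentTrace K i (u ≫ y.v j i (by omega)) := by
  subst hj
  obtain ⟨I, hI⟩ := hK.exists_finset
  have hI' : ∀ j ∉ insert i I, IsZero (K.X j) := fun j hj => hI j fun h => hj (by simp [h])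
  rw [superTrace_comp_eq_sum hI', Finset.sum_eq_single i]
  · rw [Cochain.single_v]
  · intro j _ hj
    rw [Cochain.single_v_eq_zero _ _ _ _ _ hj, zero_comp, map_zero, smul_zero]
  · intro h
    exact absurd (Finset.mem_insert_self i I) h

/-- Cochains concentrated in one degree reduce nondegeneracy to that of the trace on each component.
-/
theorem eq_zero_of_superTrace (hK : perfectComplexes A K) (h : p + q = 0)
    (y : Cochain L (nakayamaComplex.obj K) q)
    (hy : ∀ z : Cochain K L p, superTrace K (z.comp y h) = 0) : y = 0 := by
  refine Cochain.ext _ _ fun j i hij => ?_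
  refine hK.eq_zero_of_componentTrace _ fun u => ?_
  have h1 := hy (Cochain.single u p)
  rw [superTrace_single_comp hK h i j (by omega)] at h1
  exact (smul_eq_zero_iff_eq _).1 h1

theorem exists_superTrace_comp_eq (hK : perfectComplexes A K) (h : p + q = 0)
    (θ : Cochain K L p →ₗ[ℂ] ℂ) :
    ∃ y : Cochain L (nakayamaComplex.obj K) q, ∀ z, superTrace K (z.comp y h) = θ z := by
  obtain ⟨I, hI⟩ := hK.exists_finset
  have hs (i j : ℤ) (hij : i + p = j) : ∃ g : L.X j ⟶ (nakayamaComplex.obj K).X i,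
      ∀ u : K.X i ⟶ L.X j, componentTrace K i (u ≫ g) = θ (Cochain.single u p) :=
    hK.exists_componentTrace_eq i
      { toFun := fun u => θ (Cochain.single u p)
        map_add' := fun u u' => by
          rw [← map_add]
          congr 1
          ext i' j' h'
          by_cases hi : i' = i
          · subst hi
            obtain rfl : j = j' := by omega
            simp
          · simp [Cochain.single_v_eq_zero _ _ _ _ _ hi]
        map_smul' := fun c u => by
          rw [RingHom.id_apply, ← map_smul]
          congr 1
          ext i' j' h'
          by_cases hi : i' = i
          · subst hi
            obtain rfl : j = j' := by omega
            simp
          · simp [Cochain.single_v_eq_zero _ _ _ _ _ hi] }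
  choose g hg using hs
  -- The sign cancels the one in the supertrace.
  refine ⟨Cochain.mk fun j i hji => i.negOnePow • g i j (by omega), fun z => ?_⟩
  rw [superTrace_comp_eq_sum hI]
  have h1 : z = ∑ i ∈ I, Cochain.single (z.v i (i + p) rfl) p := by
    refine Cochain.ext _ _ fun i j hij => ?_
    subst hij
    have h2 : (∑ i ∈ I, Cochain.single (z.v i (i + p) rfl) p).v i (i + p) rfl =
        ∑ i' ∈ I, (Cochain.single (z.v i' (i' + p) rfl) p).v i (i + p) rfl :=
      map_sum ({ toFun := fun z : Cochain K L p => z.v i (i + p) rfl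
                 map_zero' := rfl
                 map_add' := fun _ _ => rfl } : Cochain K L p →+ _) _ _
    rw [h2]
    by_cases hi : i ∈ I
    · rw [Finset.sum_eq_single i]
      · rw [Cochain.single_v]
      · intro i' _ hi'
        rw [Cochain.single_v_eq_zero _ _ _ _ _ hi'.symm]
      · exact fun h => absurd hi h
    · exact (hI i hi).eq_of_src _ _
  conv_rhs => rw [h1, map_sum]
  refine Finset.sum_congr rfl fun i _ => ?_
  rw [Cochain.mk_v, Linear.comp_units_smul, ← hg i (i + p) rfl]
  generalize i.negOnePow = ε
  rcases Int.units_eq_one_or ε with rfl | rfl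
  · simp
  · simp

/-- Integration by parts: the supertrace kills the coboundary of `z.comp y`, which the Leibniz rule
expands. Up to sign, the two differentials are adjoint for the pairing. -/
theorem superTrace_δ_comp (hK : perfectComplexes A K) {p' q' : ℤ} (hp : p + 1 = p')
    (hq : q + 1 = q') (h : p' + q = 0) (h' : p + q' = 0) (z : Cochain K L p)
    (y : Cochain L (nakayamaComplex.obj K) q) :
    superTrace K (z.comp (δ q q' y) h') + q.negOnePow • superTrace K ((δ p p' z).comp y h) = 0 := by
  have h1 := superTrace_δ hK (z.comp y (show p + q = -1 by omega))
  rw [δ_comp z y (show p + q = -1 by omega) p' q' 0 (by simp) hp hq, map_add] at h1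
  rw [← h1]
  congr 1
  generalize q.negOnePow = ε
  rcases Int.units_eq_one_or ε with rfl | rfl
  · simp
  · simp

end SuperTrace

/-! ### Nakayama duality in the derived category -/

section NakayamaDuality

open scoped ModuleCat
open CochainComplex CochainComplex.HomComplex DerivedCategory

theorem CochainComplex.IsKProjective.Q_map_surjective {C : Type*} [Category* C] [Abelian C]
    [HasDerivedCategory.{w} C] (K L : CochainComplex C ℤ) [K.IsKProjective] :
    Function.Surjective (Q.map : (K ⟶ L) → (Q.obj K ⟶ Q.obj L)) := by
  intro g
  obtain ⟨f, hf⟩ := (IsKProjective.Qh_map_bijective K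
    ((HomotopyCategory.quotient C (ComplexShape.up ℤ)).obj L)).surjective
    ((quotientCompQhIso C).hom.app K ≫ g ≫ (quotientCompQhIso C).inv.app L)
  obtain ⟨f, rfl⟩ := (HomotopyCategory.quotient C (ComplexShape.up ℤ)).map_surjective f
  refine ⟨f, ?_⟩
  have h1 := (quotientCompQhIso C).hom.naturality f
  have h2 : (HomotopyCategory.quotient C (ComplexShape.up ℤ) ⋙ Qh).map f =
    (quotientCompQhIso C).hom.app K ≫ g ≫ (quotientCompQhIso C).inv.app L := hf
  rw [h2, Category.assoc, Category.assoc, Iso.inv_hom_id_app] at h1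
  rw [← cancel_epi ((quotientCompQhIso C).hom.app K), ← h1]
  exact congrArg _ (Category.comp_id _)

theorem CochainComplex.IsKProjective.nonempty_homotopy {C : Type*} [Category* C] [Abelian C]
    [HasDerivedCategory.{w} C] {K L : CochainComplex C ℤ} [K.IsKProjective] (f : K ⟶ L)
    (hf : Q.map f = 0) : Nonempty (Homotopy f 0) := by
  have h1 := (quotientCompQhIso C).hom.naturality f
  rw [hf, comp_zero] at h1
  have h2 : Qh.map ((HomotopyCategory.quotient C (ComplexShape.up ℤ)).map f) = 0 := by
    rw [← cancel_mono ((quotientCompQhIso C).hom.app L), zero_comp]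
    exact h1
  have h3 := (IsKProjective.Qh_map_bijective K
    ((HomotopyCategory.quotient C (ComplexShape.up ℤ)).obj L)).injective
    (h2.trans (Functor.map_zero _ _ _).symm)
  exact ⟨HomotopyCategory.homotopyOfEq f 0 (h3.trans (Functor.map_zero _ _ _).symm)⟩

variable {A : Type u} [Ring A] [Algebra ℂ A]

theorem perfectComplexes.isKProjective {K : CochainComplex (ModuleCat.{u} A) ℤ}
    (hK : perfectComplexes A K) : K.IsKProjective := by
  obtain ⟨⟨a, b, -, hb⟩, h⟩ := hK
  have (i : ℤ) : Projective (K.X i) := (IsProjective.iff_projective _).1 (h i).1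
  exact isKProjective_of_projective K b

variable {K L : CochainComplex (ModuleCat.{u} A) ℤ}

theorem superTrace_eq_zero_of_homotopy (hK : perfectComplexes A K) (f : K ⟶ nakayamaComplex.obj K)
    (h : Homotopy f 0) : superTrace K (Cochain.ofHom f) = 0 := by
  obtain ⟨z, hz⟩ := Cochain.equivHomotopy f 0 h
  rw [hz, Cochain.ofHom_zero, add_zero]
  exact superTrace_δ hK z

theorem Cochain.ofHom_smul (c : ℂ) (f : K ⟶ L) : Cochain.ofHom (c • f) = c • Cochain.ofHom f := by
  ext i : 1
  simp only [Cochain.ofHom_v, Cochain.smul_v]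
  rfl

variable [HasDerivedCategory.{w} (ModuleCat.{u} A)]

/-- `K` is K-projective, so the maps killed by `Q` are null-homotopic, and these have supertrace
zero. -/
theorem exists_derivedTrace (hK : perfectComplexes A K) :
    ∃ t : (Q.obj K ⟶ Q.obj (nakayamaComplex.obj K)) →ₗ[ℂ] ℂ,
      ∀ f, t (Q.map f) = superTrace K (Cochain.ofHom f) := by
  have := hK.isKProjective
  let s : (K ⟶ nakayamaComplex.obj K) →ₗ[ℂ] ℂ :=
    { toFun := fun f => superTrace K (Cochain.ofHom f)
      map_add' := fun f g => by rw [Cochain.ofHom_add, map_add]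
      map_smul' := fun c f => by rw [Cochain.ofHom_smul, map_smul, RingHom.id_apply] }
  obtain ⟨t, ht⟩ := LinearMap.exists_comp_eq_of_ker_le
    (Q.mapLinearMap ℂ (X := K) (Y := nakayamaComplex.obj K)) s fun f hf => by
      obtain ⟨h⟩ := IsKProjective.nonempty_homotopy f hf
      exact superTrace_eq_zero_of_homotopy hK f h
  exact ⟨t, fun f => LinearMap.congr_fun ht f⟩

/-- The trace on the derived category induced by the supertrace. -/
noncomputable def derivedTrace (hK : perfectComplexes A K) :
    (Q.obj K ⟶ Q.obj (nakayamaComplex.obj K)) →ₗ[ℂ] ℂ :=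
  (exists_derivedTrace hK).choose

theorem derivedTrace_map (hK : perfectComplexes A K) (f : K ⟶ nakayamaComplex.obj K) :
    derivedTrace hK (Q.map f) = superTrace K (Cochain.ofHom f) :=
  (exists_derivedTrace hK).choose_spec f

theorem derivedTrace_comp (hK : perfectComplexes A K) (hL : perfectComplexes A L) (f : K ⟶ L)
    (g : Q.obj L ⟶ Q.obj (nakayamaComplex.obj K)) :
    derivedTrace hK (Q.map f ≫ g) = derivedTrace hL (g ≫ Q.map (nakayamaComplex.map f)) := by
  have := hL.isKProjective
  obtain ⟨g, rfl⟩ := IsKProjective.Q_map_surjective _ _ g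
  rw [← Functor.map_comp, ← Functor.map_comp, derivedTrace_map, derivedTrace_map,
    superTrace_comp hK hL]

/-- The supertrace makes the complex `Hom(L, νK)` the dual of `Hom(K, L)`, and duality over a field
is exact: a functional vanishing on cocycles factors through the differential, so it is represented
by a coboundary. -/
theorem eq_zero_of_derivedTrace (hK : perfectComplexes A K) (hL : perfectComplexes A L)
    (g : Q.obj L ⟶ Q.obj (nakayamaComplex.obj K))
    (h : ∀ f : Q.obj K ⟶ Q.obj L, derivedTrace hK (f ≫ g) = 0) : g = 0 := by
  have := hL.isKProjective
  obtain ⟨y, rfl⟩ := IsKProjective.Q_map_surjective _ _ g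
  have h1 (z : Cochain K L 0) (hz : δ 0 1 z = 0) :
      superTrace K (z.comp (Cochain.ofHom y) (add_zero 0)) = 0 := by
    let c : Cocycle K L 0 := Cocycle.mk z 1 (by simp) hz
    have h2 := h (Q.map (Cocycle.homOf c))
    rw [← Functor.map_comp, derivedTrace_map, Cochain.ofHom_comp,
      Cocycle.cochain_ofHom_homOf_eq_coe] at h2
    exact h2
  let s : Cochain K L 0 →ₗ[ℂ] ℂ :=
    { toFun := fun z => superTrace K (z.comp (Cochain.ofHom y) (add_zero 0))
      map_add' := fun z z' => by rw [Cochain.add_comp, map_add]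
      map_smul' := fun c z => by rw [Cochain.smul_comp, map_smul, RingHom.id_apply] }
  obtain ⟨θ, hθ⟩ := LinearMap.exists_comp_eq_of_ker_le (δ_hom ℂ K L 0 1) s fun z hz => h1 z hz
  -- The functional `θ` on cochains of degree `1` is represented by a cochain `x` of degree `-1`;
  -- integration by parts then shows `y = δ x`.
  obtain ⟨x, hx⟩ := exists_superTrace_comp_eq hK (show (1 : ℤ) + (-1) = 0 by simp) θ
  have h3 : Cochain.ofHom y - δ (-1) 0 x = 0 := by
    refine eq_zero_of_superTrace hK (show (0 : ℤ) + 0 = 0 by simp) _ fun z => ?_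
    have h4 := superTrace_δ_comp hK (show (0 : ℤ) + 1 = 1 by simp)
      (show (-1 : ℤ) + 1 = 0 by simp) (by simp) (by simp) z x
    rw [hx] at h4
    have h5 : θ (δ 0 1 z) = superTrace K (z.comp (Cochain.ofHom y) (add_zero 0)) :=
      LinearMap.congr_fun hθ z
    rw [h5, Int.negOnePow_neg, Int.negOnePow_one, Units.neg_smul, one_smul] at h4
    rw [Cochain.comp_sub, map_sub, ← neg_eq_zero, ← h4]
    abel
  have h6 : Homotopy y 0 := (Cochain.equivHomotopy y 0).symm
    ⟨x, by rw [Cochain.ofHom_zero, add_zero]; exact sub_eq_zero.1 h3⟩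
  rw [Q_map_eq_of_homotopy _ h6, Functor.map_zero]

theorem exists_derivedTrace_comp_eq (hK : perfectComplexes A K)
    (θ : (Q.obj K ⟶ Q.obj L) →ₗ[ℂ] ℂ) :
    ∃ g : Q.obj L ⟶ Q.obj (nakayamaComplex.obj K), ∀ f, derivedTrace hK (f ≫ g) = θ f := by
  have := hK.isKProjective
  let ι : (K ⟶ L) →ₗ[ℂ] Cochain K L 0 :=
    { toFun := Cochain.ofHom
      map_add' := Cochain.ofHom_add
      map_smul' := Cochain.ofHom_smul }
  have hι : LinearMap.ker ι ≤ LinearMap.ker (θ ∘ₗ Q.mapLinearMap ℂ (X := K) (Y := L)) :=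
    fun f hf => by
      have : f = 0 := Cochain.ofHom_injective (hf.trans (Cochain.ofHom_zero K L).symm)
      rw [this]
      exact Submodule.zero_mem _
  -- The functional, known on chain maps, is extended arbitrarily to all cochains of degree `0`. It
  -- still kills coboundaries, since these are null-homotopic chain maps, and hence the representing
  -- cochain `y` is closed.
  obtain ⟨θ', hθ'⟩ := LinearMap.exists_comp_eq_of_ker_le ι _ hι
  have hθ'' (f : K ⟶ L) : θ' (Cochain.ofHom f) = θ (Q.map f) := LinearMap.congr_fun hθ' f
  obtain ⟨y, hy⟩ := exists_superTrace_comp_eq hK (show (0 : ℤ) + 0 = 0 by simp) θ'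
  have h1 (z : Cochain K L (-1)) : θ' (δ (-1) 0 z) = 0 := by
    let c : Cocycle K L 0 := Cocycle.mk (δ (-1) 0 z) 1 (by simp) (δ_δ _ _ _ _)
    have h2 : Cochain.ofHom (Cocycle.homOf c) = δ (-1) 0 z := Cocycle.cochain_ofHom_homOf_eq_coe c
    have h3 : Homotopy (Cocycle.homOf c) 0 := (Cochain.equivHomotopy _ _).symm
      ⟨z, by rw [Cochain.ofHom_zero, add_zero]; exact h2⟩
    rw [← h2, hθ'', Q_map_eq_of_homotopy _ h3, Functor.map_zero, map_zero]
  have h2 : δ 0 1 y = 0 := by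
    refine eq_zero_of_superTrace hK (show (-1 : ℤ) + 1 = 0 by simp) _ fun z => ?_
    have h4 := superTrace_δ_comp hK (show (-1 : ℤ) + 1 = 0 by simp)
      (show (0 : ℤ) + 1 = 1 by simp) (by simp) (by simp) z y
    rw [hy, h1, smul_zero, add_zero] at h4
    exact h4
  let c : Cocycle L (nakayamaComplex.obj K) 0 := Cocycle.mk y 1 (by simp) h2
  have hc : Cochain.ofHom (Cocycle.homOf c) = y := Cocycle.cochain_ofHom_homOf_eq_coe c
  refine ⟨Q.map (Cocycle.homOf c), fun f => ?_⟩
  obtain ⟨f, rfl⟩ := IsKProjective.Q_map_surjective _ _ f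
  rw [← Functor.map_comp, derivedTrace_map, Cochain.ofHom_comp, hc, hy, hθ'']

end NakayamaDuality

/-! ### Tensor products with bimodules -/

section BimoduleTensor

open scoped ModuleCat

variable {A : Type u} [Ring A] [Algebra ℂ A]

/-- The relations `b a ⊗ m = b ⊗ a m`. -/
noncomputable def tensorRelations (B : ModuleCat.{u} (Env A)) (M : ModuleCat.{u} A) :
    Submodule A (B ⊗[ℤ] M) :=
  Submodule.span A {x | ∃ (b : B) (a : A) (m : M), x = (op a • b) ⊗ₜ[ℤ] m - b ⊗ₜ[ℤ] (a • m)}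

/-- The left module `B ⊗_A M`. -/
def BimoduleTensor (B : ModuleCat.{u} (Env A)) (M : ModuleCat.{u} A) : Type u :=
  (B ⊗[ℤ] M) ⧸ tensorRelations B M

namespace BimoduleTensor

variable {B B' B'' : ModuleCat.{u} (Env A)} {M : ModuleCat.{u} A}

noncomputable instance : AddCommGroup (BimoduleTensor B M) :=
  inferInstanceAs (AddCommGroup ((B ⊗[ℤ] M) ⧸ tensorRelations B M))

noncomputable instance : Module A (BimoduleTensor B M) :=
  inferInstanceAs (Module A ((B ⊗[ℤ] M) ⧸ tensorRelations B M))

variable (B M) in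
/-- The projection. -/
noncomputable def proj : (B ⊗[ℤ] M) →ₗ[A] BimoduleTensor B M := (tensorRelations B M).mkQ

/-- The class of `b ⊗ m`. -/
noncomputable def tmk (b : B) (m : M) : BimoduleTensor B M := proj B M (b ⊗ₜ[ℤ] m)

theorem smul_tmk (a : A) (b : B) (m : M) : a • tmk b m = tmk (a • b) m := rfl

theorem op_smul_tmk (a : A) (b : B) (m : M) : tmk (op a • b) m = tmk b (a • m) :=
  (Submodule.Quotient.eq _).2 (Submodule.subset_span ⟨b, a, m, rfl⟩)

theorem add_tmk (b b' : B) (m : M) : tmk (b + b') m = tmk b m + tmk b' m := by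
  simp only [tmk, TensorProduct.add_tmul, map_add]

theorem tmk_add (b : B) (m m' : M) : tmk b (m + m') = tmk b m + tmk b m' := by
  simp only [tmk, TensorProduct.tmul_add, map_add]

theorem induction_on {P : BimoduleTensor B M → Prop} (x : BimoduleTensor B M)
    (tmk : ∀ b m, P (tmk b m)) (add : ∀ x y, P x → P y → P (x + y)) : P x := by
  obtain ⟨x, rfl⟩ := Submodule.Quotient.mk_surjective _ x
  induction x using TensorProduct.induction_on with
  | zero =>
    have h := tmk 0 0
    rwa [BimoduleTensor.tmk, TensorProduct.zero_tmul] at h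
  | tmul b m => exact tmk b m
  | add x y hx hy => exact add _ _ hx hy

/-- Homomorphisms of left modules out of `B ⊗_A M`. -/
noncomputable def liftHom {N : Type*} [AddCommGroup N] [Module A N] (f : B →+ M →+ N)
    (hf : ∀ (a : A) (b : B) (m : M), f (a • b) m = a • f b m)
    (hf' : ∀ (a : A) (b : B) (m : M), f (op a • b) m = f b (a • m)) :
    BimoduleTensor B M →ₗ[A] N :=
  Submodule.liftQ (tensorRelations B M)
    ({ (TensorProduct.liftAddHom f (fun r b m => by simp) : B ⊗[ℤ] M →+ N) with
       map_smul' := fun a x => by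
        induction x using TensorProduct.induction_on with
        | zero => simp
        | tmul b m => exact hf a b m
        | add x y hx hy =>
          simp only [ZeroHom.toFun_eq_coe, AddMonoidHom.toZeroHom_coe, RingHom.id_apply] at hx hy ⊢
          rw [smul_add, map_add, hx, hy, map_add, smul_add] } : B ⊗[ℤ] M →ₗ[A] N)
    (by
      refine Submodule.span_le.2 ?_
      rintro x ⟨b, a, m, rfl⟩
      rw [SetLike.mem_coe, LinearMap.mem_ker, map_sub, sub_eq_zero]
      exact hf' a b m)

/-- Additive maps out of `B ⊗_A M`. -/
noncomputable def liftAdd {N : Type*} [AddCommGroup N] (f : B →+ M →+ N)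
    (hf' : ∀ (a : A) (b : B) (m : M), f (op a • b) m = f b (a • m)) : BimoduleTensor B M →+ N :=
  QuotientAddGroup.lift (tensorRelations B M).toAddSubgroup
    (TensorProduct.liftAddHom f (fun r b m => by simp) : B ⊗[ℤ] M →+ N) (by
      intro x hx
      -- The lifted map is only additive while the relations form an `A`-submodule, so vanishing is
      -- proved for all multiples `a • x` at once and used for `a = 1`.
      refine Submodule.span_induction (p := fun x _ => ∀ a : A,
        TensorProduct.liftAddHom f (fun r b m => by simp) (a • x) = 0) ?_ ?_ ?_ ?_ hx 1 |>.symm.trans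
          (by rw [one_smul]) |>.symm
      · rintro x ⟨b, a, m, rfl⟩ a'
        rw [smul_sub, map_sub, sub_eq_zero]
        change f (a' • op a • b) m = f (a' • b) (a • m)
        rw [smul_comm, hf']
      · intro a
        rw [smul_zero, map_zero]
      · intro x y _ _ hx hy a
        rw [smul_add, map_add, hx, hy, add_zero]
      · intro a' x _ hx a
        rw [smul_smul]
        exact hx _)

/-- The bilinear map `(b, m) ↦ b ⊗ m`. -/
noncomputable def mk (B : ModuleCat.{u} (Env A)) (M : ModuleCat.{u} A) :
    B →+ M →+ BimoduleTensor B M :=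
  AddMonoidHom.mk' (fun b => AddMonoidHom.mk' (fun m => tmk b m) (tmk_add b))
    fun b b' => AddMonoidHom.ext fun m => add_tmk b b' m

/-- The functoriality for homomorphisms of right modules. -/
noncomputable def mapRight (f : B →ₗ[Aᵐᵒᵖ] B') (M : ModuleCat.{u} A) :
    BimoduleTensor B M →+ BimoduleTensor B' M :=
  liftAdd ((mk B' M).comp f.toAddMonoidHom) fun a b m =>
    (congrArg (fun b' => tmk b' m) (f.map_smul (op a) b)).trans (op_smul_tmk a (f b) m)

@[simp] theorem mapRight_tmk (f : B →ₗ[Aᵐᵒᵖ] B') (b : B) (m : M) :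
    mapRight f M (tmk b m) = tmk (f b) m := rfl

/-- The functoriality for homomorphisms of bimodules. -/
noncomputable def map (g : B ⟶ B') (M : ModuleCat.{u} A) :
    BimoduleTensor B M →ₗ[A] BimoduleTensor B' M :=
  liftHom ((mk B' M).comp g.hom.toAddMonoidHom)
    (fun a b m => (congrArg (fun b' => tmk b' m) (hom_smul g a b)).trans
      (smul_tmk a (g.hom b) m).symm)
    fun a b m =>
      (congrArg (fun b' => tmk b' m) (hom_op_smul g a b)).trans (op_smul_tmk a (g.hom b) m)

@[simp] theorem map_tmk (g : B ⟶ B') (b : B) (m : M) :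
    map g M (tmk b m) = tmk (g.hom b) m := rfl

theorem map_map_of_comp_eq_id {g : B ⟶ B'} {g' : B' ⟶ B} (h : g ≫ g' = 𝟙 _) (M : ModuleCat.{u} A) :
    map g' M ∘ₗ map g M = LinearMap.id := by
  refine LinearMap.ext fun x => ?_
  induction x using induction_on with
  | tmk b m => exact congrArg (fun b => tmk b m) (ConcreteCategory.congr_hom h b)
  | add x y hx hy => rw [map_add, hx, hy, map_add]

/-- The sequence splits as a sequence of right modules. The section and retraction induce additive
maps on the tensor products, which is enough for exactness of the `A`-linear sequence. -/
theorem shortExact {k : B' ⟶ B} {q : B ⟶ B''} (w : k ≫ q = 0)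
    (h : (ShortComplex.mk k q w).ShortExact) [Module.Projective Aᵐᵒᵖ B''] (M : ModuleCat.{u} A) :
    ∃ w' : ModuleCat.ofHom (map k M) ≫ ModuleCat.ofHom (map q M) = 0,
      (ShortComplex.mk _ _ w').ShortExact := by
  have hk : Function.Injective k.hom := (ModuleCat.mono_iff_injective _).1 h.mono_f
  have hq : Function.Surjective q.hom := (ModuleCat.epi_iff_surjective _).1 h.epi_g
  have hkq : Function.Exact k.hom q.hom :=
    (ShortComplex.ShortExact.moduleCat_exact_iff_function_exact _).1 h.exact
  let k' : B' →ₗ[Aᵐᵒᵖ] B :=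
    { toFun := k.hom, map_add' := map_add k.hom, map_smul' := fun a b => hom_op_smul k a.unop b }
  let q' : B →ₗ[Aᵐᵒᵖ] B'' :=
    { toFun := q.hom, map_add' := map_add q.hom, map_smul' := fun a b => hom_op_smul q a.unop b }
  obtain ⟨s, hs⟩ := Module.projective_lifting_property q' LinearMap.id hq
  have hs' (x : B'') : q.hom (s x) = x := LinearMap.congr_fun hs x
  have hr (b : B) : b - s (q.hom b) ∈ LinearMap.range k' := by
    obtain ⟨x, hx⟩ := (hkq (b - s (q.hom b))).1 (by rw [map_sub, hs', sub_self])
    exact ⟨x, hx⟩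
  let e := LinearEquiv.ofInjective k' hk
  let r : B →ₗ[Aᵐᵒᵖ] B' := e.symm.toLinearMap ∘ₗ
    (LinearMap.codRestrict _ (LinearMap.id - s ∘ₗ q') hr)
  have hkr (b : B) : k.hom (r b) = b - s (q.hom b) :=
    congrArg Subtype.val (e.apply_symm_apply ⟨b - s (q.hom b), hr b⟩)
  have hrk (b : B') : r (k.hom b) = b :=
    hk ((hkr _).trans (by rw [hkq.apply_apply_eq_zero, map_zero, sub_zero]))
  have h0 (m : M) : tmk (0 : B'') m = 0 := by rw [tmk, TensorProduct.zero_tmul, map_zero]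
  have h1 (x : BimoduleTensor B' M) : map q M (map k M x) = 0 := by
    induction x using induction_on with
    | tmk b m => rw [map_tmk, map_tmk, hkq.apply_apply_eq_zero, h0]
    | add x y hx hy => rw [map_add, map_add, hx, hy, add_zero]
  have h2 (x : BimoduleTensor B' M) : mapRight r M (map k M x) = x := by
    induction x using induction_on with
    | tmk b m => rw [map_tmk, mapRight_tmk, hrk]
    | add x y hx hy => rw [map_add, map_add, hx, hy]
  have h3 (x : BimoduleTensor B'' M) : map q M (mapRight s M x) = x := by
    induction x using induction_on with
    | tmk b m => rw [mapRight_tmk, map_tmk, hs']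
    | add x y hx hy => rw [map_add, map_add, hx, hy]
  have h4 (x : BimoduleTensor B M) :
      map k M (mapRight r M x) + mapRight s M (map q M x) = x := by
    induction x using induction_on with
    | tmk b m => rw [mapRight_tmk, map_tmk, map_tmk, mapRight_tmk, hkr, ← add_tmk, sub_add_cancel]
    | add x y hx hy =>
      conv_rhs => rw [← hx, ← hy]
      simp only [map_add]
      abel
  refine ⟨ModuleCat.hom_ext (LinearMap.ext h1), ?_⟩
  exact
    { exact := (ShortComplex.ShortExact.moduleCat_exact_iff_function_exact _).2 fun x =>
        ⟨fun hx => ⟨mapRight r M x, by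
          have h5 := h4 x
          have hx' : map q M x = 0 := hx
          rw [hx', map_zero, add_zero] at h5
          exact h5⟩, by
          rintro ⟨y, rfl⟩
          exact h1 y⟩
      mono_f := (ModuleCat.mono_iff_injective _).2 (Function.LeftInverse.injective h2)
      epi_g := (ModuleCat.epi_iff_surjective _).2 (Function.RightInverse.surjective h3) }

/-- An element of `A` as an element of the diagonal bimodule. -/
abbrev toDiagonal (a : A) : diagonalBimodule A := a

/-- An element of the diagonal bimodule as an element of `A`. -/
abbrev ofDiagonal (a : diagonalBimodule A) : A := a

theorem ofDiagonal_smul (a : A) (b : diagonalBimodule A) :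
    ofDiagonal (a • b) = a * ofDiagonal b :=
  (diagonalModule_tmul_smul A a 1 b).trans (mul_one _)

theorem ofDiagonal_op_smul (a : A) (b : diagonalBimodule A) :
    ofDiagonal (op a • b) = ofDiagonal b * a :=
  (diagonalModule_tmul_smul A 1 a b).trans (congrArg (· * a) (one_mul _))

/-- `A ⊗_A M = M`. -/
noncomputable def diagonalEquiv (M : ModuleCat.{u} A) :
    BimoduleTensor (diagonalBimodule A) M ≃ₗ[A] M :=
  LinearEquiv.ofLinearMap
    (liftHom (AddMonoidHom.mk' (fun a : diagonalBimodule A =>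
        AddMonoidHom.mk' (fun m : M => ofDiagonal a • m) (smul_add (ofDiagonal a)))
        fun a a' => AddMonoidHom.ext fun m => add_smul (ofDiagonal a) (ofDiagonal a') m)
      (fun a b m => (congrArg (· • m) (ofDiagonal_smul a b)).trans (mul_smul a (ofDiagonal b) m))
      (fun a b m => (congrArg (· • m) (ofDiagonal_op_smul a b)).trans (mul_smul (ofDiagonal b) a m)))
    ({ toFun := fun m => tmk (toDiagonal 1) m
       map_add' := tmk_add _
       map_smul' := fun a m => by
        have h1 : op a • toDiagonal (1 : A) = a • toDiagonal 1 :=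
          (ofDiagonal_op_smul a (toDiagonal 1)).trans
            ((by simp : (1 : A) * a = a * 1).trans (ofDiagonal_smul a (toDiagonal 1)).symm)
        rw [← op_smul_tmk, h1]
        rfl })
    (LinearMap.ext fun m => one_smul A m)
    (LinearMap.ext fun x => by
      induction x using induction_on with
      | tmk b m =>
        change tmk (toDiagonal 1) (ofDiagonal b • m) = tmk b m
        rw [← op_smul_tmk]
        exact congrArg (fun b' : diagonalBimodule A => tmk b' m)
          ((ofDiagonal_op_smul (ofDiagonal b) (toDiagonal 1)).trans (one_mul _))
      | add x y hx hy => rw [map_add, hx, hy, map_add])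

/-! ### `B ⊗_A M` is finitely generated projective. -/

section Projective

variable {ι : Type*} [Fintype ι] (e : Module.Basis ι ℂ M)

theorem sum_contract_smul_tmk (p : B) (m : M) (x : Env A) :
    ∑ l, contract (dualToHom (e.coord l)) m x • tmk p (e l) = tmk (x • p) m := by
  induction x using Env.induction_on with
  | zero =>
    rw [zero_smul, tmk, TensorProduct.zero_tmul, map_zero]
    exact Finset.sum_eq_zero fun l _ => by rw [map_zero, zero_smul]
  | tmul u v =>
    rw [_root_.tmul_smul, ← smul_tmk, op_smul_tmk]
    conv_rhs => rw [← e.sum_repr (v • m)]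
    change _ = u • mk B M p (∑ l, e.repr (v • m) l • e l)
    rw [map_sum, Finset.smul_sum]
    refine Finset.sum_congr rfl fun l _ => ?_
    rw [contract_tmul, dualToHom_apply, mul_smul]
    refine congrArg (u • ·) ?_
    change algebraMap ℂ A _ • tmk p (e l) = tmk p (algebraMap ℂ A _ • e l)
    rw [← op_smul_tmk, smul_tmk]
    congr 1
    rw [left_smul_def, right_smul_def, algebraMap_tmul_one]
    rfl
  | add x y hx hy =>
    rw [add_smul, add_tmk, ← hx, ← hy, ← Finset.sum_add_distrib]
    exact Finset.sum_congr rfl fun l _ => by rw [map_add, add_smul]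

/-- `B` is a summand of `(A ⊗ A)^m`, so `B ⊗_A M` is a summand of `(A ⊗ M)^m`, which is free of rank
`m * dim M`. -/
theorem exists_retraction [Module.Finite (Env A) B] [Module.Projective (Env A) B]
    (hM : finDimModules A M) :
    ∃ (κ : Type) (_ : Fintype κ) (i : BimoduleTensor B M →ₗ[A] κ → A)
      (r : (κ → A) →ₗ[A] BimoduleTensor B M), r ∘ₗ i = LinearMap.id := by
  have : FiniteDimensional ℂ M := hM
  obtain ⟨m, p, β, hp⟩ := Module.Projective.exists_dualBasis (R := Env A) (P := B)
  let e := Module.finBasis ℂ M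
  let c (k : Fin m) (l : Fin (Module.finrank ℂ M)) : BimoduleTensor B M →ₗ[A] A :=
    liftHom (AddMonoidHom.mk' (fun b => AddMonoidHom.mk'
        (fun x => contract (dualToHom (e.coord l)) x (β k b))
        (fun x x' => contract_add _ _ _ _))
      fun b b' => AddMonoidHom.ext fun x =>
        (congrArg (contract (dualToHom (e.coord l)) x) (map_add (β k) b b')).trans (map_add _ _ _))
      (fun a b x => (congrArg (contract (dualToHom (e.coord l)) x)
        ((β k).map_smul (Env.tmul a 1) b)).trans (contract_left_mul _ _ _ _))
      (fun a b x => (congrArg (contract (dualToHom (e.coord l)) x)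
        ((β k).map_smul (Env.tmul 1 a) b)).trans (contract_right_mul _ _ _ _))
  refine ⟨Fin m × Fin (Module.finrank ℂ M), inferInstance,
    LinearMap.pi fun kl => c kl.1 kl.2,
    Fintype.linearCombination A (fun kl => tmk (p kl.1) (e kl.2)), LinearMap.ext fun x => ?_⟩
  induction x using induction_on with
  | tmk b x =>
    rw [LinearMap.comp_apply, Fintype.linearCombination_apply, Fintype.sum_prod_type]
    change ∑ k, ∑ l, contract (dualToHom (e.coord l)) x (β k b) • tmk (p k) (e l) = tmk b x
    simp only [sum_contract_smul_tmk]
    conv_rhs => rw [hp b]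
    exact (map_sum ((mk B M).flip x) _ _).symm
  | add x y hx hy => rw [map_add, hx, hy, map_add]

theorem projective [Module.Finite (Env A) B] [Module.Projective (Env A) B]
    (hM : finDimModules A M) : Module.Projective A (BimoduleTensor B M) := by
  obtain ⟨κ, _, i, r, h⟩ := exists_retraction (B := B) hM
  exact Module.Projective.of_split i r h

theorem finite [Module.Finite (Env A) B] [Module.Projective (Env A) B]
    (hM : finDimModules A M) : Module.Finite A (BimoduleTensor B M) := by
  obtain ⟨κ, _, i, r, h⟩ := exists_retraction (B := B) hM
  exact Module.Finite.of_surjective r fun x => ⟨i x, LinearMap.congr_fun h x⟩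

end Projective

end BimoduleTensor

end BimoduleTensor

/-! ### Perfect objects of the derived category -/

section PerfectObjects

open scoped ModuleCat
open DerivedCategory Pretriangulated

variable {A : Type u} [Ring A] [Algebra ℂ A]

variable (A) in
/-- The finitely generated projective modules. -/
def fgProjective : ObjectProperty (ModuleCat.{u} A) := fun M =>
  Module.Projective A M ∧ Module.Finite A M

instance : (fgProjective A).IsClosedUnderIsomorphisms where
  of_iso e h := by
    obtain ⟨h, h'⟩ := h
    exact ⟨Module.Projective.of_equiv e.toLinearEquiv, Module.Finite.equiv e.toLinearEquiv⟩

theorem fgProjective_biprod {M N : ModuleCat.{u} A} (hM : fgProjective A M)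
    (hN : fgProjective A N) : fgProjective A (M ⊞ N) := by
  obtain ⟨h1, h2⟩ := hM
  obtain ⟨h3, h4⟩ := hN
  exact (fgProjective A).prop_of_iso (ModuleCat.biprodIsoProd M N).symm
    ⟨inferInstanceAs (Module.Projective A (M × N)), inferInstanceAs (Module.Finite A (M × N))⟩

theorem fgProjective_of_isZero {M : ModuleCat.{u} A} (hM : IsZero M) : fgProjective A M := by
  have := ModuleCat.subsingleton_of_isZero hM
  have : Module.Free A M := Module.Free.of_subsingleton A M
  exact ⟨Module.Projective.of_free, inferInstance⟩

theorem perfectComplexes_mappingCone {K L : CochainComplex (ModuleCat.{u} A) ℤ}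
    (hK : perfectComplexes A K) (hL : perfectComplexes A L) (f : K ⟶ L) :
    perfectComplexes A (CochainComplex.mappingCone f) := by
  obtain ⟨⟨a, b, ha, hb⟩, hK⟩ := hK
  obtain ⟨⟨a', b', ha', hb'⟩, hL⟩ := hL
  refine ⟨⟨min (a - 1) a', max b b', ?_, ?_⟩, fun i => ?_⟩
  · rw [CochainComplex.isStrictlyGE_iff]
    intro i hi
    rw [CochainComplex.mappingCone.isZero_X_iff]
    exact ⟨K.isZero_of_isStrictlyGE a _ (by lia), L.isZero_of_isStrictlyGE a' _ (by lia)⟩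
  · rw [CochainComplex.isStrictlyLE_iff]
    intro i hi
    rw [CochainComplex.mappingCone.isZero_X_iff]
    exact ⟨K.isZero_of_isStrictlyLE b _ (by lia), L.isZero_of_isStrictlyLE b' _ (by lia)⟩
  · exact (fgProjective A).prop_of_iso
      (HomologicalComplex.homotopyCofiber.XIsoBiprod f i (i + 1) rfl).symm
      (fgProjective_biprod (hK (i + 1)) (hL i))

theorem perfectComplexes_shift {K : CochainComplex (ModuleCat.{u} A) ℤ}
    (hK : perfectComplexes A K) (n : ℤ) : perfectComplexes A (K⟦n⟧) := by
  obtain ⟨⟨a, b, ha, hb⟩, hK⟩ := hK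
  exact ⟨⟨a - n, b - n, K.isStrictlyGE_shift a n _ (by lia), K.isStrictlyLE_shift b n _ (by lia)⟩,
    fun i => hK (i + n)⟩

theorem perfectComplexes_single {M : ModuleCat.{u} A} (hM : fgProjective A M) :
    perfectComplexes A ((HomologicalComplex.single _ (ComplexShape.up ℤ) 0).obj M) := by
  refine ⟨⟨0, 0, inferInstance, inferInstance⟩, fun i => ?_⟩
  by_cases hi : i = 0
  · subst hi
    exact (fgProjective A).prop_of_iso
      (HomologicalComplex.singleObjXSelf (ComplexShape.up ℤ) 0 M).symm hM
  · exact fgProjective_of_isZero (HomologicalComplex.isZero_single_obj_X _ _ _ _ hi)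

variable [HasDerivedCategory.{w} (ModuleCat.{u} A)]

variable (A) in
/-- The objects of the derived category that are represented by bounded complexes of finitely
generated projective modules. -/
def perfectObjects : ObjectProperty (DerivedCategory (ModuleCat.{u} A)) := fun X =>
  ∃ K, perfectComplexes A K ∧ Nonempty (Q.obj K ≅ X)

instance : (perfectObjects A).IsClosedUnderIsomorphisms where
  of_iso := by
    rintro X Y e ⟨K, hK, ⟨e'⟩⟩
    exact ⟨K, hK, ⟨e' ≪≫ e⟩⟩

instance : (perfectObjects A).IsStableUnderShift ℤ where
  isStableUnderShiftBy n := ⟨by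
    rintro X ⟨K, hK, ⟨e⟩⟩
    exact ⟨K⟦n⟧, perfectComplexes_shift hK n, ⟨(Q.commShiftIso n).app K ≪≫
      (shiftFunctor (DerivedCategory (ModuleCat.{u} A)) n).mapIso e⟩⟩⟩

instance : (perfectObjects A).ContainsZero where
  exists_zero := ⟨Q.obj ((HomologicalComplex.single _ (ComplexShape.up ℤ) 0).obj
      (ModuleCat.of A PUnit)),
    Functor.map_isZero _ (Functor.map_isZero _ (ModuleCat.isZero_of_subsingleton _)),
    _, perfectComplexes_single (fgProjective_of_isZero (ModuleCat.isZero_of_subsingleton _)),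
    ⟨Iso.refl _⟩⟩

/-- A morphism between perfect complexes in the derived category lifts to a chain map, and the
mapping cone of that chain map is again perfect. -/
instance : (perfectObjects A).IsTriangulatedClosed₃ := .mk' (by
  rintro T hT ⟨K, hK, ⟨e⟩⟩ ⟨L, hL, ⟨e'⟩⟩
  have := hK.isKProjective
  obtain ⟨f, hf⟩ := CochainComplex.IsKProjective.Q_map_surjective K L (e.hom ≫ T.mor₁ ≫ e'.inv)
  obtain ⟨i, -, -⟩ := exists_iso_of_arrow_iso _ _
    (mappingCone_triangle_distinguished f) hT
    (Arrow.isoMk e e' (show e.hom ≫ T.mor₁ = Q.map f ≫ e'.hom by simp [hf]))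
  exact ⟨_, perfectComplexes_mappingCone hK hL f, ⟨Triangle.π₃.mapIso i⟩⟩)

instance : (perfectObjects A).IsTriangulatedClosed₂ := .of_isTriangulatedClosed₃

theorem perfectObjects_single {M : ModuleCat.{u} A} (hM : fgProjective A M) :
    perfectObjects A ((singleFunctor _ 0).obj M) :=
  ⟨_, perfectComplexes_single hM, ⟨Iso.refl _⟩⟩

variable {n : ℕ} {P : ProjectiveResolution (diagonalBimodule A)}

/-- Descending induction along `0 → Ω_{i+1} ⊗ M → P_i ⊗ M → Ω_i ⊗ M → 0` from `Ω_{n+1} = 0`, with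
`k` bounding the number of remaining steps. The case `i = 0` concerns `M` itself. -/
theorem perfectObjects_single_bimoduleTensor (hP : ∀ i, Module.Finite (Env A) (P.complex.X i))
    (hn : ∀ i, n < i → IsZero (P.complex.X i)) {M : ModuleCat.{u} A} (hM : finDimModules A M)
    (k i : ℕ) (hi : n + 1 ≤ i + k) : perfectObjects A ((singleFunctor _ 0).obj
      (ModuleCat.of A (BimoduleTensor (P.complex.opcycles i) M))) := by
  induction k generalizing i with
  | zero =>
    have h := P.isZero_opcycles (hn i (by lia))
    have h' := ModuleCat.subsingleton_of_isZero h
    refine perfectObjects_single (fgProjective_of_isZero ?_)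
    have : Subsingleton (BimoduleTensor (P.complex.opcycles i) M) := by
      refine subsingleton_of_forall_eq 0 fun x => ?_
      induction x using BimoduleTensor.induction_on with
      | tmk b m =>
        rw [Subsingleton.elim b 0, BimoduleTensor.tmk, TensorProduct.zero_tmul]
        rfl
      | add x y hx hy => rw [hx, hy, add_zero]
    exact ModuleCat.isZero_of_subsingleton _
  | succ k ih =>
    have := syzygy_right_projective (P := P) i
    obtain ⟨w', h⟩ := BimoduleTensor.shortExact _ (P.syzygy_shortExact i) M
    have := hP i
    have : Module.Projective (Env A) (P.complex.X i) :=
      (IsProjective.iff_projective _).2 (P.projective i)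
    exact (perfectObjects A).ext_of_isTriangulatedClosed₃ _ h.singleTriangle_distinguished
      (ih (i + 1) (by lia)) (perfectObjects_single
        ⟨BimoduleTensor.projective hM, BimoduleTensor.finite hM⟩)

theorem perfectObjects_single_of_finDim (hP : ∀ i, Module.Finite (Env A) (P.complex.X i))
    (hn : ∀ i, n < i → IsZero (P.complex.X i)) {M : ModuleCat.{u} A} (hM : finDimModules A M) :
    perfectObjects A ((singleFunctor _ 0).obj M) := by
  let e := P.opcyclesZeroIso
  let f : ModuleCat.of A (BimoduleTensor (P.complex.opcycles 0) M) ≅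
      ModuleCat.of A (BimoduleTensor (diagonalBimodule A) M) :=
    { hom := ModuleCat.ofHom (BimoduleTensor.map e.hom M)
      inv := ModuleCat.ofHom (BimoduleTensor.map e.inv M)
      hom_inv_id := ModuleCat.hom_ext (BimoduleTensor.map_map_of_comp_eq_id e.hom_inv_id M)
      inv_hom_id := ModuleCat.hom_ext (BimoduleTensor.map_map_of_comp_eq_id e.inv_hom_id M) }
  exact (perfectObjects A).prop_of_iso ((singleFunctor _ 0).mapIso
    (f ≪≫ LinearEquiv.toModuleIso (X₂ := M) (BimoduleTensor.diagonalEquiv M)))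
    (perfectObjects_single_bimoduleTensor hP hn hM (n + 1) 0 (by lia))

/-- The homology of a single module. -/
noncomputable def homologySingleIso (M : ModuleCat.{u} A) (a : ℤ) :
    (homologyFunctor _ a).obj ((singleFunctor _ a).obj M) ≅ M :=
  (homologyFunctorFactors (ModuleCat.{u} A) a).app
    ((HomologicalComplex.single _ (ComplexShape.up ℤ) a).obj M) ≪≫
    (HomologicalComplex.homologyFunctorSingleIso _ (ComplexShape.up ℤ) a).app M

/-- Dévissage: truncation splits off the lowest cohomology module, and `k` counts the degrees from
`a` to `b`. -/
theorem perfectObjects_of_isGE_of_isLE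
    (h : ∀ M, finDimModules A M → perfectObjects A ((singleFunctor _ 0).obj M)) (k : ℕ) (a b : ℤ)
    (hk : b + 1 = a + k) (X : DerivedCategory (ModuleCat.{u} A)) (ha : X.IsGE a) (hb : X.IsLE b)
    (hX : finDimCohomology A X) : perfectObjects A X := by
  induction k generalizing a b X with
  | zero =>
    exact (perfectObjects A).prop_of_isZero (TStructure.t.isZero X b a (by lia))
  | succ k ih =>
    obtain ⟨X', Y, hX', hY, f, g, δ, hT⟩ := TStructure.t.exists_triangle X a (a + 1) rfl
    have hX' : X'.IsLE a := ⟨hX'⟩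
    have hY : Y.IsGE (a + 1) := ⟨hY⟩
    -- The pieces have no overlapping cohomology, so the long exact sequence breaks up. The
    -- cohomology modules of `X'` and `Y` are then sub- and quotient modules of those of `X`, and
    -- bounds and finite dimension pass to them.
    have hδ (i : ℤ) : HomologySequence.δ (Triangle.mk f g δ) i (i + 1) = 0 := by
      by_cases hi : i ≤ a
      · exact (Y.isZero_of_isGE (a + 1) i (by lia)).eq_of_src _ _
      · exact (X'.isZero_of_isLE a (i + 1) (by lia)).eq_of_tgt _ _
    have hf (i : ℤ) : Mono ((homologyFunctor _ i).map f) := by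
      have := (HomologySequence.mono_homologyMap_mor₁_iff _ hT (i - 1) (i - 1 + 1)).2 (hδ (i - 1))
      rwa [sub_add_cancel] at this
    have hg (i : ℤ) : Epi ((homologyFunctor _ i).map g) :=
      (HomologySequence.epi_homologyMap_mor₂_iff _ hT i (i + 1)).2 (hδ i)
    have hX'' : X'.IsGE a := (isGE_iff _ _).2 fun i hi =>
      IsZero.of_mono ((homologyFunctor _ i).map f) (X.isZero_of_isGE a i hi)
    have hY' : Y.IsLE b := (isLE_iff _ _).2 fun i hi =>
      IsZero.of_epi ((homologyFunctor _ i).map g) (X.isZero_of_isLE b i hi)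
    refine (perfectObjects A).ext_of_isTriangulatedClosed₂ _ hT ?_ (ih (a + 1) b (by lia) Y hY hY'
      fun i => (finDimModules A).prop_of_epi ((homologyFunctor _ i).map g) (hX i))
    obtain ⟨M, ⟨e⟩⟩ := exists_iso_singleFunctor_obj_of_isGE_of_isLE X' a
    have hM : finDimModules A M := (finDimModules A).prop_of_iso
      ((homologyFunctor _ a).mapIso e ≪≫ homologySingleIso M a)
      ((finDimModules A).prop_of_mono ((homologyFunctor _ a).map f) (hX a))
    exact (perfectObjects A).prop_of_iso
      ((((singleFunctors (ModuleCat.{u} A)).shiftIso (-a) a 0 (by lia)).app M) ≪≫ e.symm)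
      ((perfectObjects A).le_shift (-a) _ (h M hM))

theorem exists_perfectFinDim (hP : ∀ i, Module.Finite (Env A) (P.complex.X i))
    (hn : ∀ i, n < i → IsZero (P.complex.X i)) {X : DerivedCategory (ModuleCat.{u} A)}
    (hX : TStructure.t.bounded X) (hX' : finDimCohomology A X) :
    ∃ K, perfectFinDim A K ∧ Nonempty (Q.obj K ≅ X) := by
  obtain ⟨⟨a, ha⟩, ⟨b, hb⟩⟩ := hX
  -- The given bounds may have `b < a`; enlarging `b` keeps the length `max a b + 1 - a` a natural
  -- number.
  have hb' : X.IsLE (max a b) := TStructure.t.isLE_of_le X b _ (le_max_right _ _)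
  obtain ⟨K, hK, ⟨e⟩⟩ := perfectObjects_of_isGE_of_isLE
    (fun M hM => perfectObjects_single_of_finDim hP hn hM) (max a b + 1 - a).toNat a (max a b)
    (by lia) X ha hb' hX'
  exact ⟨K, ⟨hK, fun i => (finDimModules A).prop_of_iso
    ((homologyFunctor _ i).mapIso e.symm ≪≫ (homologyFunctorFactors _ i).app K) (hX' i)⟩, ⟨e⟩⟩

end PerfectObjects

/-! ### Cyclic traces and Calabi-Yau categories -/

section CyclicTraces

/-- An infinite dimension is strictly smaller than that of the dual, so `V ≅ W^*` and `W ≅ V^*`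
would make each dimension exceed the other. -/
theorem Module.finite_of_dual_equiv {K : Type u} {V W : Type v} [Field K] [AddCommGroup V]
    [Module K V] [AddCommGroup W] [Module K W] (e : V ≃ₗ[K] Module.Dual K W)
    (f : W ≃ₗ[K] Module.Dual K V) : Module.Finite K V := by
  by_contra h
  have hW : ¬ Module.Finite K W := fun hW => h (Module.Finite.equiv e.symm)
  rw [← Module.rank_lt_aleph0_iff, not_lt] at h hW
  have h1 := lift_rank_lt_rank_dual h
  have h2 := lift_rank_lt_rank_dual hW
  have h3 := e.lift_rank_eq
  have h4 := f.lift_rank_eq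
  rw [Cardinal.lift_id'.{v}] at h3 h4
  have h5 := congrFun Cardinal.lift_umax.{v, u} (Module.rank K V)
  have h6 := congrFun Cardinal.lift_umax.{v, u} (Module.rank K W)
  exact lt_asymm (h1.trans_eq (h4.symm.trans h6)) (h2.trans_eq (h3.symm.trans h5))

variable (k : Type*) [Field k] {D : Type*} [Category* D] [Preadditive D] [Linear k D]
  [HasShift D ℤ]

/-- A system of linear forms `t_X : Hom(X, X[n]) → k` for the objects `X` with the property `R`,
with `t_X(fg) = t_Y(g f[n])`, which induces perfect pairings
`Hom(X, Y) × Hom(Y, X[n]) → k`. -/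
def HasCyclicTrace (R : ObjectProperty D) (n : ℤ) : Prop :=
  ∃ t : ∀ X : D, R X → ((X ⟶ X⟦n⟧) →ₗ[k] k),
    (∀ (X Y : D) (hX : R X) (hY : R Y) (f : X ⟶ Y) (g : Y ⟶ X⟦n⟧),
      t X hX (f ≫ g) = t Y hY (g ≫ f⟦n⟧')) ∧
    (∀ (X Y : D) (hX : R X) (_ : R Y) (g : Y ⟶ X⟦n⟧), (∀ f, t X hX (f ≫ g) = 0) → g = 0) ∧
    (∀ (X Y : D) (hX : R X) (_ : R Y) (θ : (X ⟶ Y) →ₗ[k] k), ∃ g, ∀ f, t X hX (f ≫ g) = θ f)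

variable {k} {R : ObjectProperty D} {n : ℤ}

namespace HasCyclicTrace

theorem exists_equiv (h : HasCyclicTrace k R n) : ∃ t : ∀ X : D, R X → ((X ⟶ X⟦n⟧) →ₗ[k] k),
    (∀ (X Y : D) (hX : R X) (hY : R Y) (f : X ⟶ Y) (g : Y ⟶ X⟦n⟧),
      t X hX (f ≫ g) = t Y hY (g ≫ f⟦n⟧')) ∧
    ∀ (X Y : D) (hX : R X) (_ : R Y), ∃ e : (Y ⟶ X⟦n⟧) ≃ₗ[k] Module.Dual k (X ⟶ Y),
      ∀ g f, e g f = t X hX (f ≫ g) := by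
  obtain ⟨t, h1, h2, h3⟩ := h
  refine ⟨t, h1, fun X Y hX hY => ⟨LinearEquiv.ofBijective
    ((Linear.comp (S := k) X Y (X⟦n⟧)).flip.compr₂ (t X hX)) ⟨?_, fun θ => ?_⟩, fun g f => rfl⟩⟩
  · rw [← LinearMap.ker_eq_bot, LinearMap.ker_eq_bot']
    exact fun g hg => h2 X Y hX hY g fun f => LinearMap.congr_fun hg f
  · obtain ⟨g, hg⟩ := h3 X Y hX hY θ
    exact ⟨g, LinearMap.ext hg⟩

/-- The pairing used twice makes `Hom(X, Y) ≅ Hom(X[n], Y[n]) ≅ Hom(Y, X[n])^*` and `Hom(Y, X[n]) ≅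
Hom(X, Y)^*` mutually dual. -/
theorem finite [∀ n : ℤ, (shiftFunctor D n).Additive] [∀ n : ℤ, (shiftFunctor D n).Linear k]
    [R.IsStableUnderShift ℤ] (h : HasCyclicTrace k R n) {X Y : D} (hX : R X) (hY : R Y) :
    FiniteDimensional k (X ⟶ Y) := by
  obtain ⟨t, -, h⟩ := h.exists_equiv
  obtain ⟨e, -⟩ := h X Y hX hY
  obtain ⟨e', -⟩ := h Y (X⟦n⟧) hY (R.le_shift n _ hX)
  let s : (X ⟶ Y) ≃ₗ[k] (X⟦n⟧ ⟶ Y⟦n⟧) :=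
    LinearEquiv.ofBijective ((shiftFunctor D n).mapLinearMap k)
      ⟨(shiftFunctor D n).map_injective, (shiftFunctor D n).map_surjective⟩
  exact Module.finite_of_dual_equiv (s.trans e') e

/-- Full faithfulness and compatibility with shifts pull the pairings back to `C`. Naturality in `Y`
is associativity of composition, and naturality in `X` is cyclicity of the trace. -/
theorem isCalabiYau [∀ n : ℤ, (shiftFunctor D n).Additive]
    [∀ n : ℤ, (shiftFunctor D n).Linear k] [R.IsStableUnderShift ℤ]
    (h : HasCyclicTrace k R n) {C : Type*} [Category* C] [Preadditive C] [Linear k C]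
    [HasShift C ℤ] (F : C ⥤ D) [F.Full] [F.Faithful] [F.Additive] [F.Linear k] [F.CommShift ℤ]
    (hF : ∀ X, R (F.obj X)) : IsCalabiYau k C n := by
  have hfin (X Y : C) : FiniteDimensional k (X ⟶ Y) := by
    have := h.finite (hF X) (hF Y)
    exact FiniteDimensional.of_injective (F.mapLinearMap k) F.map_injective
  obtain ⟨t, h1, h⟩ := h.exists_equiv
  choose e he using fun X Y : C => h (F.obj X) (F.obj Y) (hF X) (hF Y)
  let s (X Y : C) : (X ⟶ Y) ≃ₗ[k] (F.obj X ⟶ F.obj Y) :=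
    LinearEquiv.ofBijective (F.mapLinearMap k) ⟨F.map_injective, F.map_surjective⟩
  let c (X Y : C) : (Y ⟶ X⟦n⟧) ≃ₗ[k] (F.obj Y ⟶ (F.obj X)⟦n⟧) :=
    (s Y (X⟦n⟧)).trans (Linear.homCongr k (Iso.refl _) ((F.commShiftIso n).app X))
  have hc (X Y : C) (g : Y ⟶ X⟦n⟧) : c X Y g = F.map g ≫ (F.commShiftIso n).hom.app X := by
    refine (Linear.homCongr_apply k (Iso.refl _) ((F.commShiftIso n).app X) (F.map g)).trans ?_
    simp
  -- The trace identifies `Hom(Y, X[n])` with the dual of `Hom(X, Y)`; transposing and using finite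
  -- dimension gives the direction required of a Serre functor.
  let ν (X Y : C) : (X ⟶ Y) ≃ₗ[k] Module.Dual k (Y ⟶ X⟦n⟧) :=
    (Module.evalEquiv k (X ⟶ Y)).trans
      ((c X Y).trans ((e X Y).trans (s X Y).dualMap)).dualMap
  have hν (X Y : C) (f : X ⟶ Y) (g : Y ⟶ X⟦n⟧) :
      ν X Y f g = t (F.obj X) (hF X) (F.map (f ≫ g) ≫ (F.commShiftIso n).hom.app X) := by
    rw [F.map_comp, Category.assoc, ← hc, ← he]
    rfl
  refine ⟨inferInstance, hfin, ν, fun {X X' Y} f g h => ?_, fun {X Y Y'} g u h => ?_⟩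
  · rw [hν, hν]
    have h2 := h1 _ _ (hF X') (hF X) (F.map f) (F.map (g ≫ h) ≫ (F.commShiftIso n).hom.app X')
    have h3 := (F.commShiftIso n).hom.naturality f
    rw [Category.assoc] at h2
    refine Eq.trans ?_ (h2.trans ?_)
    · rw [Category.assoc, F.map_comp, Category.assoc]
    · refine congrArg _ ?_
      rw [← Category.assoc g h, F.map_comp (g ≫ h), Category.assoc]
      exact congrArg (F.map (g ≫ h) ≫ ·) h3.symm
  · rw [hν, hν, Category.assoc]

end HasCyclicTrace

end CyclicTraces

/-! ### The cyclic trace on bounded objects with finite dimensional cohomology. -/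

section CalabiYau

open scoped ModuleCat
open DerivedCategory

variable {A : Type u} [Ring A] [Algebra ℂ A] [HasDerivedCategory.{w} (ModuleCat.{u} A)]
  {n : ℕ} {P : ProjectiveResolution (diagonalBimodule A)}

/-- Choose a perfect model `K` of each object `X` and transport the derived trace along `X ≅ K` and
`X[n] ≅ K[n] ≅ νK`. -/
theorem hasCyclicTrace (hP : ∀ i, Module.Finite (Env A) (P.complex.X i)) (hsd : IsSelfdual P n) :
    HasCyclicTrace ℂ (TStructure.t.bounded ⊓ finDimCohomology A) n := by
  choose K hK e using fun (X : DerivedCategory (ModuleCat.{u} A))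
    (hX : (TStructure.t.bounded ⊓ finDimCohomology A) X) =>
      exists_perfectFinDim hP hsd.1 hX.1 hX.2
  replace e := fun X hX => (e X hX).some
  obtain ⟨φ⟩ := nakFunctor_iso_shift n P hP hsd
  let φ' (X) (hX) : (Q.obj (K X hX))⟦(n : ℤ)⟧ ≅ Q.obj (nakayamaComplex.obj (K X hX)) :=
    φ.symm.app ⟨K X hX, hK X hX⟩
  have hφ {X Y} (hX hY) (f : K X hX ⟶ K Y hY) : (φ' X hX).hom ≫ Q.map (nakayamaComplex.map f) =
      (Q.map f)⟦(n : ℤ)⟧' ≫ (φ' Y hY).hom :=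
    (φ.inv.naturality (ObjectProperty.homMk f :
      (⟨K X hX, hK X hX⟩ : (perfectFinDim A).FullSubcategory) ⟶ ⟨K Y hY, hK Y hY⟩)).symm
  let c (X) (hX) : X⟦(n : ℤ)⟧ ≅ Q.obj (nakayamaComplex.obj (K X hX)) :=
    (shiftFunctor _ (n : ℤ)).mapIso (e X hX).symm ≪≫ φ' X hX
  refine ⟨fun X hX => derivedTrace (hK X hX).1 ∘ₗ
    (Linear.homCongr ℂ (e X hX).symm (c X hX)).toLinearMap, ?_, ?_, ?_⟩
  · intro X Y hX hY f g
    have := (hK X hX).1.isKProjective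
    obtain ⟨f', hf'⟩ := CochainComplex.IsKProjective.Q_map_surjective (K X hX) (K Y hY)
      ((e X hX).hom ≫ f ≫ (e Y hY).inv)
    have h1 := derivedTrace_comp (hK X hX).1 (hK Y hY).1 f' ((e Y hY).hom ≫ g ≫ (c X hX).hom)
    -- Naturality of `νK ≅ K[n]` replaces `ν f'` by the shift of `f`; this turns cyclicity of the
    -- derived trace into the required form.
    have h2 : (c X hX).hom ≫ Q.map (nakayamaComplex.map f') = f⟦(n : ℤ)⟧' ≫ (c Y hY).hom := by
      change ((e X hX).inv⟦(n : ℤ)⟧' ≫ (φ' X hX).hom) ≫ Q.map (nakayamaComplex.map f') =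
        f⟦(n : ℤ)⟧' ≫ (e Y hY).inv⟦(n : ℤ)⟧' ≫ (φ' Y hY).hom
      rw [Category.assoc, hφ, hf', ← Functor.map_comp_assoc, ← Functor.map_comp_assoc,
        Iso.inv_hom_id_assoc]
    rw [Category.assoc, Category.assoc, h2, hf', Category.assoc, Category.assoc,
      Iso.inv_hom_id_assoc] at h1
    simp only [LinearMap.comp_apply, LinearEquiv.coe_coe, Linear.homCongr_apply, Iso.symm_inv,
      Category.assoc]
    exact h1
  · intro X Y hX hY g h
    have h1 := eq_zero_of_derivedTrace (hK X hX).1 (hK Y hY).1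
      ((e Y hY).hom ≫ g ≫ (c X hX).hom) fun f => by
        have h2 := h ((e X hX).inv ≫ f ≫ (e Y hY).hom)
        simp only [LinearMap.comp_apply, LinearEquiv.coe_coe, Linear.homCongr_apply,
          Iso.symm_inv, Category.assoc, Iso.hom_inv_id_assoc] at h2
        exact h2
    rw [← cancel_epi (e Y hY).hom, ← cancel_mono (c X hX).hom, Category.assoc, h1]
    simp
  · intro X Y hX hY θ
    obtain ⟨g, hg⟩ := exists_derivedTrace_comp_eq (hK X hX).1 (L := K Y hY)
      (θ ∘ₗ (Linear.homCongr ℂ (e X hX) (e Y hY)).toLinearMap)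
    refine ⟨(e Y hY).inv ≫ g ≫ (c X hX).inv, fun f => ?_⟩
    have h1 := hg ((e X hX).hom ≫ f ≫ (e Y hY).inv)
    simp only [LinearMap.comp_apply, LinearEquiv.coe_coe, Linear.homCongr_apply,
      Iso.symm_inv, Category.assoc, Iso.inv_hom_id_assoc, Iso.inv_hom_id,
      Category.comp_id] at h1 ⊢
    exact h1

section

variable (A) [HasDerivedCategory.{w'} (FinRep A)]

noncomputable instance : (fromBoundedFinRep A).CommShift ℤ :=
  inferInstanceAs ((Bounded.ι ⋙ (finDimModules A).ι.mapDerivedCategory).CommShift ℤ)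

instance : (fromBoundedFinRep A).Additive :=
  inferInstanceAs (Bounded.ι ⋙ (finDimModules A).ι.mapDerivedCategory).Additive

instance : (fromBoundedFinRep A).Linear ℂ :=
  inferInstanceAs ((Bounded.ι ⋙ (finDimModules A).ι.mapDerivedCategory).Linear ℂ)

end

/-- A bounded object is represented by a strictly bounded complex in `FinRep A`, and the exact
inclusion preserves its cohomology, which is finite dimensional. -/
theorem fromBoundedFinRep_obj [HasDerivedCategory.{w'} (FinRep A)]
    (X : Bounded (FinRep A)) :
    (TStructure.t.bounded ⊓ finDimCohomology A) ((fromBoundedFinRep A).obj X) := by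
  obtain ⟨X, ⟨a, ha⟩, ⟨b, hb⟩⟩ := X
  obtain ⟨K, hKa, hKb, ⟨e⟩⟩ := X.exists_iso_Q_obj_of_isGE_of_isLE a b
  let K' : CochainComplex (ModuleCat.{u} A) ℤ :=
    ((finDimModules A).ι.mapHomologicalComplex (ComplexShape.up ℤ)).obj K
  let e' : (fromBoundedFinRep A).obj ⟨X, ⟨a, ha⟩, ⟨b, hb⟩⟩ ≅ Q.obj K' :=
    (finDimModules A).ι.mapDerivedCategory.mapIso e ≪≫
      (finDimModules A).ι.mapDerivedCategoryFactors.app K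
  have h1 : K'.IsStrictlyGE a := inferInstance
  have h2 : K'.IsStrictlyLE b := inferInstance
  refine ⟨⟨⟨a, TStructure.t.isGE_of_iso e'.symm a⟩, ⟨b, TStructure.t.isLE_of_iso e'.symm b⟩⟩,
    fun i => ?_⟩
  exact (finDimModules A).prop_of_iso
    ((homologyFunctor _ i).mapIso e' ≪≫ (homologyFunctorFactors _ i).app K' ≪≫
      ((K.sc i).mapHomologyIso (finDimModules A).ι)).symm (K.homology i).property

end CalabiYau

theorem mainTheorem3
    -- a finite quiver with vertex set `V`
    (V : Type v) [Fintype V] [Quiver.{v' + 1} V] [∀ i j : V, Finite (i ⟶ j)]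
    -- a graded quotient `A` of its path algebra
    (A : Type u) [Ring A] [Algebra ℂ A]
    (π : PathAlgebra V →ₐ[ℂ] A) (hπ : Function.Surjective π) (hgr : PathAlgebra.HasGradedKernel π)
    -- a selfdual resolution of length `n` with entries in `𝒫`
    (n : ℕ) (P : ProjectiveResolution (diagonalBimodule A))
    (hP : ∀ i, IsStandardBimodule (PathAlgebra.degreeZero π) (P.complex.X i))
    (hsd : IsSelfdual P n)
    -- models of the derived categories of `Mod A` and `Rep A`
    [HasDerivedCategory.{w} (ModuleCat.{u} A)] [HasDerivedCategory.{w'} (FinRep A)] :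
    IsCalabiYau ℂ (BoundedFinDim A) n ∧
    ((fromBoundedFinRep A).Full → (fromBoundedFinRep A).Faithful →
      IsCalabiYau ℂ (DerivedCategory.Bounded (FinRep A)) n) := by
  have h := hasCyclicTrace (fun i => (hP i).finite) hsd
  refine ⟨h.isCalabiYau (ObjectProperty.ι _) fun X => X.property, fun hF hF' => ?_⟩
  exact h.isCalabiYau (fromBoundedFinRep A) fromBoundedFinRep_obj
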